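/- Let $n\in\mathbb N$ and let $N^{n+1}=f^{-1}(c)\subset S^{n+2}\subset\mathbb R^{n+3}$ be a minimal isoparametric hypersurface, i.e. $f:S^{n+2}\to\mathbb R$ is a nonconstant smooth function with $|\nabla f|^2=b(f)$ and $\Delta_{S^{n+2}}f=a(f)$ for smooth functions $a,b$, the number $c$ is an attained regular value of $f$, and the shape operator of $N$ in $S^{n+2}$ has trace zero. Assume that $N$ has exactly $g=4$ distinct principal curvatures $\kappa_1>\kappa_2>\kappa_3>\kappa_4$ (with respect to the unit normal $\nabla f/|\nabla f|$), where $\kappa_1,\kappa_2$ have multiplicities $m_1,m_2$. Put $q=\min\{m_1,m_2\}$ and $s=m_1+m_2$. For orthonormal $X,\nu\in T_pN$ let $$\Delta(X,\nu)=\sum_{k=1}^n R^N(e_k,X,e_k,X)+\operatorname{Ric}_N(\nu,\nu)|X|^2-\sum_{k=1}^n|\Pi(e_k,X)|^2-\sum_{k=1}^n|\Pi(e_k,\nu)|^2|X|^2,$$ where $R^N$ and $\operatorname{Ric}_N$ are the curvature and Ricci tensors of $N$ (with $R^N(u,v,u,v)$ the sectional curvature of an orthonormal pair), $\Pi$ is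 the second fundamental form of $N$ in $\mathbb R^{n+3}$, and $e_1,\dots,e_n$ is an orthonormal basis of $\nu^\perp\subset T_pN$. Then: (1) Let $p\in N$ and let $\mu$ be a principal curvature of $N$ at $p$ of largest absolute value. Then $\mu$ has multiplicity $q$, $$\mu^2=\frac{1+\sqrt{1-q/s}}{1-\sqrt{1-q/s}},$$ every orthonormal pair $X,\nu$ in the eigenspace of $\mu$ satisfies $\Delta(X,\nu)=(2n-2)-4\mu^2$, and $(2n-2)-4\mu^2>0$ if and only if $q>4-4/s$. (2) $\Delta(X,\nu)>0$ for every $p\in N$ and every orthonormal pair $X,\nu\in T_pN$ if and only if $\min\{m_1,m_2\}\ge 4$. In particular, this pointwise positivity forces $\min\{m_1,m_2\}\ge 4$. -/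

import Mathlib

noncomputable section

namespace SphereHypersurface

open scoped Manifold ContDiff EuclideanSpace

/-- The Euclidean space `ℝ^(n+3)`. -/
abbrev Ambient (n : ℕ) : Type := EuclideanSpace ℝ (Fin (n + 3))

/-- The unit sphere `S^(n+2)` in `ℝ^(n+3)`. -/
abbrev UnitSphere (n : ℕ) : Type := Metric.sphere (0 : Ambient n) 1

variable {n : ℕ}

/-- The extension of a function on the unit sphere to `ℝ^(n+3) ∖ {0}` that is constant along rays
(with the irrelevant value `0` at the origin). -/
def radialExt (f : UnitSphere n → ℝ) (x : Ambient n) : ℝ :=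
  open Classical in
  if hx : x = 0 then 0 else f ⟨‖x‖⁻¹ • x, by simp [norm_smul, hx]⟩

/-- The gradient vector field of the radial extension. At a point of the unit sphere it is tangent
to the sphere and equals the Riemannian gradient of `f` on the sphere. -/
def grad (f : UnitSphere n → ℝ) (x : Ambient n) : Ambient n :=
  gradient (radialExt f) x

/-- The Laplace–Beltrami operator of the unit sphere: at a point of the unit sphere, the Euclidean
Laplacian of the extension of `f` that is constant along rays. -/
def sphereLaplacian (f : UnitSphere n → ℝ) (p : UnitSphere n) : ℝ :=
  Laplacian.laplacian (radialExt f) (p : Ambient n)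

/-- Isoparametric functions on the unit sphere: nonconstant smooth functions `f` with
`|∇f|² = b(f)` and `Δf = a(f)` for smooth functions `a` and `b`. -/
structure IsIsoparametric (f : UnitSphere n → ℝ) : Prop where
  smooth : ContMDiff (𝓡 (n + 2)) 𝓘(ℝ, ℝ) ∞ f
  nonconstant : ∃ x y, f x ≠ f y
  gradient_eq : ∃ b : ℝ → ℝ, ContDiff ℝ ∞ b ∧ ∀ p : UnitSphere n, ‖grad f p‖ ^ 2 = b (f p)
  laplacian_eq : ∃ a : ℝ → ℝ, ContDiff ℝ ∞ a ∧ ∀ p : UnitSphere n, sphereLaplacian f p = a (f p)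

/-- `c` is a regular value of `f` that is attained, so that `f⁻¹(c)` is a (nonempty) smooth closed
hypersurface of the unit sphere. -/
def IsAttainedRegularValue (f : UnitSphere n → ℝ) (c : ℝ) : Prop :=
  (∃ p, f p = c) ∧ ∀ p : UnitSphere n, f p = c → grad f p ≠ 0

/-- The tangent space at `y` of the level set of `f` through `y`, for `y` in the unit sphere. For
other `y ≠ 0` it is the same space as at `y / |y|`, which extends the tangent
distribution of the level sets to an open set of `ℝ^(n+3)`. -/
def tangentSpace (f : UnitSphere n → ℝ) (y : Ambient n) : Submodule ℝ (Ambient n) :=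
  (Submodule.span ℝ {y, grad f y})ᗮ

/-- The unit normal field `∇f / |∇f|` of the level sets of `f` in the sphere. -/
def unitNormal (f : UnitSphere n → ℝ) (y : Ambient n) : Ambient n :=
  ‖grad f y‖⁻¹ • grad f y

/-- The shape operator `A v = -(D_v η)ᵀ` of the level set of `f` through `p` in the unit sphere, for
the unit normal field `η = ∇f / |∇f|`. -/
def shapeOperator (f : UnitSphere n → ℝ) (p : UnitSphere n) :
    tangentSpace f p →ₗ[ℝ] tangentSpace f p :=
  -((tangentSpace f p).orthogonalProjectionOnto ∘L fderiv ℝ (unitNormal f) p ∘L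
    (tangentSpace f p).subtypeL).toLinearMap

/-- The set of principal curvatures at `p`. -/
def principalCurvatures (f : UnitSphere n → ℝ) (p : UnitSphere n) : Set ℝ :=
  {μ | Module.End.HasEigenvalue (shapeOperator f p) μ}

/-- The space of principal vectors at `p` for the principal curvature `μ`. -/
def curvatureSpace (f : UnitSphere n → ℝ) (p : UnitSphere n) (μ : ℝ) :
    Submodule ℝ (tangentSpace f p) :=
  Module.End.eigenspace (shapeOperator f p) μ

/-- The multiplicity of the principal curvature `μ` at `p`. -/
def multiplicity (f : UnitSphere n → ℝ) (p : UnitSphere n) (μ : ℝ) : ℕ :=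
  Module.finrank ℝ (curvatureSpace f p μ)

/-- The level set `f⁻¹(c)` is a minimal hypersurface of the unit sphere. -/
def IsMinimalLevel (f : UnitSphere n → ℝ) (c : ℝ) : Prop :=
  ∀ p, f p = c → LinearMap.trace ℝ _ (shapeOperator f p) = 0

/-- At every point `f⁻¹(c)` has exactly four distinct principal curvatures
`κ₁ > κ₂ > κ₃ > κ₄`, and `κ₁`, `κ₂` have multiplicities `m₁`, `m₂`. -/
def HasFourPrincipalCurvatures (f : UnitSphere n → ℝ) (c : ℝ) (m₁ m₂ : ℕ) : Prop :=
  ∀ p, f p = c → ∃ κ : Fin 4 → ℝ, StrictAnti κ ∧ principalCurvatures f p = Set.range κ ∧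
    multiplicity f p (κ 0) = m₁ ∧ multiplicity f p (κ 1) = m₂

/-- The extension of the vector `v` to a vector field tangent to the level sets of `f`, by
orthogonal projection to their tangent spaces. -/
def tangentField (f : UnitSphere n → ℝ) (v y : Ambient n) : Ambient n :=
  (tangentSpace f y).starProjection v

/-- The Levi-Civita connection `∇_V W = (D_V W)ᵀ` of the level sets of `f`: the tangential
part of the Euclidean derivative. -/
def covDeriv (f : UnitSphere n → ℝ) (V W : Ambient n → Ambient n) (y : Ambient n) : Ambient n :=
  (tangentSpace f y).starProjection (fderiv ℝ W y (V y))

/-- The curvature operator `R(U, V) W = ∇_U ∇_V W - ∇_V ∇_U W - ∇_[U,V] W` of the level sets, for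
vector fields tangent to them. -/
def curvatureOp (f : UnitSphere n → ℝ) (U V W : Ambient n → Ambient n) (y : Ambient n) :
    Ambient n :=
  covDeriv f U (covDeriv f V W) y - covDeriv f V (covDeriv f U W) y -
    covDeriv f (VectorField.lieBracket ℝ U V) W y

/-- The Riemann curvature tensor `R^N(u, v, w, z) = ⟨R(u, v) z, w⟩` at `p` of the level set `N`
through `p`, so that `R^N(u, v, u, v)` is the sectional curvature of an orthonormal pair. By
tensoriality it may be computed with any tangential extensions of the tangent vectors. -/
def riemann (f : UnitSphere n → ℝ) (p : UnitSphere n) (u v w z : Ambient n) : ℝ :=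
  inner ℝ (curvatureOp f (tangentField f u) (tangentField f v) (tangentField f z) p) w

/-- The Ricci tensor of the level set through `p`: the trace of the curvature tensor over an
orthonormal basis of the tangent space. -/
def ricci (f : UnitSphere n → ℝ) (p : UnitSphere n) (u v : Ambient n) : ℝ :=
  ∑ i, riemann f p (stdOrthonormalBasis ℝ (tangentSpace f p) i) u
    (stdOrthonormalBasis ℝ (tangentSpace f p) i) v

/-- The second fundamental form `Π(u, v) = (D_u V)^⊥` at `p` of the level set through `p`, as a
submanifold of `ℝ^(n+3)`, where `V` is a tangential extension of the tangent vector `v`. -/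
def secondFF (f : UnitSphere n → ℝ) (p : UnitSphere n) (u v : Ambient n) : Ambient n :=
  (tangentSpace f p)ᗮ.starProjection (fderiv ℝ (tangentField f v) p u)

/-- For a unit tangent vector `ν` of the level set `N` at `p`, the tangent space at `p` of
a hypersurface of `N` with unit normal `ν`. -/
def normalComplement (f : UnitSphere n → ℝ) (p : UnitSphere n) (ν : Ambient n) :
    Submodule ℝ (Ambient n) :=
  tangentSpace f p ⊓ (Submodule.span ℝ {ν})ᗮ

/-- The pointwise Ambrozio–Carlotto–Sharp quantity
`Δ(X, ν) = ∑ₖ R^N(eₖ, X, eₖ, X) + Ric_N(ν, ν) |X|² - ∑ₖ |Π(eₖ, X)|² - ∑ₖ |Π(eₖ, ν)|² |X|²`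
at `p` of the level set `N` of `f` through `p`, where `(eₖ)` is an orthonormal basis of the
orthogonal complement of `ν` in the tangent space of `N`. -/
def acsDelta (f : UnitSphere n → ℝ) (p : UnitSphere n) (X ν : Ambient n) : ℝ :=
  let e := stdOrthonormalBasis ℝ (normalComplement f p ν)
  ∑ k, riemann f p (e k) X (e k) X + ricci f p ν ν * ‖X‖ ^ 2
    - ∑ k, ‖secondFF f p (e k) X‖ ^ 2 - ∑ k, ‖secondFF f p (e k) ν‖ ^ 2 * ‖X‖ ^ 2

end SphereHypersurface

end

/-! ### One-variable tools: singular ODE uniqueness, flatness, reflection -/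

section

open Set Filter Topology
open scoped InnerProductSpace

/-! The whole statement rests on Münzner's structure of the four principal curvatures, proved here
analytically for a minimal level. Let `E` be the radial extension of `f`, and follow the great
circle leaving `p` in the direction of the gradient up to the first zero `T` of the derivative of
`E` along it. On that arc the gradient stays tangent to the circle, `E` satisfies an autonomous
second order equation, and a Riccati equation makes the Hessian act on a principal vector of
curvature κ by the logarithmic derivative of `cos t - κ sin t`. The Laplacian condition then becomes
one scalar equation along the circle (`RadialIsoparametric.laplacian_along`).

Minimality makes the sum of these logarithmic derivatives negative after time 0, which forces `cot T
= κ 0` (`NormalProfile.jacobi_zero_eq_zero`). The solution of the autonomous equation extends evenly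
and smoothly past `T`. With denominators cleared, the Laplacian equation is a smooth function
vanishing on one side of `T`, hence flat there. Combining its values on the two sides, so that the
unknown coefficient function drops out, leaves a quadratic polynomial in `sin² τ` that vanishes to
third order in `sin² τ`. So it is zero, and the curvatures seen from the focal point are symmetric
with equal multiplicities (`NormalProfile.reflection_symmetry`). The same argument for `-E` treats
the other end of the spectrum. Together these give `κ 0 * κ 2 = κ 1 * κ 3 = -1`, the multiplicity
pattern m₁, m₂, m₁, m₂, and a cotangent relation. With the trace condition, `k` (the largest
absolute value) and `-l` (the opposite end, up to a common sign) satisfy `(k - 1) * (l - 1) = 2` and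
`q * (k ^ 2 + 1) ^ 2 = 4 * s * k ^ 2`. This is part (1), up to the value of Δ.

The Gauss equation expresses Δ through the shape operator `A` alone (`acsDelta_eq`). For `q ≥ 4` one
has `4 * k ^ 2 + 4 ≤ 2 * n - 2`; bounding `‖A x‖ ^ 2` linearly in `⟪A x, x⟫` reduces positivity to a
two-variable inequality (`extremal_bound`). Conversely, for `q` equal to 2 or 3 a pair in the
extremal eigenspace violates positivity. For `q = 1` that eigenspace is a line, and its unit vector
is paired with one of curvature `-1/μ`. -/

theorem eq_zero_of_norm_smul_deriv_le {E : Type*} [NormedAddCommGroup E] [NormedSpace ℝ E]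
    {Z Z' : ℝ → E} {φ C : ℝ → ℝ} {T : ℝ}
    (hZ : ∀ t ∈ Ico 0 T, HasDerivAt Z (Z' t) t)
    (hφ : ContinuousOn φ (Ico 0 T)) (hφ0 : ∀ t ∈ Ico 0 T, 0 < φ t)
    (hC : ContinuousOn C (Ico 0 T))
    (h : ∀ t ∈ Ico 0 T, ‖φ t • Z' t‖ ≤ C t * ‖Z t‖) (h0 : Z 0 = 0) :
    ∀ t ∈ Ico 0 T, Z t = 0 := by
  intro t ht
  -- Since `φ` may vanish at `T`, Grönwall is applied only on `[0, t]` with `t < T`, where `C / φ`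
  -- is bounded.
  have hsub : Icc 0 t ⊆ Ico 0 T := fun s hs => ⟨hs.1, hs.2.trans_lt ht.2⟩
  have hcont : ContinuousOn (fun s => C s / φ s) (Icc 0 t) :=
    (hC.mono hsub).div (hφ.mono hsub) fun s hs => (hφ0 s (hsub hs)).ne'
  obtain ⟨K, hK⟩ := (isCompact_Icc.image_of_continuousOn hcont).bddAbove
  refine eq_zero_of_abs_deriv_le_mul_abs_self_of_eq_zero_right
    (K := K) (f' := Z') (fun s hs => (hZ s (hsub hs)).continuousAt.continuousWithinAt)
    (fun s hs => (hZ s (hsub ⟨hs.1, hs.2.le⟩)).hasDerivWithinAt) h0 ?_ t ⟨ht.1, le_rfl⟩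
  intro s hs
  have hs' := hsub ⟨hs.1, hs.2.le⟩
  have hp := hφ0 s hs'
  have h1 := h s hs'
  rw [norm_smul, Real.norm_eq_abs, abs_of_pos hp] at h1
  have h2 : C s / φ s ≤ K := hK ⟨s, ⟨hs.1, hs.2.le⟩, rfl⟩
  calc ‖Z' s‖ ≤ C s / φ s * ‖Z s‖ := by
        rw [div_mul_eq_mul_div, le_div_iff₀ hp]; linarith
    _ ≤ K * ‖Z s‖ := by gcongr

/-- A smooth function vanishing on the right of `0` is flat at `0`. -/
theorem exists_bound_pow_of_eq_zero_right {r : ℝ} (hr : 0 < r) (k : ℕ) :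
    ∀ Q : ℝ → ℝ, ContDiffOn ℝ k Q (Ioo (-r) r) → (∀ t ∈ Ioo 0 r, Q t = 0) →
    ∃ δ > 0, δ < r ∧ ∃ C, ∀ t ∈ Ioo 0 δ, |Q (-t)| ≤ C * t ^ k := by
  induction k with
  | zero =>
    intro Q hQ _
    have hc : ContinuousOn Q (Icc (-(r/2)) (r/2)) :=
      hQ.continuousOn.mono fun t ht => ⟨by linarith [ht.1], by linarith [ht.2]⟩
    obtain ⟨K, hK⟩ := isCompact_Icc.exists_bound_of_continuousOn hc
    exact ⟨r/2, by linarith, by linarith, K, fun t ht => by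
      simpa using hK (-t) ⟨by linarith [ht.2], by linarith [ht.1]⟩⟩
  | succ k ih =>
    intro Q hQ h0
    have hQ' : ContDiffOn ℝ (k + 1) Q (Ioo (-r) r) := by exact_mod_cast hQ
    obtain ⟨hd, -, hQd⟩ := (contDiffOn_succ_iff_deriv_of_isOpen isOpen_Ioo).1 hQ'
    obtain ⟨δ, hδ, hδr, C, hC⟩ := ih (deriv Q) hQd (by
      intro t ht
      have : Q =ᶠ[𝓝 t] fun _ => 0 := by
        filter_upwards [isOpen_Ioo.mem_nhds ht] with s hs using h0 s hs
      rw [this.deriv_eq]; simp)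
    have hQ0 : Q 0 = 0 := by
      have h1 : Tendsto Q (𝓝[>] 0) (𝓝 (Q 0)) :=
        ((hQ.continuousOn.continuousAt (isOpen_Ioo.mem_nhds (by simp [hr]))).tendsto).mono_left
          nhdsWithin_le_nhds
      have h2 : Tendsto Q (𝓝[>] 0) (𝓝 0) := by
        refine tendsto_const_nhds.congr' ?_
        filter_upwards [Ioo_mem_nhdsGT hr] with s hs using (h0 s hs).symm
      exact tendsto_nhds_unique h1 h2
    refine ⟨δ, hδ, hδr, C, fun t ht => ?_⟩
    -- The mean value theorem on `[-t, 0]` gains one power of `t` over the bound for `deriv Q`.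
    obtain ⟨s, hs, hs'⟩ := exists_deriv_eq_slope Q (a := -t) (b := 0) (by linarith [ht.1])
      (hQ.continuousOn.mono fun u hu => ⟨by linarith [hu.1, ht.2], by linarith [hu.2]⟩)
      (hd.mono fun u hu => ⟨by linarith [hu.1, ht.2], by linarith [hu.2]⟩)
    have hb := hC (-s) ⟨by linarith [hs.2], by linarith [hs.1, ht.2]⟩
    rw [neg_neg, hs', hQ0] at hb
    have ht0 := ht.1
    have hC0 : 0 ≤ C := by
      by_contra hneg
      have : 0 < (-s) ^ k := pow_pos (by linarith [hs.2]) k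
      have := abs_nonneg ((0 - Q (-t)) / (0 - -t))
      nlinarith
    have : (-s) ^ k ≤ t ^ k := pow_le_pow_left₀ (by linarith [hs.2]) (by linarith [hs.1]) k
    have h3 : |Q (-t)| / t ≤ C * t ^ k := by
      calc |Q (-t)| / t = |(0 - Q (-t)) / (0 - -t)| := by
            rw [abs_div]; simp [abs_of_pos ht0]
        _ ≤ C * (-s) ^ k := hb
        _ ≤ C * t ^ k := by gcongr
    rw [div_le_iff₀ ht0] at h3
    calc _ ≤ _ := h3
      _ = _ := by ring

/-- Even reflection of a one-sided differentiable function with vanishing derivative at `0`. -/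
theorem hasDerivAt_comp_abs {u u' : ℝ → ℝ} {T : ℝ}
    (hu : ∀ t ∈ Ico 0 T, HasDerivAt u (u' t) t) (h0 : u' 0 = 0) {τ : ℝ} (hτ : |τ| < T) :
    HasDerivAt (fun t => u |t|) (SignType.sign τ * u' |τ|) τ := by
  have hT : 0 < T := (abs_nonneg _).trans_lt hτ
  rcases lt_trichotomy τ 0 with h | rfl | h
  · have := (hu (|τ|) ⟨abs_nonneg _, hτ⟩).comp τ (hasDerivAt_abs_neg h)
    simpa [sign_neg h, Function.comp_def] using this
  · have h1 := hu 0 ⟨le_rfl, hT⟩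
    have hR : HasDerivWithinAt (fun t => u |t|) 0 (Ici 0) 0 := by
      rw [h0] at h1
      exact h1.hasDerivWithinAt.congr (fun x hx => by rw [abs_of_nonneg hx]) (by simp)
    have hL : HasDerivWithinAt (fun t => u |t|) 0 (Iic 0) 0 := by
      rw [h0] at h1
      have h2 : HasDerivAt (fun t => u (-t)) 0 0 := by
        have := HasDerivAt.comp (0:ℝ) (h₂ := u) (h := fun t => -t) (by simpa using h1)
          (hasDerivAt_neg 0)
        simpa [Function.comp_def] using this
      exact h2.hasDerivWithinAt.congr (fun x hx => by rw [abs_of_nonpos hx]) (by simp)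
    have := hL.union hR
    rw [Iic_union_Ici, hasDerivWithinAt_univ] at this
    simpa using this
  · have := (hu (|τ|) ⟨abs_nonneg _, hτ⟩).comp τ (hasDerivAt_abs_pos h)
    simpa [sign_pos h, Function.comp_def] using this

/-- Odd reflection of a one-sided differentiable function vanishing at `0`. -/
theorem hasDerivAt_sign_mul_comp_abs {u u' : ℝ → ℝ} {T : ℝ}
    (hu : ∀ t ∈ Ico 0 T, HasDerivAt u (u' t) t) (h0 : u 0 = 0) {τ : ℝ} (hτ : |τ| < T) :
    HasDerivAt (fun t => (SignType.sign t : ℝ) * u |t|) (u' |τ|) τ := by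
  have hT : 0 < T := (abs_nonneg _).trans_lt hτ
  rcases lt_trichotomy τ 0 with h | rfl | h
  · have := ((hu (|τ|) ⟨abs_nonneg _, hτ⟩).comp τ (hasDerivAt_abs_neg h)).neg
    refine (this.congr_deriv (by simp)).congr_of_eventuallyEq ?_
    filter_upwards [Iio_mem_nhds h] with s hs
    simp [sign_neg (show s < 0 from hs)]
  · have h1 := hu 0 ⟨le_rfl, hT⟩
    have hR : HasDerivWithinAt (fun t => (SignType.sign t : ℝ) * u |t|) (u' 0) (Ici 0) 0 := by
      refine h1.hasDerivWithinAt.congr (fun x hx => ?_) (by simp [h0])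
      rcases eq_or_lt_of_le (show 0 ≤ x from hx) with rfl | hx
      · simp [h0]
      · simp [sign_pos hx, abs_of_pos hx]
    have hL : HasDerivWithinAt (fun t => (SignType.sign t : ℝ) * u |t|) (u' 0) (Iic 0) 0 := by
      have h2 : HasDerivAt (fun t => -u (-t)) (u' 0) 0 := by
        have := (HasDerivAt.comp (0:ℝ) (h₂ := u) (h := fun t => -t) (by simpa using h1)
          (hasDerivAt_neg 0)).neg
        exact this.congr_deriv (by simp)
      refine h2.hasDerivWithinAt.congr (fun x hx => ?_) (by simp [h0])
      rcases eq_or_lt_of_le (show x ≤ 0 from hx) with rfl | hx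
      · simp [h0]
      · simp [sign_neg hx, abs_of_neg hx]
    have := hL.union hR
    rw [Iic_union_Ici, hasDerivWithinAt_univ] at this
    simpa using this
  · have := ((hu (|τ|) ⟨abs_nonneg _, hτ⟩).comp τ (hasDerivAt_abs_pos h))
    refine (this.congr_deriv (by simp)).congr_of_eventuallyEq ?_
    filter_upwards [Ioi_mem_nhds h] with s hs
    simp [sign_pos (show 0 < s from hs)]

/-- Solutions of a second order autonomous equation with smooth right-hand side are smooth. -/
theorem contDiffOn_of_autonomous {β ψ ψ₁ : ℝ → ℝ} {s : Set ℝ} (hs : IsOpen s)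
    (hβ : ContDiff ℝ (⊤ : ℕ∞) β) (h : ∀ t ∈ s, HasDerivAt ψ (ψ₁ t) t)
    (h₁ : ∀ t ∈ s, HasDerivAt ψ₁ (β (ψ t)) t) (k : ℕ) :
    ContDiffOn ℝ k ψ s ∧ ContDiffOn ℝ k ψ₁ s := by
  induction k with
  | zero =>
    exact ⟨contDiffOn_zero.2 fun t ht => (h t ht).continuousAt.continuousWithinAt,
      contDiffOn_zero.2 fun t ht => (h₁ t ht).continuousAt.continuousWithinAt⟩
  | succ k ih =>
    push_cast
    have hβk : ContDiff ℝ k β := hβ.of_le (by exact_mod_cast le_top)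
    refine ⟨(contDiffOn_succ_iff_deriv_of_isOpen hs).2 ⟨fun t ht =>
      (h t ht).differentiableAt.differentiableWithinAt, by simp, ?_⟩,
      (contDiffOn_succ_iff_deriv_of_isOpen hs).2 ⟨fun t ht =>
      (h₁ t ht).differentiableAt.differentiableWithinAt, by simp, ?_⟩⟩
    · exact ih.2.congr fun t ht => (h t ht).deriv
    · exact (hβk.comp_contDiffOn ih.1).congr fun t ht => (h₁ t ht).deriv

/-- A quadratic polynomial which is cubically small along a filter approaching `0` vanishes. -/
theorem quadratic_coeff_eq_zero {ι : Type*} {l : Filter ι} [l.NeBot] {w : ι → ℝ}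
    (hw : Tendsto w l (𝓝 0)) (hw0 : ∀ᶠ i in l, w i ≠ 0) {a b c C : ℝ}
    (h : ∀ᶠ i in l, |a + b * w i + c * w i ^ 2| ≤ C * |w i| ^ 3) : a = 0 ∧ b = 0 ∧ c = 0 := by
  have habs : Tendsto (fun i => |w i|) l (𝓝 0) := by simpa using hw.abs
  have ha : a = 0 := by
    have h1 : Tendsto (fun i => a + b * w i + c * w i ^ 2) l (𝓝 a) := by
      simpa using (tendsto_const_nhds (x := a)).add (hw.const_mul b) |>.add
        ((hw.pow 2).const_mul c)
    have h2 : Tendsto (fun i => a + b * w i + c * w i ^ 2) l (𝓝 0) :=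
      squeeze_zero_norm' h (by simpa using (habs.pow 3).const_mul C)
    exact tendsto_nhds_unique h1 h2
  have hb : b = 0 := by
    have h1 : Tendsto (fun i => b + c * w i) l (𝓝 b) := by
      simpa using (tendsto_const_nhds (x := b)).add (hw.const_mul c)
    have h2 : Tendsto (fun i => b + c * w i) l (𝓝 0) := by
      refine squeeze_zero_norm' (a := fun i => C * |w i| ^ 2) ?_
        (by simpa using (habs.pow 2).const_mul C)
      filter_upwards [h, hw0] with i hi hi0
      have hp := abs_pos.2 hi0
      rw [ha, show 0 + b * w i + c * w i ^ 2 = w i * (b + c * w i) by ring, abs_mul] at hi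
      rw [Real.norm_eq_abs]
      exact le_of_mul_le_mul_left (by linarith [hi, show |w i| * (C * |w i| ^ 2) = C * |w i| ^ 3 by ring]) hp
    exact tendsto_nhds_unique h1 h2
  refine ⟨ha, hb, ?_⟩
  have h2 : Tendsto (fun _ : ι => c) l (𝓝 0) := by
    refine squeeze_zero_norm' (a := fun i => C * |w i|) ?_ (by simpa using habs.const_mul C)
    filter_upwards [h, hw0] with i hi hi0
    have hp := pow_pos (abs_pos.2 hi0) 2
    rw [ha, hb, show 0 + 0 * w i + c * w i ^ 2 = w i ^ 2 * c by ring, abs_mul, abs_pow] at hi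
    rw [Real.norm_eq_abs]
    exact le_of_mul_le_mul_left (by linarith [hi, show |w i| ^ 2 * (C * |w i|) = C * |w i| ^ 3 by ring]) hp
  exact tendsto_nhds_unique tendsto_const_nhds h2

/-- If `β (F T) = 0`, the constant `F T` solves the same equation with the same Cauchy data at `T`,
so `F₁` would vanish before `T`. Hence `F₁` has a simple zero at `T`. -/
theorem ne_zero_of_autonomous {F F₁ β : ℝ → ℝ} {T : ℝ} (hT : 0 < T)
    (hβ : ContDiff ℝ (⊤ : ℕ∞) β)
    (hF : ∀ t ∈ Icc 0 T, HasDerivAt F (F₁ t) t)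
    (hF₁ : ∀ t ∈ Icc 0 T, HasDerivAt F₁ (β (F t)) t)
    (hpos : ∀ t ∈ Ico 0 T, 0 < F₁ t) (hFT : F₁ T = 0) : β (F T) ≠ 0 := by
  intro hb
  have hmem : ∀ t ∈ Ico 0 T, T - t ∈ Icc 0 T := fun t ht => ⟨by linarith [ht.2], by linarith [ht.1]⟩
  have hsub : ∀ t : ℝ, HasDerivAt (fun s => T - s) (-1) t := fun t => by
    simpa using (hasDerivAt_id t).const_sub T
  have hZ : ∀ t ∈ Ico 0 T, HasDerivAt (fun t => (F (T - t) - F T, F₁ (T - t)))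
      (-F₁ (T - t), -β (F (T - t))) t := by
    intro t ht
    have h1 := (HasDerivAt.comp t (hF _ (hmem t ht)) (hsub t)).sub_const (F T)
    have h2 := HasDerivAt.comp t (hF₁ _ (hmem t ht)) (hsub t)
    simpa using h1.prodMk h2
  -- The divided difference is the continuous coefficient that makes the equation for `F - F T`
  -- linear.
  have hds : Continuous (dslope β (F T)) := by
    have := (continuousOn_dslope (f := β) (a := F T) (s := univ) univ_mem).2
      ⟨hβ.continuous.continuousOn, (hβ.differentiable (by simp)).differentiableAt⟩
    simpa using this
  have hcF : ContinuousOn (fun t => F (T - t)) (Ico 0 T) := fun t ht =>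
    (HasDerivAt.comp t (hF _ (hmem t ht)) (hsub t)).continuousAt.continuousWithinAt
  have key := eq_zero_of_norm_smul_deriv_le (φ := fun _ => 1)
    (C := fun t => 1 + |dslope β (F T) (F (T - t))|) hZ continuousOn_const (by simp)
    (continuousOn_const.add (hds.comp_continuousOn hcF).abs) (by
      intro t ht
      have h1 : β (F (T - t)) = (F (T - t) - F T) * dslope β (F T) (F (T - t)) := by
        have := sub_smul_dslope β (F T) (F (T - t))
        rw [hb, smul_eq_mul] at this
        linarith
      rw [one_smul, Prod.norm_def, Prod.norm_def]
      simp only [norm_neg, Real.norm_eq_abs]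
      rw [h1, abs_mul]
      have ha := abs_nonneg (dslope β (F T) (F (T - t)))
      have hm1 := le_max_left |F (T - t) - F T| |F₁ (T - t)|
      have hm2 := le_max_right |F (T - t) - F T| |F₁ (T - t)|
      have hm0 := (abs_nonneg _).trans hm1
      refine max_le ?_ ?_ <;> nlinarith) (by simp [hFT])
  have h1 := key (T / 2) ⟨by linarith, by linarith⟩
  have h2 := hpos (T - T / 2) ⟨by linarith, by linarith⟩
  simp only [Prod.mk_eq_zero] at h1
  linarith [h1.2]

/-! ### The profile equation and the first focal time -/

/-- The data of the level-distance equation along a normal geodesic up to the first focal time. -/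
structure NormalProfile (F F₁ α β : ℝ → ℝ) (T : ℝ) (κ m : Fin 4 → ℝ) : Prop where
  pos : 0 < T
  smooth_left : ContDiff ℝ (⊤ : ℕ∞) α
  smooth_right : ContDiff ℝ (⊤ : ℕ∞) β
  hasDeriv : ∀ t ∈ Icc 0 T, HasDerivAt F (F₁ t) t
  hasDeriv₁ : ∀ t ∈ Icc 0 T, HasDerivAt F₁ (β (F t)) t
  deriv_pos : ∀ t ∈ Ico 0 T, 0 < F₁ t
  deriv_zero : F₁ T = 0
  jacobi_pos : ∀ j, ∀ t ∈ Ico 0 T, 0 < Real.cos t - κ j * Real.sin t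
  equation : ∀ t ∈ Ico 0 T, α (F t) = F₁ t * ∑ j, m j *
    (-(Real.sin t + κ j * Real.cos t) / (Real.cos t - κ j * Real.sin t))
  strictAnti : StrictAnti κ
  mult_pos : ∀ j, 0 < m j
  minimal : ∑ j, m j * κ j = 0

namespace NormalProfile

variable {F F₁ α β : ℝ → ℝ} {T : ℝ} {κ m : Fin 4 → ℝ}

theorem continuous_jacobi (k : ℝ) : Continuous fun t => Real.cos t - k * Real.sin t := by fun_prop

theorem jacobi_nonneg (h : NormalProfile F F₁ α β T κ m) (j : Fin 4) :
    0 ≤ Real.cos T - κ j * Real.sin T := by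
  have h1 : Tendsto (fun t => Real.cos t - κ j * Real.sin t) (𝓝[<] T)
      (𝓝 (Real.cos T - κ j * Real.sin T)) :=
    ((continuous_jacobi (κ j)).tendsto T).mono_left nhdsWithin_le_nhds
  refine ge_of_tendsto h1 ?_
  filter_upwards [Ioo_mem_nhdsLT h.pos] with t ht using (h.jacobi_pos j t ⟨ht.1.le, ht.2⟩).le

theorem lt_pi (h : NormalProfile F F₁ α β T κ m) : T < Real.pi := by
  by_contra! hT
  rcases hT.eq_or_lt with hT | hT
  · have := h.jacobi_nonneg 0
    rw [← hT] at this
    simp at this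
    linarith
  · have := h.jacobi_pos 0 Real.pi ⟨Real.pi_pos.le, hT⟩
    simp at this
    linarith

theorem sin_pos (h : NormalProfile F F₁ α β T κ m) : 0 < Real.sin T :=
  Real.sin_pos_of_pos_of_lt_pi h.pos h.lt_pi

theorem hasDerivAt_quotient {k t : ℝ} (ht : Real.cos t - k * Real.sin t ≠ 0) :
    HasDerivAt (fun t => -(Real.sin t + k * Real.cos t) / (Real.cos t - k * Real.sin t))
      (-1 - (-(Real.sin t + k * Real.cos t) / (Real.cos t - k * Real.sin t)) ^ 2) t := by
  have h1 := ((Real.hasDerivAt_sin t).add ((Real.hasDerivAt_cos t).const_mul k)).neg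
  have h2 := (Real.hasDerivAt_cos t).sub ((Real.hasDerivAt_sin t).const_mul k)
  refine (h1.div h2 ht).congr_deriv ?_
  simp only [Pi.sub_apply, Pi.neg_apply, Pi.add_apply]
  field_simp
  ring

/-- The first focal time is attained by the largest principal curvature. -/
theorem jacobi_zero_eq_zero (h : NormalProfile F F₁ α β T κ m) :
    Real.cos T - κ 0 * Real.sin T = 0 := by
  by_contra hne
  have h0 : 0 < Real.cos T - κ 0 * Real.sin T := lt_of_le_of_ne (h.jacobi_nonneg 0) (Ne.symm hne)
  -- As `sin T > 0`, the factor of the largest curvature is the smallest at `T`; if it is positive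
  -- there, no denominator degenerates on the closed interval.
  have hD : ∀ j, ∀ t ∈ Icc 0 T, 0 < Real.cos t - κ j * Real.sin t := by
    intro j t ht
    rcases ht.2.eq_or_lt with rfl | hlt
    · have := h.strictAnti.antitone (Fin.zero_le j)
      nlinarith [h.sin_pos]
    · exact h.jacobi_pos j t ⟨ht.1, hlt⟩
  set L : ℝ → ℝ := fun t => ∑ j, m j *
    (-(Real.sin t + κ j * Real.cos t) / (Real.cos t - κ j * Real.sin t)) with hL
  have hLd : ∀ t ∈ Icc 0 T, HasDerivAt L (∑ j, m j * (-1 - (-(Real.sin t + κ j * Real.cos t) /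
      (Real.cos t - κ j * Real.sin t)) ^ 2)) t := fun t ht =>
    HasDerivAt.fun_sum fun j _ => (hasDerivAt_quotient (hD j t ht).ne').const_mul (m j)
  have hTm : T ∈ Icc 0 T := ⟨h.pos.le, le_rfl⟩
  have hanti : StrictAntiOn L (Icc 0 T) := by
    refine strictAntiOn_of_deriv_neg (convex_Icc 0 T)
      (fun t ht => (hLd t ht).continuousAt.continuousWithinAt) fun t ht => ?_
    rw [interior_Icc] at ht
    rw [(hLd t ⟨ht.1.le, ht.2.le⟩).deriv]
    refine Finset.sum_neg (fun j _ => ?_) ⟨0, Finset.mem_univ 0⟩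
    have := h.mult_pos j
    have h2 := sq_nonneg (-(Real.sin t + κ j * Real.cos t) / (Real.cos t - κ j * Real.sin t))
    nlinarith
  have hLT : L T < 0 := by
    have h1 := hanti ⟨le_rfl, h.pos.le⟩ hTm h.pos
    -- Minimality enters here: `L 0` is minus the trace of the shape operator.
    have h2 : L 0 = 0 := by
      simp only [hL]
      simp [h.minimal, Finset.sum_neg_distrib]
    linarith
  have hα : HasDerivAt (fun t => α (F t)) (deriv α (F T) * F₁ T) T :=
    HasDerivAt.comp T ((h.smooth_left.differentiable (by simp)).differentiableAt.hasDerivAt)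
      (h.hasDeriv T hTm)
  -- Differentiating `F₁ * L = α ∘ F` at `T`, where `F₁ T = 0`, leaves `β (F T) * L T = 0`; both
  -- factors are nonzero.
  have hG := ((h.hasDeriv₁ T hTm).mul (hLd T hTm)).sub hα
  have hGc : ContinuousWithinAt (F₁ * L - fun t => α (F t)) (Iio T) T :=
    hG.continuousAt.continuousWithinAt
  have hG0 : ∀ t ∈ Ico 0 T, (F₁ * L - fun t => α (F t)) t = 0 := fun t ht => by
    simp only [Pi.sub_apply, Pi.mul_apply, hL]
    rw [h.equation t ht, sub_self]
  have hGT : (F₁ * L - fun t => α (F t)) T = 0 := by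
    refine tendsto_nhds_unique hGc (tendsto_const_nhds.congr' ?_)
    filter_upwards [Ioo_mem_nhdsLT h.pos] with t ht using (hG0 t ⟨ht.1.le, ht.2⟩).symm
  have hG1 : HasDerivWithinAt (F₁ * L - fun t => α (F t)) 0 (Icc 0 T) T := by
    refine (hasDerivWithinAt_const T (Icc 0 T) (0 : ℝ)).congr (fun t ht => ?_) hGT
    rcases ht.2.eq_or_lt with rfl | hlt
    · exact hGT
    · exact hG0 t ⟨ht.1, hlt⟩
  have huniq := (uniqueDiffOn_Icc h.pos T hTm).eq_deriv _ hG.hasDerivWithinAt hG1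
  rw [h.deriv_zero] at huniq
  have hβ := ne_zero_of_autonomous h.pos h.smooth_right h.hasDeriv h.hasDeriv₁ h.deriv_pos h.deriv_zero
  have : β (F T) * L T = 0 := by linarith
  exact (mul_ne_zero hβ hLT.ne) this

end NormalProfile

theorem HasDerivAt.eventually_mul_le_abs {f : ℝ → ℝ} {d : ℝ} (hf : HasDerivAt f d 0)
    (h0 : f 0 = 0) (hd : d ≠ 0) : ∀ᶠ t in 𝓝[>] (0 : ℝ), |d| / 2 * t ≤ |f t| := by
  have h1 := hf.tendsto_slope
  have h2 : Tendsto (fun t => |slope f 0 t|) (𝓝[>] 0) (𝓝 |d|) :=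
    (h1.mono_left (nhdsWithin_mono _ fun x hx => ne_of_gt hx)).abs
  have h3 : |d| / 2 < |d| := by linarith [abs_pos.2 hd]
  filter_upwards [h2.eventually (lt_mem_nhds h3), self_mem_nhdsWithin] with t ht ht0
  have ht0 : 0 < t := ht0
  rw [slope_def_field, h0, sub_zero, sub_zero, abs_div, abs_of_pos ht0, lt_div_iff₀ ht0] at ht
  exact ht.le

/-- Three weighted nodes with these vanishing symmetric sums are symmetric about the middle one. -/
theorem symmetric_of_moments {x₁ x₂ x₃ m₁ m₂ m₃ : ℝ} (h12 : x₁ < x₂) (h23 : x₂ < x₃)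
    (hm₁ : 0 < m₁) (hm₂ : 0 < m₂) (hm₃ : 0 < m₃)
    (ha : m₁ * x₁ + m₂ * x₂ + m₃ * x₃ = 0)
    (hb : m₁ * x₁ * ((1 + x₂ ^ 2) + (1 + x₃ ^ 2)) + m₂ * x₂ * ((1 + x₁ ^ 2) + (1 + x₃ ^ 2)) +
      m₃ * x₃ * ((1 + x₁ ^ 2) + (1 + x₂ ^ 2)) = 0)
    (hc : m₁ * x₁ * ((1 + x₂ ^ 2) * (1 + x₃ ^ 2)) + m₂ * x₂ * ((1 + x₁ ^ 2) * (1 + x₃ ^ 2)) +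
      m₃ * x₃ * ((1 + x₁ ^ 2) * (1 + x₂ ^ 2)) = 0) :
    x₂ = 0 ∧ x₁ = -x₃ ∧ m₁ = m₃ := by
  -- Take the quadratic `a - b * w + c * w ^ 2`, with `a`, `b`, `c` the three sums assumed zero, at
  -- `w = 1 / (1 + x₁ ^ 2)`: only the `x₁` term survives, and the distinctness of the nodes removes
  -- the other factors. The next two equations are the same at the other nodes.
  have e1 : x₁ * ((x₁ + x₂) * (x₁ + x₃)) = 0 := by
    have : (m₁ * (x₁ - x₂) * (x₁ - x₃)) * (x₁ * ((x₁ + x₂) * (x₁ + x₃))) = 0 := by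
      linear_combination (1 + x₁ ^ 2) ^ 2 * ha - (1 + x₁ ^ 2) * hb + hc
    exact (mul_eq_zero.1 this).resolve_left (mul_ne_zero (mul_ne_zero hm₁.ne'
      (sub_ne_zero.2 h12.ne)) (sub_ne_zero.2 (h12.trans h23).ne))
  have e2 : x₂ * ((x₂ + x₁) * (x₂ + x₃)) = 0 := by
    have : (m₂ * (x₂ - x₁) * (x₂ - x₃)) * (x₂ * ((x₂ + x₁) * (x₂ + x₃))) = 0 := by
      linear_combination (1 + x₂ ^ 2) ^ 2 * ha - (1 + x₂ ^ 2) * hb + hc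
    exact (mul_eq_zero.1 this).resolve_left (mul_ne_zero (mul_ne_zero hm₂.ne'
      (sub_ne_zero.2 h12.ne')) (sub_ne_zero.2 h23.ne))
  have e3 : x₃ * ((x₃ + x₁) * (x₃ + x₂)) = 0 := by
    have : (m₃ * (x₃ - x₁) * (x₃ - x₂)) * (x₃ * ((x₃ + x₁) * (x₃ + x₂))) = 0 := by
      linear_combination (1 + x₃ ^ 2) ^ 2 * ha - (1 + x₃ ^ 2) * hb + hc
    exact (mul_eq_zero.1 this).resolve_left (mul_ne_zero (mul_ne_zero hm₃.ne'
      (sub_ne_zero.2 (h12.trans h23).ne')) (sub_ne_zero.2 h23.ne'))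
  have hx : x₂ = 0 ∧ x₁ = -x₃ := by
    simp only [mul_eq_zero] at e1 e2 e3
    -- Among the 27 sign patterns the ordering of the nodes excludes all that do not yield the
    -- symmetric one.
    rcases e1 with e1 | e1 | e1 <;> rcases e2 with e2 | e2 | e2 <;> rcases e3 with e3 | e3 | e3 <;>
      constructor <;> linarith
  refine ⟨hx.1, hx.2, ?_⟩
  have h3 : x₃ ≠ 0 := by linarith [hx.1]
  have : x₃ * (m₃ - m₁) = 0 := by rw [hx.1, hx.2] at ha; linarith
  linarith [(mul_eq_zero.1 this).resolve_left h3]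

/-! ### Reflection through the focal point -/

namespace NormalProfile

variable {F F₁ α β : ℝ → ℝ} {T : ℝ} {κ m : Fin 4 → ℝ}

/-- Angle subtraction about the focal time: with `k₀ = cot T` and `k = cot θ`, the number `x` is
`cot (T - θ)`, the curvature seen from the focal point. -/
theorem jacobi_sub {S C s c k k₀ x : ℝ} (hC : C = k₀ * S) (hx : x * (k₀ - k) = -(1 + k₀ * k)) :
    (C * c + S * s) - k * (S * c - C * s) = S * (k₀ - k) * (c - x * s) := by
  subst hC; linear_combination S * s * hx

theorem jacobi_deriv_sub {S C s c k k₀ x : ℝ} (hC : C = k₀ * S)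
    (hx : x * (k₀ - k) = -(1 + k₀ * k)) :
    -((S * c - C * s) + k * (C * c + S * s)) = S * (k₀ - k) * (x * c + s) := by
  subst hC; linear_combination -S * c * hx

/-- The profile equation at `T - τ`, multiplied by all denominators. The term of `κ 0` becomes `-cos
τ / sin τ`, so one factor `sin τ` suffices to make every coefficient smooth across `τ = 0`. -/
theorem equation_reflected (h : NormalProfile F F₁ α β T κ m) {x₁ x₂ x₃ : ℝ}
    (h₁ : x₁ * (κ 0 - κ 1) = -(1 + κ 0 * κ 1)) (h₂ : x₂ * (κ 0 - κ 2) = -(1 + κ 0 * κ 2))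
    (h₃ : x₃ * (κ 0 - κ 3) = -(1 + κ 0 * κ 3)) {τ : ℝ} (hτ : τ ∈ Ioo 0 T) :
    Real.sin τ * α (F (T - τ)) * ((Real.cos τ - x₁ * Real.sin τ) *
      (Real.cos τ - x₂ * Real.sin τ) * (Real.cos τ - x₃ * Real.sin τ)) -
    F₁ (T - τ) * (-(m 0) * Real.cos τ * ((Real.cos τ - x₁ * Real.sin τ) *
      (Real.cos τ - x₂ * Real.sin τ) * (Real.cos τ - x₃ * Real.sin τ)) + Real.sin τ *
      (m 1 * (x₁ * Real.cos τ + Real.sin τ) * ((Real.cos τ - x₂ * Real.sin τ) *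
        (Real.cos τ - x₃ * Real.sin τ)) +
       m 2 * (x₂ * Real.cos τ + Real.sin τ) * ((Real.cos τ - x₁ * Real.sin τ) *
        (Real.cos τ - x₃ * Real.sin τ)) +
       m 3 * (x₃ * Real.cos τ + Real.sin τ) * ((Real.cos τ - x₁ * Real.sin τ) *
        (Real.cos τ - x₂ * Real.sin τ)))) = 0 := by
  have hmem : T - τ ∈ Ico 0 T := ⟨by linarith [hτ.2], by linarith [hτ.1]⟩
  have hC : Real.cos T = κ 0 * Real.sin T := by linarith [h.jacobi_zero_eq_zero]
  have hS := h.sin_pos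
  have hs : 0 < Real.sin τ := Real.sin_pos_of_pos_of_lt_pi hτ.1 (hτ.2.trans h.lt_pi)
  have hk : ∀ j : Fin 4, j ≠ 0 → 0 < κ 0 - κ j := fun j hj =>
    sub_pos.2 (h.strictAnti (Fin.pos_iff_ne_zero.2 hj))
  have hD : ∀ (j : Fin 4) (x : ℝ), j ≠ 0 → x * (κ 0 - κ j) = -(1 + κ 0 * κ j) →
      (0 < Real.cos τ - x * Real.sin τ ∧
      -(Real.sin (T - τ) + κ j * Real.cos (T - τ)) / (Real.cos (T - τ) - κ j * Real.sin (T - τ))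
        = (x * Real.cos τ + Real.sin τ) / (Real.cos τ - x * Real.sin τ)) := by
    intro j x hj hx
    have hp := h.jacobi_pos j _ hmem
    rw [Real.cos_sub, Real.sin_sub] at hp ⊢
    rw [jacobi_sub hC hx] at hp ⊢
    rw [jacobi_deriv_sub hC hx]
    have h0 : 0 < Real.sin T * (κ 0 - κ j) := mul_pos hS (hk j hj)
    exact ⟨(mul_pos_iff_of_pos_left h0).1 hp, mul_div_mul_left _ _ h0.ne'⟩
  have hD0 : -(Real.sin (T - τ) + κ 0 * Real.cos (T - τ)) /
      (Real.cos (T - τ) - κ 0 * Real.sin (T - τ)) = -Real.cos τ / Real.sin τ := by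
    have hne := (h.jacobi_pos 0 _ hmem).ne'
    rw [div_eq_div_iff hne hs.ne', Real.cos_sub, Real.sin_sub, hC]
    ring
  obtain ⟨p1, e1⟩ := hD 1 x₁ (by decide) h₁
  obtain ⟨p2, e2⟩ := hD 2 x₂ (by decide) h₂
  obtain ⟨p3, e3⟩ := hD 3 x₃ (by decide) h₃
  rw [h.equation _ hmem, Fin.sum_univ_four, hD0, e1, e2, e3]
  generalize Real.cos τ - x₁ * Real.sin τ = c1 at *
  generalize Real.cos τ - x₂ * Real.sin τ = c2 at *
  generalize Real.cos τ - x₃ * Real.sin τ = c3 at *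
  field_simp
  ring

/-- The cleared equation is smooth across the focal time and vanishes on one side, hence is flat.
Evenness of the reflected solution then eliminates the unknown `α` and the term of `m 0`. -/
theorem exists_flat_bound (h : NormalProfile F F₁ α β T κ m) {x₁ x₂ x₃ : ℝ}
    (h₁ : x₁ * (κ 0 - κ 1) = -(1 + κ 0 * κ 1)) (h₂ : x₂ * (κ 0 - κ 2) = -(1 + κ 0 * κ 2))
    (h₃ : x₃ * (κ 0 - κ 3) = -(1 + κ 0 * κ 3)) :
    ∃ C, ∀ᶠ τ in 𝓝[>] (0 : ℝ), |2 * F₁ (T - τ) * Real.sin τ *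
      (m 1 * x₁ * ((1 - (1 + x₂ ^ 2) * Real.sin τ ^ 2) * (1 - (1 + x₃ ^ 2) * Real.sin τ ^ 2)) +
       m 2 * x₂ * ((1 - (1 + x₁ ^ 2) * Real.sin τ ^ 2) * (1 - (1 + x₃ ^ 2) * Real.sin τ ^ 2)) +
       m 3 * x₃ * ((1 - (1 + x₁ ^ 2) * Real.sin τ ^ 2) * (1 - (1 + x₂ ^ 2) * Real.sin τ ^ 2)))|
      ≤ C * τ ^ 8 := by
  have hmem : ∀ t ∈ Ico 0 T, T - t ∈ Icc 0 T := fun t ht => ⟨by linarith [ht.2], by linarith [ht.1]⟩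
  have hsub : ∀ t : ℝ, HasDerivAt (fun s => T - s) (-1) t := fun t => by
    simpa using (hasDerivAt_id t).const_sub T
  set ψ : ℝ → ℝ := fun τ => F (T - |τ|) with hψ
  set ψ₁ : ℝ → ℝ := fun τ => (SignType.sign τ : ℝ) * -F₁ (T - |τ|) with hψ₁
  have hdψ : ∀ τ ∈ Ioo (-T) T, HasDerivAt ψ (ψ₁ τ) τ := fun τ hτ =>
    hasDerivAt_comp_abs (u := fun t => F (T - t)) (u' := fun t => -F₁ (T - t)) (T := T)
      (fun t ht => (HasDerivAt.comp t (h.hasDeriv _ (hmem t ht)) (hsub t)).congr_deriv (by simp))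
      (by simp [h.deriv_zero]) (abs_lt.2 hτ)
  have hdψ₁ : ∀ τ ∈ Ioo (-T) T, HasDerivAt ψ₁ (β (ψ τ)) τ := fun τ hτ =>
    hasDerivAt_sign_mul_comp_abs (u := fun t => -F₁ (T - t)) (u' := fun t => β (F (T - t))) (T := T)
      (fun t ht =>
        (HasDerivAt.comp t (h.hasDeriv₁ _ (hmem t ht)) (hsub t)).neg.congr_deriv (by simp))
      (by simp [h.deriv_zero]) (abs_lt.2 hτ)
  -- Order 8 is what the later comparison needs: two powers are absorbed by `F₁ * sin τ`, and the
  -- remaining six equal the order of `(sin² τ) ^ 3`.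
  obtain ⟨hcψ, hcψ₁⟩ := contDiffOn_of_autonomous isOpen_Ioo h.smooth_right hdψ hdψ₁ 8
  set P : ℝ → ℝ := fun τ => (Real.cos τ - x₁ * Real.sin τ) *
      (Real.cos τ - x₂ * Real.sin τ) * (Real.cos τ - x₃ * Real.sin τ) with hP
  set N : ℝ → ℝ := fun τ => m 1 * (x₁ * Real.cos τ + Real.sin τ) *
       ((Real.cos τ - x₂ * Real.sin τ) * (Real.cos τ - x₃ * Real.sin τ)) +
       m 2 * (x₂ * Real.cos τ + Real.sin τ) * ((Real.cos τ - x₁ * Real.sin τ) *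
        (Real.cos τ - x₃ * Real.sin τ)) +
       m 3 * (x₃ * Real.cos τ + Real.sin τ) * ((Real.cos τ - x₁ * Real.sin τ) *
        (Real.cos τ - x₂ * Real.sin τ)) with hN
  have hcs : ContDiff ℝ 8 Real.sin := Real.contDiff_sin
  have hcc : ContDiff ℝ 8 Real.cos := Real.contDiff_cos
  have hPc : ContDiff ℝ 8 P := by fun_prop
  have hNc : ContDiff ℝ 8 N := by fun_prop
  have hαc : ContDiff ℝ 8 α := contDiff_infty.1 h.smooth_left 8
  set Q : ℝ → ℝ := fun τ => Real.sin τ * α (ψ τ) * P τ +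
    ψ₁ τ * (-(m 0) * Real.cos τ * P τ + Real.sin τ * N τ) with hQ
  have hQc : ContDiffOn ℝ (8 : ℕ) Q (Ioo (-T) T) := by
    have e : ((8 : ℕ) : WithTop ℕ∞) = 8 := rfl
    rw [e] at hcψ hcψ₁ ⊢
    have hαψ : ContDiffOn ℝ 8 (fun τ => α (ψ τ)) (Ioo (-T) T) := hαc.comp_contDiffOn hcψ
    exact ((hcs.contDiffOn.mul hαψ).mul hPc.contDiffOn).add (hcψ₁.mul
      (((contDiffOn_const.mul hcc.contDiffOn).mul hPc.contDiffOn).add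
        (hcs.contDiffOn.mul hNc.contDiffOn)))
  have hQ0 : ∀ τ ∈ Ioo 0 T, Q τ = 0 := by
    intro τ hτ
    have := h.equation_reflected h₁ h₂ h₃ hτ
    simp only [hQ, hψ, hψ₁, abs_of_pos hτ.1, sign_pos hτ.1]
    simp only [hP, hN, SignType.coe_one]
    linarith
  obtain ⟨δ, hδ, hδT, C, hC⟩ := exists_bound_pow_of_eq_zero_right h.pos 8 Q hQc hQ0
  obtain ⟨B, hB⟩ := (isCompact_Icc (a := (0:ℝ)) (b := T)).exists_bound_of_continuousOn
    hPc.continuous.continuousOn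
  refine ⟨B * C, ?_⟩
  filter_upwards [Ioo_mem_nhdsGT hδ] with τ hτ
  have hτT : τ ∈ Ioo 0 T := ⟨hτ.1, hτ.2.trans hδT⟩
  have h0 := hQ0 τ hτT
  have hc := Real.sin_sq_add_cos_sq τ
  have key : P τ * Q (-τ) = 2 * ψ₁ τ * Real.sin τ *
      (m 1 * x₁ * ((1 - (1 + x₂ ^ 2) * Real.sin τ ^ 2) * (1 - (1 + x₃ ^ 2) * Real.sin τ ^ 2)) +
       m 2 * x₂ * ((1 - (1 + x₁ ^ 2) * Real.sin τ ^ 2) * (1 - (1 + x₃ ^ 2) * Real.sin τ ^ 2)) +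
       m 3 * x₃ * ((1 - (1 + x₁ ^ 2) * Real.sin τ ^ 2) *
        (1 - (1 + x₂ ^ 2) * Real.sin τ ^ 2))) := by
    have e1 : ψ (-τ) = ψ τ := by simp [hψ]
    have e2 : ψ₁ (-τ) = -ψ₁ τ := by
      simp [hψ₁, sign_pos hτ.1, sign_neg (neg_lt_zero.2 hτ.1)]
    -- Adding `P (-τ) * Q τ`, which is zero, cancels the terms in `α` and `m 0`, because `ψ` is even
    -- and `ψ₁` is odd.
    have e3 : P τ * Q (-τ) = ψ₁ τ * Real.sin τ * (P (-τ) * N τ + N (-τ) * P τ) := by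
      have : P τ * Q (-τ) + P (-τ) * Q τ = ψ₁ τ * Real.sin τ * (P (-τ) * N τ + N (-τ) * P τ) := by
        simp only [hQ]
        rw [e1, e2, Real.sin_neg, Real.cos_neg]
        ring
      rw [h0] at this
      linarith
    have f : ∀ x : ℝ, 1 - (1 + x ^ 2) * Real.sin τ ^ 2 =
        (Real.cos τ - x * Real.sin τ) * (Real.cos τ + x * Real.sin τ) := fun x => by
      linear_combination -hc
    rw [e3, f, f, f]
    simp only [hP, hN, Real.sin_neg, Real.cos_neg]
    linear_combination (2 * ψ₁ τ * Real.sin τ *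
      (m 1 * x₁ * ((Real.cos τ - x₂ * Real.sin τ) * (Real.cos τ + x₂ * Real.sin τ) *
        ((Real.cos τ - x₃ * Real.sin τ) * (Real.cos τ + x₃ * Real.sin τ))) +
       m 2 * x₂ * ((Real.cos τ - x₁ * Real.sin τ) * (Real.cos τ + x₁ * Real.sin τ) *
        ((Real.cos τ - x₃ * Real.sin τ) * (Real.cos τ + x₃ * Real.sin τ))) +
       m 3 * x₃ * ((Real.cos τ - x₁ * Real.sin τ) * (Real.cos τ + x₁ * Real.sin τ) *
        ((Real.cos τ - x₂ * Real.sin τ) * (Real.cos τ + x₂ * Real.sin τ))))) * hc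
  have hψ₁τ : ψ₁ τ = -F₁ (T - τ) := by simp [hψ₁, sign_pos hτ.1, abs_of_pos hτ.1]
  rw [hψ₁τ] at key
  have h1 := hC τ hτ
  have h2 : |P τ| ≤ B := hB τ ⟨hτ.1.le, hτT.2.le⟩
  calc _ = |P τ * Q (-τ)| := by rw [key, ← abs_neg]; congr 1; ring
    _ = |P τ| * |Q (-τ)| := abs_mul _ _
    _ ≤ B * (C * τ ^ 8) := mul_le_mul h2 h1 (abs_nonneg _) ((abs_nonneg _).trans h2)
    _ = _ := by ring

/-- The reflection symmetry of the principal curvatures at the first focal time. -/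
theorem reflection_symmetry (h : NormalProfile F F₁ α β T κ m) :
    κ 0 * κ 2 = -1 ∧ (1 + κ 0 * κ 1) / (κ 0 - κ 1) = -((1 + κ 0 * κ 3) / (κ 0 - κ 3)) ∧
      m 1 = m 3 := by
  have hk : ∀ j : Fin 4, j ≠ 0 → 0 < κ 0 - κ j := fun j hj =>
    sub_pos.2 (h.strictAnti (Fin.pos_iff_ne_zero.2 hj))
  have k1 := hk 1 (by decide)
  have k2 := hk 2 (by decide)
  have k3 := hk 3 (by decide)
  have hx : ∀ j : Fin 4, 0 < κ 0 - κ j →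
      -(1 + κ 0 * κ j) / (κ 0 - κ j) * (κ 0 - κ j) = -(1 + κ 0 * κ j) := fun j hj =>
    div_mul_cancel₀ _ hj.ne'
  have hlt : ∀ i j : Fin 4, 0 < κ 0 - κ i → i < j →
      -(1 + κ 0 * κ i) / (κ 0 - κ i) < -(1 + κ 0 * κ j) / (κ 0 - κ j) := by
    intro i j hi hij
    have hij' := h.strictAnti hij
    rw [div_lt_div_iff₀ hi (by linarith)]
    nlinarith [mul_pos (sub_pos.2 hij') (show 0 < 1 + κ 0 ^ 2 by positivity)]
  obtain ⟨C, hC⟩ := h.exists_flat_bound (hx 1 k1) (hx 2 k2) (hx 3 k3)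
  have hl1 := hlt 1 2 k1 (by decide)
  have hl2 := hlt 2 3 k2 (by decide)
  set x₁ := -(1 + κ 0 * κ 1) / (κ 0 - κ 1) with hx₁
  set x₂ := -(1 + κ 0 * κ 2) / (κ 0 - κ 2) with hx₂
  set x₃ := -(1 + κ 0 * κ 3) / (κ 0 - κ 3) with hx₃
  have hβ := ne_zero_of_autonomous h.pos h.smooth_right h.hasDeriv h.hasDeriv₁ h.deriv_pos
    h.deriv_zero
  -- The zero of `F₁` at `T` is simple, so `|F₁ (T - τ) * sin τ|` is bounded below by a multiple of
  -- `τ ^ 2` and can be divided out.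
  have hF₁ : HasDerivAt (fun τ => F₁ (T - τ)) (-β (F T)) 0 := by
    have hs : HasDerivAt (fun s => T - s) (-1) 0 := by simpa using (hasDerivAt_id (0:ℝ)).const_sub T
    have h1 : HasDerivAt F₁ (β (F T)) (T - 0) := by
      rw [sub_zero]; exact h.hasDeriv₁ T ⟨h.pos.le, le_rfl⟩
    exact (HasDerivAt.comp (0:ℝ) h1 hs).congr_deriv (by simp)
  have hev1 := hF₁.eventually_mul_le_abs (by simp [h.deriv_zero]) (neg_ne_zero.2 hβ)
  have hev2 := HasDerivAt.eventually_mul_le_abs (f := Real.sin) (d := 1)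
    (by simpa using Real.hasDerivAt_sin 0) Real.sin_zero one_ne_zero
  rw [abs_neg] at hev1
  rw [abs_one] at hev2
  have hβ' := abs_pos.2 hβ
  have hw : Tendsto (fun τ => Real.sin τ ^ 2) (𝓝[>] 0) (𝓝 0) := by
    have : Tendsto (fun τ => Real.sin τ ^ 2) (𝓝 0) (𝓝 (Real.sin 0 ^ 2)) :=
      (Real.continuous_sin.pow 2).tendsto 0
    simpa using this.mono_left nhdsWithin_le_nhds
  have hw0 : ∀ᶠ τ in 𝓝[>] (0:ℝ), Real.sin τ ^ 2 ≠ 0 := by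
    filter_upwards [hev2, self_mem_nhdsWithin] with τ h1 h2
    have h2 : 0 < τ := h2
    have : Real.sin τ ≠ 0 := abs_pos.1 (by linarith)
    positivity
  obtain ⟨ha, hb, hc⟩ := quadratic_coeff_eq_zero hw hw0 (a := m 1 * x₁ + m 2 * x₂ + m 3 * x₃)
    (b := -(m 1 * x₁ * ((1 + x₂ ^ 2) + (1 + x₃ ^ 2)) + m 2 * x₂ * ((1 + x₁ ^ 2) + (1 + x₃ ^ 2)) +
      m 3 * x₃ * ((1 + x₁ ^ 2) + (1 + x₂ ^ 2))))
    (c := m 1 * x₁ * ((1 + x₂ ^ 2) * (1 + x₃ ^ 2)) + m 2 * x₂ * ((1 + x₁ ^ 2) * (1 + x₃ ^ 2)) +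
      -- The constant is `2 * 64`: the 2 from the lower bound with `|β (F T)| / 2`, and `64 = 2 ^ 6`
      -- from `τ / 2 ≤ |sin τ|`.
      m 3 * x₃ * ((1 + x₁ ^ 2) * (1 + x₂ ^ 2))) (C := 128 * C / |β (F T)|) (by
    filter_upwards [hC, hev1, hev2, self_mem_nhdsWithin] with τ e0 e1 e2 e3
    have e3 : 0 < τ := e3
    set q := m 1 * x₁ * ((1 - (1 + x₂ ^ 2) * Real.sin τ ^ 2) * (1 - (1 + x₃ ^ 2) * Real.sin τ ^ 2)) +
       m 2 * x₂ * ((1 - (1 + x₁ ^ 2) * Real.sin τ ^ 2) * (1 - (1 + x₃ ^ 2) * Real.sin τ ^ 2)) +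
       m 3 * x₃ * ((1 - (1 + x₁ ^ 2) * Real.sin τ ^ 2) * (1 - (1 + x₂ ^ 2) * Real.sin τ ^ 2))
      with hq
    have hqe : m 1 * x₁ + m 2 * x₂ + m 3 * x₃ + -(m 1 * x₁ * ((1 + x₂ ^ 2) + (1 + x₃ ^ 2)) +
        m 2 * x₂ * ((1 + x₁ ^ 2) + (1 + x₃ ^ 2)) + m 3 * x₃ * ((1 + x₁ ^ 2) + (1 + x₂ ^ 2))) *
        Real.sin τ ^ 2 + (m 1 * x₁ * ((1 + x₂ ^ 2) * (1 + x₃ ^ 2)) +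
        m 2 * x₂ * ((1 + x₁ ^ 2) * (1 + x₃ ^ 2)) + m 3 * x₃ * ((1 + x₁ ^ 2) * (1 + x₂ ^ 2))) *
        (Real.sin τ ^ 2) ^ 2 = q := by rw [hq]; ring
    rw [hqe, abs_of_nonneg (sq_nonneg (Real.sin τ)), ← pow_mul]
    rw [abs_mul, abs_mul, abs_mul, abs_two] at e0
    have e5 : |β (F T)| / 2 * τ ^ 2 * |q| ≤ C * τ ^ 8 := by
      refine le_trans ?_ e0
      have : |β (F T)| / 2 * τ * (1 / 2 * τ) ≤ |F₁ (T - τ)| * |Real.sin τ| :=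
        mul_le_mul e1 e2 (by positivity) (abs_nonneg _)
      nlinarith [abs_nonneg q]
    have e6 : |β (F T)| / 2 * |q| ≤ C * τ ^ 6 := by
      have : τ ^ 2 * (|β (F T)| / 2 * |q|) ≤ τ ^ 2 * (C * τ ^ 6) := by linarith
      exact le_of_mul_le_mul_left this (by positivity)
    have hC0 : 0 ≤ C := by
      by_contra! hneg
      have h1 : 0 ≤ |β (F T)| / 2 * |q| := by positivity
      have h2 : C * τ ^ 6 < 0 := mul_neg_of_neg_of_pos hneg (by positivity)
      linarith
    have e7 : τ ^ 6 ≤ 64 * Real.sin τ ^ 6 := by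
      have : (1 / 2 * τ) ^ 6 ≤ |Real.sin τ| ^ 6 := pow_le_pow_left₀ (by positivity) e2 6
      rw [Even.pow_abs (by decide)] at this
      linarith
    rw [div_mul_eq_mul_div, le_div_iff₀ hβ']
    norm_num
    nlinarith)
  obtain ⟨r1, r2, r3⟩ := symmetric_of_moments hl1 hl2 (h.mult_pos 1) (h.mult_pos 2) (h.mult_pos 3)
    ha (by linarith) hc
  refine ⟨?_, ?_, r3⟩
  · have := hx 2 k2
    rw [← hx₂, r1] at this
    linarith
  · rw [hx₁, hx₃, neg_div, neg_div] at r2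
    linarith

end NormalProfile

/-! ### Differential identities for radially extended isoparametric functions -/

section
variable {V : Type*} [NormedAddCommGroup V] [InnerProductSpace ℝ V] [FiniteDimensional ℝ V]

/-- A function constant along rays whose restriction to the unit sphere is isoparametric. -/
structure RadialIsoparametric (E : V → ℝ) (a b : ℝ → ℝ) : Prop where
  smooth : ContDiffOn ℝ (⊤ : ℕ∞) E {0}ᶜ
  radial : ∀ y, ∀ r : ℝ, 0 < r → E (r • y) = E y
  norm_gradient : ∀ y, ‖y‖ = 1 → ‖gradient E y‖ ^ 2 = b (E y)
  laplacian : ∀ y, ‖y‖ = 1 → Laplacian.laplacian E y = a (E y)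
  smooth_laplacian : ContDiff ℝ (⊤ : ℕ∞) a
  smooth_gradient : ContDiff ℝ (⊤ : ℕ∞) b

namespace RadialIsoparametric

variable {E : V → ℝ} {a b : ℝ → ℝ} {y v w : V}

theorem contDiffAt (h : RadialIsoparametric E a b) (hy : y ≠ 0) : ContDiffAt ℝ (⊤ : ℕ∞) E y :=
  h.smooth.contDiffAt (isOpen_compl_singleton.mem_nhds hy)

theorem hasFDerivAt (h : RadialIsoparametric E a b) (hy : y ≠ 0) :
    HasFDerivAt E (innerSL ℝ (gradient E y)) y := by
  have := ((h.contDiffAt hy).differentiableAt (by simp)).hasGradientAt.hasFDerivAt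
  exact this

theorem contDiffAt_gradient (h : RadialIsoparametric E a b) (hy : y ≠ 0) :
    ContDiffAt ℝ (⊤ : ℕ∞) (gradient E) y := by
  have h1 : ContDiffAt ℝ (⊤ : ℕ∞) (fderiv ℝ E) y := (h.contDiffAt hy).fderiv_right (by simp)
  exact (InnerProductSpace.toDual ℝ V).symm.contDiff.contDiffAt.comp y h1

theorem hasFDerivAt_gradient (h : RadialIsoparametric E a b) (hy : y ≠ 0) :
    HasFDerivAt (gradient E) (fderiv ℝ (gradient E) y) y :=
  ((h.contDiffAt_gradient hy).differentiableAt (by simp)).hasFDerivAt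

theorem contDiffAt_hessian (h : RadialIsoparametric E a b) (hy : y ≠ 0) :
    ContDiffAt ℝ (⊤ : ℕ∞) (fderiv ℝ (gradient E)) y :=
  (h.contDiffAt_gradient hy).fderiv_right (by simp)

theorem hasFDerivAt_hessian (h : RadialIsoparametric E a b) (hy : y ≠ 0) :
    HasFDerivAt (fderiv ℝ (gradient E)) (fderiv ℝ (fderiv ℝ (gradient E)) y) y :=
  ((h.contDiffAt_hessian hy).differentiableAt (by simp)).hasFDerivAt

theorem fderiv_fderiv_apply (h : RadialIsoparametric E a b) (hy : y ≠ 0) (v w : V) :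
    fderiv ℝ (fderiv ℝ E) y v w = ⟪fderiv ℝ (gradient E) y v, w⟫_ℝ := by
  have h1 : fderiv ℝ E = fun z => innerSL ℝ (gradient E z) := by
    ext z u; simp
  have h2 : HasFDerivAt (fderiv ℝ E) ((innerSL ℝ).comp (fderiv ℝ (gradient E) y)) y := by
    rw [h1]; exact (innerSL ℝ (E := V)).hasFDerivAt.comp y (h.hasFDerivAt_gradient hy)
  rw [h2.fderiv]; rfl

theorem hessian_symm (h : RadialIsoparametric E a b) (hy : y ≠ 0) (v w : V) :
    ⟪fderiv ℝ (gradient E) y v, w⟫_ℝ = ⟪v, fderiv ℝ (gradient E) y w⟫_ℝ := by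
  have hs : IsSymmSndFDerivAt ℝ E y := (h.contDiffAt hy).isSymmSndFDerivAt
      (by rw [minSmoothness_of_isRCLikeNormedField]; exact WithTop.coe_le_coe.2 (le_top : (2 : ℕ∞) ≤ ⊤))
  have := hs v w
  rw [h.fderiv_fderiv_apply hy, h.fderiv_fderiv_apply hy] at this
  rw [this, real_inner_comm]

theorem laplacian_eq_sum (h : RadialIsoparametric E a b) (hy : y ≠ 0) {ι : Type*} [Fintype ι]
    (e : OrthonormalBasis ι ℝ V) :
    Laplacian.laplacian E y = ∑ i, ⟪fderiv ℝ (gradient E) y (e i), e i⟫_ℝ := by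
  rw [InnerProductSpace.laplacian_eq_iteratedFDeriv_orthonormalBasis E e]
  refine Finset.sum_congr rfl fun i _ => ?_
  rw [iteratedFDeriv_two_apply, ← h.fderiv_fderiv_apply hy]
  simp

theorem inner_gradient_self (h : RadialIsoparametric E a b) (hy : y ≠ 0) :
    ⟪gradient E y, y⟫_ℝ = 0 := by
  have h1 : HasDerivAt (fun r : ℝ => r • y) y 1 := by
    simpa using (hasDerivAt_id (1:ℝ)).smul_const y
  have h2 : HasDerivAt (fun r : ℝ => E (r • y)) ⟪gradient E y, y⟫_ℝ 1 := by
    have h3 : HasFDerivAt E (innerSL ℝ (gradient E y)) ((1:ℝ) • y) := by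
      rw [one_smul]; exact h.hasFDerivAt hy
    exact h3.comp_hasDerivAt 1 h1
  have h4 : HasDerivAt (fun r : ℝ => E (r • y)) 0 1 := by
    refine (hasDerivAt_const (1:ℝ) (E y)).congr_of_eventuallyEq ?_
    filter_upwards [Ioi_mem_nhds one_pos] with r hr using h.radial y r hr
  exact h2.unique h4

theorem gradient_smul (h : RadialIsoparametric E a b) (hy : y ≠ 0) {r : ℝ} (hr : 0 < r) :
    r • gradient E (r • y) = gradient E y := by
  have hry : r • y ≠ 0 := smul_ne_zero hr.ne' hy
  have h1 : HasFDerivAt (fun z : V => r • z) (r • ContinuousLinearMap.id ℝ V) y :=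
    (hasFDerivAt_id y).const_smul r
  have h2 := (h.hasFDerivAt hry).comp y h1
  have h3 : (E ∘ fun z : V => r • z) = E := by ext z; exact h.radial z r hr
  rw [h3] at h2
  have h4 := h2.unique (h.hasFDerivAt hy)
  refine ext_inner_right ℝ fun v => ?_
  have := congrArg (fun L => L v) h4
  simpa [inner_smul_left, inner_smul_right] using this

/-- The gradient is homogeneous of degree -1, so the norm condition on the sphere becomes an
identity on an open set, which can be differentiated in all directions. -/
theorem norm_sq_mul_norm_gradient_sq (h : RadialIsoparametric E a b) (hy : y ≠ 0) :
    ‖y‖ ^ 2 * ‖gradient E y‖ ^ 2 = b (E y) := by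
  have hp : 0 < ‖y‖⁻¹ := inv_pos.2 (norm_pos_iff.2 hy)
  have h1 := h.norm_gradient (‖y‖⁻¹ • y) (by simp [norm_smul, hy])
  rw [h.radial y _ hp] at h1
  rw [← h1, ← h.gradient_smul hy hp, norm_smul, Real.norm_eq_abs, abs_of_pos hp, mul_pow]
  field_simp [norm_ne_zero_iff.2 hy]

/-- Differentiating the orthogonality of gradient and position, using the symmetry of the Hessian.
-/
theorem hessian_self (h : RadialIsoparametric E a b) (hy : y ≠ 0) :
    fderiv ℝ (gradient E) y y = -gradient E y := by
  have h1 : HasFDerivAt (fun z => ⟪gradient E z, z⟫_ℝ) _ y :=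
    (h.hasFDerivAt_gradient hy).inner ℝ (hasFDerivAt_id y)
  have h2 : HasFDerivAt (fun z => ⟪gradient E z, z⟫_ℝ) (0 : V →L[ℝ] ℝ) y := by
    refine (hasFDerivAt_const (0:ℝ) y).congr_of_eventuallyEq ?_
    filter_upwards [isOpen_compl_singleton.mem_nhds hy] with z hz using h.inner_gradient_self hz
  refine ext_inner_right ℝ fun v => ?_
  have h3 := congrArg (fun L => L v) (h1.unique h2)
  simp [fderivInnerCLM_apply, -inner_gradient_left] at h3
  rw [h.hessian_symm hy, inner_neg_left, real_inner_comm]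
  linarith

theorem hasFDerivAt_comp (h : RadialIsoparametric E a b) (hy : y ≠ 0) {β : ℝ → ℝ}
    (hβ : ContDiff ℝ (⊤ : ℕ∞) β) :
    HasFDerivAt (fun z => β (E z)) (deriv β (E y) • innerSL ℝ (gradient E y)) y :=
  ((hβ.differentiable (by simp)).differentiableAt.hasDerivAt).comp_hasFDerivAt y
    (h.hasFDerivAt hy)

/-- The derivative of `‖y‖ ^ 2 * ‖∇E‖ ^ 2 = b (E y)`. On the unit sphere it keeps the span of `y`
and `∇E` invariant under the Hessian. -/
theorem hessian_gradient (h : RadialIsoparametric E a b) (hy : y ≠ 0) :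
    ‖y‖ ^ 2 • fderiv ℝ (gradient E) y (gradient E y) =
      (deriv b (E y) / 2) • gradient E y - ‖gradient E y‖ ^ 2 • y := by
  have h1 := ((hasFDerivAt_id y).norm_sq).mul ((h.hasFDerivAt_gradient hy).norm_sq)
  have h2 := (h.hasFDerivAt_comp hy h.smooth_gradient)
  have h3 := h1.congr_of_eventuallyEq (f₁ := fun z => b (E z)) (by
    filter_upwards [isOpen_compl_singleton.mem_nhds hy] with z hz
    exact (h.norm_sq_mul_norm_gradient_sq hz).symm)
  refine ext_inner_right ℝ fun v => ?_
  have h4 := congrArg (fun L => L v) (h3.unique h2)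
  simp [-inner_gradient_left] at h4
  simp only [inner_sub_left, inner_smul_left, conj_trivial]
  rw [h.hessian_symm hy]
  linarith

/-- The Riccati equation for the Hessian in the gradient direction: differentiate the previous
identity along a vector tangent to the level set and exchange the two derivatives of the gradient.
The term `-‖∇E‖ ^ 2 • v` reflects the curvature of the sphere. -/
theorem deriv_hessian_gradient (h : RadialIsoparametric E a b) (hy : ‖y‖ = 1)
    (hvy : ⟪y, v⟫_ℝ = 0) (hvg : ⟪gradient E y, v⟫_ℝ = 0) :
    fderiv ℝ (fderiv ℝ (gradient E)) y (gradient E y) v +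
      fderiv ℝ (gradient E) y (fderiv ℝ (gradient E) y v) =
      (deriv b (E y) / 2) • fderiv ℝ (gradient E) y v - ‖gradient E y‖ ^ 2 • v := by
  have hy0 : y ≠ 0 := by rintro rfl; simp at hy
  have hs : IsSymmSndFDerivAt ℝ (gradient E) y :=
    (h.contDiffAt_gradient hy0).isSymmSndFDerivAt
      (by rw [minSmoothness_of_isRCLikeNormedField]; exact WithTop.coe_le_coe.2 (le_top : (2 : ℕ∞) ≤ ⊤))
  have hβ : ContDiff ℝ (⊤ : ℕ∞) fun x => deriv b x / 2 :=
    (h.smooth_gradient.iterate_deriv 1).div_const 2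
  have hgg : ⟪gradient E y, fderiv ℝ (gradient E) y v⟫_ℝ = 0 := by
    have h1 := congrArg (fun u => ⟪u, v⟫_ℝ) (h.hessian_gradient hy0)
    simp only [hy, inner_sub_left, inner_smul_left, hvg, hvy] at h1
    rw [← h.hessian_symm hy0]
    simpa using h1
  have hL := ((hasFDerivAt_id y).norm_sq).smul
    ((h.hasFDerivAt_hessian hy0).clm_apply (h.hasFDerivAt_gradient hy0))
  have hR := ((h.hasFDerivAt_comp hy0 hβ).smul (h.hasFDerivAt_gradient hy0)).sub
    (((h.hasFDerivAt_gradient hy0).norm_sq).smul (hasFDerivAt_id y))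
  have h3 := hL.congr_of_eventuallyEq (f₁ := fun z => (deriv b (E z) / 2) • gradient E z -
      ‖gradient E z‖ ^ 2 • z) (by
    filter_upwards [isOpen_compl_singleton.mem_nhds hy0] with z hz
    exact (h.hessian_gradient hz).symm)
  have h4 := congrArg (fun L => L v) (h3.unique hR)
  simp [hvy, hvg, hgg, hy, -inner_gradient_left] at h4
  rw [hs (gradient E y) v, add_comm]
  exact h4

end RadialIsoparametric
end

/-! ### Normal great circles and the Hessian along them -/

section
variable {V : Type*} [NormedAddCommGroup V] [InnerProductSpace ℝ V]

/-- The great circle through `p` with initial velocity `η`. -/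
noncomputable def greatCircle (p η : V) (t : ℝ) : V := Real.cos t • p + Real.sin t • η

/-- The velocity field of the great circle. -/
noncomputable def greatCircleDeriv (p η : V) (t : ℝ) : V := Real.cos t • η - Real.sin t • p

section
variable {p η : V} (t : ℝ)

theorem hasDerivAt_greatCircle : HasDerivAt (greatCircle p η) (greatCircleDeriv p η t) t := by
  refine (((Real.hasDerivAt_cos t).smul_const p).add
    ((Real.hasDerivAt_sin t).smul_const η)).congr_deriv ?_
  simp only [greatCircleDeriv]; module

theorem hasDerivAt_greatCircleDeriv :
    HasDerivAt (greatCircleDeriv p η) (-greatCircle p η t) t := by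
  refine (((Real.hasDerivAt_cos t).smul_const η).sub
    ((Real.hasDerivAt_sin t).smul_const p)).congr_deriv ?_
  simp only [greatCircle]; module

theorem inner_greatCircle_self (hp : ‖p‖ = 1) (hη : ‖η‖ = 1) (hpη : ⟪p, η⟫_ℝ = 0) :
    ⟪greatCircle p η t, greatCircle p η t⟫_ℝ = 1 := by
  have := Real.sin_sq_add_cos_sq t
  simp only [greatCircle, inner_add_left, inner_add_right, inner_smul_left, inner_smul_right,
    real_inner_self_eq_norm_sq, hp, hη, hpη, real_inner_comm p η, conj_trivial]
  linarith

theorem inner_greatCircleDeriv_self (hp : ‖p‖ = 1) (hη : ‖η‖ = 1) (hpη : ⟪p, η⟫_ℝ = 0) :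
    ⟪greatCircleDeriv p η t, greatCircleDeriv p η t⟫_ℝ = 1 := by
  have := Real.sin_sq_add_cos_sq t
  simp only [greatCircleDeriv, inner_sub_left, inner_sub_right, inner_smul_left, inner_smul_right,
    real_inner_self_eq_norm_sq, hp, hη, hpη, real_inner_comm p η, conj_trivial]
  linarith

theorem inner_greatCircle_deriv (hp : ‖p‖ = 1) (hη : ‖η‖ = 1) (hpη : ⟪p, η⟫_ℝ = 0) :
    ⟪greatCircle p η t, greatCircleDeriv p η t⟫_ℝ = 0 := by
  simp only [greatCircle, greatCircleDeriv, inner_add_left, inner_sub_right, inner_smul_left,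
    inner_smul_right, real_inner_self_eq_norm_sq, hp, hη, hpη, real_inner_comm p η, conj_trivial]
  ring

theorem norm_greatCircle (hp : ‖p‖ = 1) (hη : ‖η‖ = 1) (hpη : ⟪p, η⟫_ℝ = 0) :
    ‖greatCircle p η t‖ = 1 := by
  rw [norm_eq_sqrt_real_inner, inner_greatCircle_self t hp hη hpη, Real.sqrt_one]

theorem norm_greatCircleDeriv (hp : ‖p‖ = 1) (hη : ‖η‖ = 1) (hpη : ⟪p, η⟫_ℝ = 0) :
    ‖greatCircleDeriv p η t‖ = 1 := by
  rw [norm_eq_sqrt_real_inner, inner_greatCircleDeriv_self t hp hη hpη, Real.sqrt_one]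

theorem greatCircle_ne_zero (hp : ‖p‖ = 1) (hη : ‖η‖ = 1) (hpη : ⟪p, η⟫_ℝ = 0) :
    greatCircle p η t ≠ 0 := by
  rw [← norm_ne_zero_iff, norm_greatCircle t hp hη hpη]; exact one_ne_zero

end

variable [FiniteDimensional ℝ V]

namespace RadialIsoparametric

variable {E : V → ℝ} {a b : ℝ → ℝ} {p η v : V} {r : ℝ}

/-- The derivative of `E` along the great circle. -/
noncomputable def speed (E : V → ℝ) (p η : V) (t : ℝ) : ℝ :=
  ⟪gradient E (greatCircle p η t), greatCircleDeriv p η t⟫_ℝ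

/-- The data of a normal geodesic: a point of the sphere and the unit normal direction. -/
structure NormalStart (E : V → ℝ) (p η : V) (r : ℝ) : Prop where
  norm_point : ‖p‖ = 1
  norm_normal : ‖η‖ = 1
  inner_eq : ⟪p, η⟫_ℝ = 0
  gradient_eq : gradient E p = r • η
  pos : 0 < r

section

theorem hasDerivAt_along
    (h : RadialIsoparametric E a b) (hs : NormalStart E p η r) (t : ℝ) : HasDerivAt (fun t => E (greatCircle p η t)) (speed E p η t) t :=
  (h.hasFDerivAt (greatCircle_ne_zero t hs.1 hs.2 hs.3)).comp_hasDerivAt t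
    (hasDerivAt_greatCircle t)

theorem hasDerivAt_gradient_along
    (h : RadialIsoparametric E a b) (hs : NormalStart E p η r) (t : ℝ) :
    HasDerivAt (fun t => gradient E (greatCircle p η t))
      (fderiv ℝ (gradient E) (greatCircle p η t) (greatCircleDeriv p η t)) t :=
  (h.hasFDerivAt_gradient (greatCircle_ne_zero t hs.1 hs.2 hs.3)).comp_hasDerivAt t
    (hasDerivAt_greatCircle t)

theorem hasDerivAt_hessian_along
    (h : RadialIsoparametric E a b) (hs : NormalStart E p η r) (t : ℝ) :
    HasDerivAt (fun t => fderiv ℝ (gradient E) (greatCircle p η t))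
      (fderiv ℝ (fderiv ℝ (gradient E)) (greatCircle p η t) (greatCircleDeriv p η t)) t :=
  (h.hasFDerivAt_hessian (greatCircle_ne_zero t hs.1 hs.2 hs.3)).comp_hasDerivAt t
    (hasDerivAt_greatCircle t)

theorem hasDerivAt_speed
    (h : RadialIsoparametric E a b) (hs : NormalStart E p η r) (t : ℝ) : HasDerivAt (speed E p η)
    ⟪fderiv ℝ (gradient E) (greatCircle p η t) (greatCircleDeriv p η t),
      greatCircleDeriv p η t⟫_ℝ t := by
  have := (h.hasDerivAt_gradient_along hs t).inner ℝ (hasDerivAt_greatCircleDeriv (p := p) (η := η) t)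
  refine this.congr_deriv ?_
  rw [inner_neg_right, h.inner_gradient_self (greatCircle_ne_zero t hs.1 hs.2 hs.3)]
  simp

/-- The great circle closes up after time `2π`, so Rolle's theorem yields a critical time; the least
one exists by compactness. -/
theorem exists_first_zero
    (h : RadialIsoparametric E a b) (hs : NormalStart E p η r) :
    ∃ T, 0 < T ∧ speed E p η T = 0 ∧ ∀ t ∈ Ico 0 T, 0 < speed E p η t := by
  have hcont : Continuous (speed E p η) :=
    continuous_iff_continuousAt.2 fun t => (h.hasDerivAt_speed hs t).continuousAt
  have h0 : 0 < speed E p η 0 := by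
    simp [speed, greatCircle, greatCircleDeriv, hs.gradient_eq, inner_smul_left,
      hs.norm_normal, hs.pos, -inner_gradient_left]
  obtain ⟨c, hc, hc0⟩ := exists_hasDerivAt_eq_zero (f := fun t => E (greatCircle p η t))
    (f' := speed E p η) Real.two_pi_pos
    (fun t _ => (h.hasDerivAt_along hs t).continuousAt.continuousWithinAt)
    (by simp [greatCircle]) (fun t _ => h.hasDerivAt_along hs t)
  have hK : IsCompact (Icc 0 c ∩ speed E p η ⁻¹' {0}) :=
    isCompact_Icc.inter_right (isClosed_singleton.preimage hcont)
  obtain ⟨T, ⟨hT, hT0⟩, hleast⟩ := hK.exists_isLeast ⟨c, ⟨hc.1.le, le_rfl⟩, hc0⟩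
  have hTpos : 0 < T := lt_of_le_of_ne hT.1 (by rintro rfl; exact h0.ne' hT0)
  refine ⟨T, hTpos, hT0, fun t ht => ?_⟩
  by_contra! hneg
  obtain ⟨s, hs1, hs2⟩ := intermediate_value_Icc' ht.1 hcont.continuousOn ⟨hneg, h0.le⟩
  have := hleast ⟨⟨hs1.1, hs1.2.trans (ht.2.le.trans hT.2)⟩, hs2⟩
  linarith [hs1.2, ht.2]

end

section
variable {T : ℝ}

/-- Until the first focal time the gradient is tangent to the normal geodesic. -/
theorem gradient_along
    (h : RadialIsoparametric E a b) (hs : NormalStart E p η r)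
    (hT : ∀ t ∈ Ico 0 T, 0 < speed E p η t) {t : ℝ} (ht : t ∈ Ico 0 T) :
    gradient E (greatCircle p η t) = speed E p η t • greatCircleDeriv p η t := by
  have hne : ∀ t, greatCircle p η t ≠ 0 := fun t => greatCircle_ne_zero t hs.1 hs.2 hs.3
  set J : ℝ → V := fun t => gradient E (greatCircle p η t) - speed E p η t • greatCircleDeriv p η t
    with hJ
  have hJd : ∀ t, HasDerivAt J (fderiv ℝ (gradient E) (greatCircle p η t) (greatCircleDeriv p η t) -
      (speed E p η t • -greatCircle p η t +
        ⟪fderiv ℝ (gradient E) (greatCircle p η t) (greatCircleDeriv p η t),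
          greatCircleDeriv p η t⟫_ℝ • greatCircleDeriv p η t)) t := fun t =>
    (h.hasDerivAt_gradient_along hs t).sub
      ((h.hasDerivAt_speed hs t).smul (hasDerivAt_greatCircleDeriv t))
  have hcE : Continuous fun t => E (greatCircle p η t) :=
    continuous_iff_continuousAt.2 fun t => (h.hasDerivAt_along hs t).continuousAt
  have hcS : Continuous fun t => fderiv ℝ (gradient E) (greatCircle p η t) :=
    continuous_iff_continuousAt.2 fun t => (h.hasDerivAt_hessian_along hs t).continuousAt
  have hcJ : Continuous J := continuous_iff_continuousAt.2 fun t => (hJd t).continuousAt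
  have hcs : Continuous (speed E p η) :=
    continuous_iff_continuousAt.2 fun t => (h.hasDerivAt_speed hs t).continuousAt
  have hcb : Continuous (deriv b) := h.smooth_gradient.continuous_deriv (by simp)
  have hcC : Continuous fun t => |deriv b (E (greatCircle p η t)) / 2| +
      2 * ‖fderiv ℝ (gradient E) (greatCircle p η t)‖ + ‖J t‖ :=
    (((hcb.comp hcE).div_const 2).abs.add (continuous_const.mul hcS.norm)).add hcJ.norm
  -- `J` is the part of the gradient normal to the velocity. Multiplying `J'` by the speed expresses
  -- it through `J`; the quadratic term `‖J‖ ^ 2` is absorbed by including `‖J t‖` in the continuous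
  -- coefficient.
  have key := eq_zero_of_norm_smul_deriv_le (T := T) (φ := speed E p η)
    (C := fun t => |deriv b (E (greatCircle p η t)) / 2| +
      2 * ‖fderiv ℝ (gradient E) (greatCircle p η t)‖ + ‖J t‖)
    (fun t _ => hJd t) hcs.continuousOn hT hcC.continuousOn (by
      intro t _
      have hg1 := norm_greatCircle t hs.1 hs.2 hs.3
      have hg2 := norm_greatCircleDeriv t hs.1 hs.2 hs.3
      have hg3 := inner_greatCircle_deriv t hs.1 hs.2 hs.3
      have hg4 := inner_greatCircleDeriv_self t hs.1 hs.2 hs.3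
      have hSg := h.hessian_gradient (hne t)
      have hJt : J t = gradient E (greatCircle p η t) - speed E p η t • greatCircleDeriv p η t := rfl
      have hsp : speed E p η t = ⟪gradient E (greatCircle p η t), greatCircleDeriv p η t⟫_ℝ := rfl
      generalize J t = j at *
      generalize speed E p η t = f at *
      generalize deriv b (E (greatCircle p η t)) / 2 = β at *
      generalize gradient E (greatCircle p η t) = g at *
      generalize fderiv ℝ (gradient E) (greatCircle p η t) = S at *
      generalize greatCircle p η t = y at *
      generalize greatCircleDeriv p η t = u at *
      rw [hg1, one_pow, one_smul] at hSg
      have hgj : g = j + f • u := by rw [hJt]; abel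
      have hju : ⟪j, u⟫_ℝ = 0 := by
        rw [hJt, inner_sub_left, inner_smul_left, hg4, ← hsp]; simp
      have hn : ‖g‖ ^ 2 = ‖j‖ ^ 2 + f ^ 2 := by
        rw [hgj, norm_add_sq_real, inner_smul_right, hju, norm_smul, hg2]; simp
      have hSu : f • S u = β • g - ‖g‖ ^ 2 • y - S j := by
        rw [← hSg, ← map_smul, ← map_sub]; congr 1; rw [hgj]; abel
      have hSuu : f * ⟪S u, u⟫_ℝ = β * f - ⟪S j, u⟫_ℝ := by
        have := congrArg (fun z => ⟪z, u⟫_ℝ) hSu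
        simp only [inner_sub_left, inner_smul_left, hg3, ← hsp] at this
        simpa using this
      have e : f • (S u - (f • -y + ⟪S u, u⟫_ℝ • u)) =
          β • j - S j + ⟪S j, u⟫_ℝ • u - ‖j‖ ^ 2 • y := by
        have : f • (S u - (f • -y + ⟪S u, u⟫_ℝ • u)) =
            f • S u + f ^ 2 • y - (f * ⟪S u, u⟫_ℝ) • u := by module
        rw [this, hSu, hSuu, hn, hgj]
        module
      rw [e]
      have b1 : ‖S j‖ ≤ ‖S‖ * ‖j‖ := S.le_opNorm j
      have b2 : ‖⟪S j, u⟫_ℝ • u‖ ≤ ‖S‖ * ‖j‖ := by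
        rw [norm_smul, hg2, mul_one]
        exact (norm_inner_le_norm _ _).trans (by rw [hg2, mul_one]; exact b1)
      have b3 : ‖‖j‖ ^ 2 • y‖ = ‖j‖ * ‖j‖ := by
        rw [norm_smul, hg1, mul_one, Real.norm_eq_abs, abs_of_nonneg (sq_nonneg _), sq]
      have b4 : ‖β • j‖ = |β| * ‖j‖ := by rw [norm_smul, Real.norm_eq_abs]
      calc _ ≤ ‖β • j‖ + ‖S j‖ + ‖⟪S j, u⟫_ℝ • u‖ + ‖‖j‖ ^ 2 • y‖ :=
            (norm_sub_le _ _).trans (by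
              gcongr
              exact (norm_add_le _ _).trans (by gcongr; exact norm_sub_le _ _))
        _ ≤ |β| * ‖j‖ + ‖S‖ * ‖j‖ + ‖S‖ * ‖j‖ + ‖j‖ * ‖j‖ := by rw [b3, b4]; gcongr
        _ = _ := by ring)
    (by
      have : greatCircle p η 0 = p := by simp [greatCircle]
      simp [hJ, speed, this, hs.gradient_eq, greatCircleDeriv, hs.norm_normal, inner_smul_left,
        -inner_gradient_left])
  exact sub_eq_zero.1 (key t ht)

/-- Once the gradient is speed times velocity, pair `hessian_gradient` with the velocity and cancel
the speed. -/
theorem deriv_speed_eq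
    (h : RadialIsoparametric E a b) (hs : NormalStart E p η r)
    (hT : ∀ t ∈ Ico 0 T, 0 < speed E p η t) {t : ℝ} (ht : t ∈ Ico 0 T) :
    ⟪fderiv ℝ (gradient E) (greatCircle p η t) (greatCircleDeriv p η t),
      greatCircleDeriv p η t⟫_ℝ = deriv b (E (greatCircle p η t)) / 2 := by
  have hg := h.gradient_along hs hT ht
  have hSg := h.hessian_gradient (greatCircle_ne_zero t hs.1 hs.2 hs.3)
  rw [norm_greatCircle t hs.1 hs.2 hs.3, one_pow, one_smul, hg] at hSg
  have := congrArg (fun z => ⟪z, greatCircleDeriv p η t⟫_ℝ) hSg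
  simp only [map_smul, inner_sub_left, inner_smul_left, inner_greatCircle_deriv t hs.1 hs.2 hs.3,
    inner_greatCircleDeriv_self t hs.1 hs.2 hs.3, conj_trivial] at this
  have h0 := (hT t ht).ne'
  exact mul_left_cancel₀ h0 (by linarith)

/-- The endpoint, where the speed vanishes and cannot be cancelled, follows by continuity. It is
needed to reflect the solution there. -/
theorem hasDerivAt_speed_of_mem_Icc
    (h : RadialIsoparametric E a b) (hs : NormalStart E p η r)
    (hT : ∀ t ∈ Ico 0 T, 0 < speed E p η t) {t : ℝ} (ht : t ∈ Icc 0 T) (hT0 : 0 < T) :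
    HasDerivAt (speed E p η) (deriv b (E (greatCircle p η t)) / 2) t := by
  have key : ⟪fderiv ℝ (gradient E) (greatCircle p η t) (greatCircleDeriv p η t),
      greatCircleDeriv p η t⟫_ℝ = deriv b (E (greatCircle p η t)) / 2 := by
    rcases ht.2.eq_or_lt with rfl | hlt
    · have hd : Continuous (greatCircleDeriv p η) :=
        continuous_iff_continuousAt.2 fun t => (hasDerivAt_greatCircleDeriv t).continuousAt
      have hcE : Continuous fun t => E (greatCircle p η t) :=
        continuous_iff_continuousAt.2 fun t => (h.hasDerivAt_along hs t).continuousAt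
      have hcS : Continuous fun t => fderiv ℝ (gradient E) (greatCircle p η t) :=
        continuous_iff_continuousAt.2 fun t => (h.hasDerivAt_hessian_along hs t).continuousAt
      have hcb : Continuous (deriv b) := h.smooth_gradient.continuous_deriv (by simp)
      have h1 := (((hcS.clm_apply hd).inner (𝕜 := ℝ) hd).tendsto t).mono_left
        (nhdsWithin_le_nhds (s := Iio t))
      have h2 := (((hcb.comp hcE).div_const 2).tendsto t).mono_left
        (nhdsWithin_le_nhds (s := Iio t))
      refine tendsto_nhds_unique h1 (h2.congr' ?_)
      filter_upwards [Ioo_mem_nhdsLT hT0] with s hs'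
      exact (h.deriv_speed_eq hs hT ⟨hs'.1.le, hs'.2⟩).symm
    · exact h.deriv_speed_eq hs hT ⟨ht.1, hlt⟩
  rw [← key]
  exact h.hasDerivAt_speed hs t

/-- The Hessian along the normal geodesic acts on a principal vector through the Jacobi field. -/
theorem hessian_along
    (h : RadialIsoparametric E a b) (hs : NormalStart E p η r)
    (hT : ∀ t ∈ Ico 0 T, 0 < speed E p η t) {κ : ℝ} (hvp : ⟪p, v⟫_ℝ = 0) (hvη : ⟪η, v⟫_ℝ = 0)
    (hv : fderiv ℝ (gradient E) p v = -(r * κ) • v) {t : ℝ} (ht : t ∈ Ico 0 T) :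
    (Real.cos t - κ * Real.sin t) • fderiv ℝ (gradient E) (greatCircle p η t) v =
      -(speed E p η t * (Real.sin t + κ * Real.cos t)) • v := by
  have hne : ∀ t, greatCircle p η t ≠ 0 := fun t => greatCircle_ne_zero t hs.1 hs.2 hs.3
  set Z : ℝ → V := fun t => (Real.cos t - κ * Real.sin t) •
    fderiv ℝ (gradient E) (greatCircle p η t) v +
      (speed E p η t * (Real.sin t + κ * Real.cos t)) • v with hZ
  have hcE : Continuous fun t => E (greatCircle p η t) :=
    continuous_iff_continuousAt.2 fun t => (h.hasDerivAt_along hs t).continuousAt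
  have hcS : Continuous fun t => fderiv ℝ (gradient E) (greatCircle p η t) :=
    continuous_iff_continuousAt.2 fun t => (h.hasDerivAt_hessian_along hs t).continuousAt
  have hcs : Continuous (speed E p η) :=
    continuous_iff_continuousAt.2 fun t => (h.hasDerivAt_speed hs t).continuousAt
  have hcb : Continuous (deriv b) := h.smooth_gradient.continuous_deriv (by simp)
  have hcC : Continuous fun t => |deriv b (E (greatCircle p η t)) / 2| +
      ‖fderiv ℝ (gradient E) (greatCircle p η t)‖ :=
    ((hcb.comp hcE).div_const 2).abs.add hcS.norm
  have hZd : ∀ t ∈ Ico 0 T, HasDerivAt Z (((Real.cos t - κ * Real.sin t) •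
      fderiv ℝ (fderiv ℝ (gradient E)) (greatCircle p η t) (greatCircleDeriv p η t) v -
      (Real.sin t + κ * Real.cos t) • fderiv ℝ (gradient E) (greatCircle p η t) v) +
      (deriv b (E (greatCircle p η t)) / 2 * (Real.sin t + κ * Real.cos t) +
        speed E p η t * (Real.cos t - κ * Real.sin t)) • v) t := by
    intro t ht
    have d1 := (Real.hasDerivAt_cos t).sub ((Real.hasDerivAt_sin t).const_mul κ)
    have d2 := (Real.hasDerivAt_sin t).add ((Real.hasDerivAt_cos t).const_mul κ)
    have d3 := (h.hasDerivAt_hessian_along hs t).clm_apply (hasDerivAt_const t v)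
    have d4 := h.hasDerivAt_speed_of_mem_Icc hs hT ⟨ht.1, ht.2.le⟩ (ht.1.trans_lt ht.2)
    refine ((d1.smul d3).add ((d4.mul d2).smul_const v)).congr_deriv ?_
    simp only [map_zero, add_zero, Pi.sub_apply, Pi.add_apply]
    module
  have key := eq_zero_of_norm_smul_deriv_le (T := T) (φ := speed E p η)
    (C := fun t => |deriv b (E (greatCircle p η t)) / 2| +
      ‖fderiv ℝ (gradient E) (greatCircle p η t)‖) hZd hcs.continuousOn hT hcC.continuousOn (by
      intro t ht
      have hg := h.gradient_along hs hT ht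
      have hyv : ⟪greatCircle p η t, v⟫_ℝ = 0 := by
        simp [greatCircle, inner_add_left, inner_smul_left, hvp, hvη]
      have huv : ⟪greatCircleDeriv p η t, v⟫_ℝ = 0 := by
        simp [greatCircleDeriv, inner_sub_left, inner_smul_left, hvp, hvη]
      have hR := h.deriv_hessian_gradient (norm_greatCircle t hs.1 hs.2 hs.3) hyv
        (by rw [hg, inner_smul_left, huv, mul_zero])
      rw [hg, norm_smul, norm_greatCircleDeriv t hs.1 hs.2 hs.3, mul_one, Real.norm_eq_abs, sq_abs,
        map_smul, _root_.smul_apply] at hR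
      have hZt : Z t = (Real.cos t - κ * Real.sin t) •
        fderiv ℝ (gradient E) (greatCircle p η t) v +
          (speed E p η t * (Real.sin t + κ * Real.cos t)) • v := rfl
      generalize Z t = z at *
      generalize speed E p η t = f at *
      generalize deriv b (E (greatCircle p η t)) / 2 = β at *
      generalize fderiv ℝ (fderiv ℝ (gradient E)) (greatCircle p η t) (greatCircleDeriv p η t) v
        = S' at *
      generalize fderiv ℝ (gradient E) (greatCircle p η t) = S at *
      generalize Real.cos t - κ * Real.sin t = D at *
      generalize Real.sin t + κ * Real.cos t = N at *
      -- The Riccati equation turns the derivative of `Z` into a linear expression in `Z`, so the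
      -- vanishing initial value propagates.
      have e : f • ((D • S' - N • S v) + (β * N + f * D) • v) = β • z - S z := by
        have h1 : f • S' = β • S v - f ^ 2 • v - S (S v) := by rw [← hR]; abel
        have h2 : f • ((D • S' - N • S v) + (β * N + f * D) • v) =
            D • (f • S') - (f * N) • S v + (f * (β * N + f * D)) • v := by module
        rw [h2, h1, hZt]
        simp only [map_add, map_smul]
        module
      rw [e]
      calc _ ≤ ‖β • z‖ + ‖S z‖ := norm_sub_le _ _
        _ ≤ |β| * ‖z‖ + ‖S‖ * ‖z‖ := by
            rw [norm_smul, Real.norm_eq_abs]; gcongr; exact S.le_opNorm z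
        _ = _ := by ring)
    (by
      have : greatCircle p η 0 = p := by simp [greatCircle]
      simp [hZ, speed, this, hs.gradient_eq, greatCircleDeriv, hs.norm_normal, inner_smul_left,
        -inner_gradient_left, hv])
  have := key t ht
  simp only [hZ] at this
  rw [neg_smul]
  exact eq_neg_of_add_eq_zero_left this

/-- At a zero of `cos t - κ sin t` the Hessian formula would force `sin t + κ cos t = 0` as well,
but the two cannot vanish together. Positivity at time 0 then persists by the intermediate value
theorem. -/
theorem jacobi_pos
    (h : RadialIsoparametric E a b) (hs : NormalStart E p η r)
    (hT : ∀ t ∈ Ico 0 T, 0 < speed E p η t) {κ : ℝ} (hvp : ⟪p, v⟫_ℝ = 0) (hvη : ⟪η, v⟫_ℝ = 0) (hv0 : v ≠ 0)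
    (hv : fderiv ℝ (gradient E) p v = -(r * κ) • v) {t : ℝ} (ht : t ∈ Ico 0 T) :
    0 < Real.cos t - κ * Real.sin t := by
  have hne : ∀ t ∈ Ico 0 T, Real.cos t - κ * Real.sin t ≠ 0 := by
    intro t ht h0
    have h1 := h.hessian_along hs hT hvp hvη hv ht
    rw [h0, zero_smul] at h1
    have h2 := (smul_eq_zero.1 h1.symm).resolve_right hv0
    have h3 : Real.sin t + κ * Real.cos t = 0 := by
      have := hT t ht
      rw [neg_eq_zero] at h2
      exact (mul_eq_zero.1 h2).resolve_left this.ne'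
    have h4 := Real.sin_sq_add_cos_sq t
    have : (1 : ℝ) = 0 := by linear_combination -h4 + Real.sin t * h3 + Real.cos t * h0
    exact one_ne_zero this
  by_contra! hneg
  obtain ⟨s, hs1, hs2⟩ := intermediate_value_Icc' (f := fun t => Real.cos t - κ * Real.sin t)
    ht.1 (by fun_prop) (show (0:ℝ) ∈ _ from ⟨hneg, by simp⟩)
  exact hne s ⟨hs1.1, hs1.2.trans_lt ht.2⟩ hs2

/-- The Laplacian equation along a normal geodesic in terms of the principal curvatures. -/
theorem laplacian_along
    (h : RadialIsoparametric E a b) (hs : NormalStart E p η r)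
    (hT : ∀ t ∈ Ico 0 T, 0 < speed E p η t) {ι : Type*} [Fintype ι] {e : ι → V} (he : Orthonormal ℝ e) {κ : ι → ℝ}
    (hcard : Fintype.card ι + 2 = Module.finrank ℝ V)
    (hep : ∀ i, ⟪p, e i⟫_ℝ = 0) (heη : ∀ i, ⟪η, e i⟫_ℝ = 0)
    (hv : ∀ i, fderiv ℝ (gradient E) p (e i) = -(r * κ i) • e i) {t : ℝ} (ht : t ∈ Ico 0 T) :
    a (E (greatCircle p η t)) = deriv b (E (greatCircle p η t)) / 2 +
      speed E p η t * ∑ i, (-(Real.sin t + κ i * Real.cos t) /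
        (Real.cos t - κ i * Real.sin t)) := by
  have hne := greatCircle_ne_zero t hs.1 hs.2 hs.3
  have hyv : ∀ i, ⟪greatCircle p η t, e i⟫_ℝ = 0 := fun i => by
    simp [greatCircle, inner_add_left, inner_smul_left, hep, heη]
  have huv : ∀ i, ⟪greatCircleDeriv p η t, e i⟫_ℝ = 0 := fun i => by
    simp [greatCircleDeriv, inner_sub_left, inner_smul_left, hep, heη]
  have hyu := inner_greatCircle_deriv t hs.1 hs.2 hs.3
  set w : Fin 2 ⊕ ι → V := Sum.elim ![greatCircle p η t, greatCircleDeriv p η t] e with hw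
  have how : Orthonormal ℝ w := by
    constructor
    · rintro (i | i)
      · fin_cases i
        · exact norm_greatCircle t hs.1 hs.2 hs.3
        · exact norm_greatCircleDeriv t hs.1 hs.2 hs.3
      · exact he.1 i
    · rintro (i | i) (j | j) hij
      · fin_cases i <;> fin_cases j
        · exact absurd rfl hij
        · exact hyu
        · exact (real_inner_comm _ _).trans hyu
        · exact absurd rfl hij
      · fin_cases i
        · exact hyv j
        · exact huv j
      · fin_cases j
        · exact (real_inner_comm _ _).trans (hyv i)
        · exact (real_inner_comm _ _).trans (huv i)
      · exact he.2 fun hh => hij (by rw [hh])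
  have hspan : ⊤ ≤ Submodule.span ℝ (range w) := by
    rw [how.linearIndependent.span_eq_top_of_card_eq_finrank' (by simp; omega)]
  have hlap := h.laplacian_eq_sum hne (OrthonormalBasis.mk how hspan)
  rw [h.laplacian _ (norm_greatCircle t hs.1 hs.2 hs.3)] at hlap
  rw [hlap, Fintype.sum_sum_type, Fin.sum_univ_two, Finset.mul_sum]
  simp only [OrthonormalBasis.coe_mk, hw, Sum.elim_inl, Sum.elim_inr, Matrix.cons_val_zero,
    Matrix.cons_val_one]
  -- In the basis formed by position, velocity and principal vectors, the position contributes 0 and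
  -- the velocity contributes `b' / 2`.
  rw [h.hessian_self hne, inner_neg_left, h.inner_gradient_self hne, h.deriv_speed_eq hs hT ht,
    neg_zero, zero_add]
  congr 1
  refine Finset.sum_congr rfl fun i _ => ?_
  have hp := h.jacobi_pos hs hT (hep i) (heη i) (he.ne_zero i) (hv i) ht
  have h1 := congrArg (fun z => ⟪z, e i⟫_ℝ) (h.hessian_along hs hT (hep i) (heη i) (hv i) ht)
  simp only [inner_smul_left, real_inner_self_eq_norm_sq, he.1 i, conj_trivial] at h1
  rw [mul_div_assoc', eq_div_iff hp.ne']
  linarith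

end

end RadialIsoparametric
end

/-! ### Münzner's structure from both ends of the spectrum -/

theorem sum_comp_eq_sum_card_mul {ι : Type*} [Fintype ι] {κ : Fin 4 → ℝ}
    (hκ : Function.Injective κ) {k : ι → ℝ} (hk : ∀ i, k i ∈ range κ) (φ : ℝ → ℝ) :
    ∑ i, φ (k i) = ∑ j, (Finset.card {i | k i = κ j} : ℝ) * φ (κ j) := by
  choose c hc using hk
  rw [← Finset.sum_fiberwise_of_maps_to (g := c) (t := Finset.univ) (fun _ _ => Finset.mem_univ _)]
  refine Finset.sum_congr rfl fun j _ => ?_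
  have : ∀ i, c i = j ↔ k i = κ j := fun i => by rw [← hc i, hκ.eq_iff]
  simp only [this]
  rw [Finset.sum_congr rfl (g := fun _ => φ (κ j)) fun i hi => by rw [(Finset.mem_filter.1 hi).2]]
  simp

section
variable {V : Type*} [NormedAddCommGroup V] [InnerProductSpace ℝ V] [FiniteDimensional ℝ V]

namespace RadialIsoparametric

variable {E : V → ℝ} {a b : ℝ → ℝ} {p η v : V} {r : ℝ}

/-- The principal curvatures of a minimal level set are symmetric about the first focal point. -/
theorem reflection_symmetry (h : RadialIsoparametric E a b) (hs : NormalStart E p η r)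
    {ι : Type*} [Fintype ι] {e : ι → V} (he : Orthonormal ℝ e) {k : ι → ℝ}
    (hcard : Fintype.card ι + 2 = Module.finrank ℝ V)
    (hep : ∀ i, ⟪p, e i⟫_ℝ = 0) (heη : ∀ i, ⟪η, e i⟫_ℝ = 0)
    (hv : ∀ i, fderiv ℝ (gradient E) p (e i) = -(r * k i) • e i)
    {κ : Fin 4 → ℝ} (hκ : StrictAnti κ) (hk : range k = range κ) (hmin : ∑ i, k i = 0) :
    κ 0 * κ 2 = -1 ∧ (1 + κ 0 * κ 1) / (κ 0 - κ 1) = -((1 + κ 0 * κ 3) / (κ 0 - κ 3)) ∧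
      Finset.card {i | k i = κ 1} = Finset.card {i | k i = κ 3} := by
  obtain ⟨T, hT0, hTz, hT⟩ := h.exists_first_zero hs
  have hmem : ∀ i, k i ∈ range κ := fun i => hk ▸ mem_range_self i
  have hex : ∀ j, ∃ i, k i = κ j := fun j => by
    have : κ j ∈ range k := hk ▸ mem_range_self j
    exact this
  have hβ : ContDiff ℝ (⊤ : ℕ∞) fun x => deriv b x / 2 :=
    (h.smooth_gradient.iterate_deriv 1).div_const 2
  have prof : NormalProfile (fun t => E (greatCircle p η t)) (speed E p η)
      (fun x => a x - deriv b x / 2) (fun x => deriv b x / 2) T κ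
      (fun j => (Finset.card {i | k i = κ j} : ℝ)) :=
    { pos := hT0
      smooth_left := h.smooth_laplacian.sub hβ
      smooth_right := hβ
      hasDeriv := fun t _ => h.hasDerivAt_along hs t
      hasDeriv₁ := fun t ht => h.hasDerivAt_speed_of_mem_Icc hs hT ht hT0
      deriv_pos := hT
      deriv_zero := hTz
      jacobi_pos := fun j t ht => by
        obtain ⟨i, hi⟩ := hex j
        rw [← hi]
        exact h.jacobi_pos hs hT (hep i) (heη i) (he.ne_zero i) (hv i) ht
      equation := fun t ht => by
        rw [h.laplacian_along hs hT he hcard hep heη hv ht, sum_comp_eq_sum_card_mul hκ.injective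
          hmem fun x => -(Real.sin t + x * Real.cos t) / (Real.cos t - x * Real.sin t)]
        ring
      strictAnti := hκ
      mult_pos := fun j => by
        obtain ⟨i, hi⟩ := hex j
        exact_mod_cast Finset.card_pos.2 ⟨i, by simp [hi]⟩
      minimal := by
        rw [← sum_comp_eq_sum_card_mul hκ.injective hmem fun x => x]
        exact hmin }
  obtain ⟨h1, h2, h3⟩ := prof.reflection_symmetry
  exact ⟨h1, h2, by exact_mod_cast h3⟩

theorem neg (h : RadialIsoparametric E a b) :
    RadialIsoparametric (-E) (fun x => -a (-x)) (fun x => b (-x)) where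
  smooth := h.smooth.neg
  radial y r hr := by simp [h.radial y r hr]
  norm_gradient y hy := by
    have hy0 : y ≠ 0 := by rintro rfl; simp at hy
    have : gradient (-E) y = -gradient E y := by
      refine HasGradientAt.gradient ?_
      rw [hasGradientAt_iff_hasFDerivAt, map_neg]
      exact (h.hasFDerivAt hy0).neg
    rw [this, norm_neg, h.norm_gradient y hy]; simp
  laplacian y hy := by
    rw [InnerProductSpace.laplacian_neg]
    simp [h.laplacian y hy]
  smooth_laplacian := (h.smooth_laplacian.comp contDiff_neg).neg
  smooth_gradient := h.smooth_gradient.comp contDiff_neg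

theorem gradient_neg (h : RadialIsoparametric E a b) (hy : v ≠ 0) :
    gradient (-E) v = -gradient E v := by
  refine HasGradientAt.gradient ?_
  rw [hasGradientAt_iff_hasFDerivAt, map_neg]
  exact (h.hasFDerivAt hy).neg

theorem hessian_neg (h : RadialIsoparametric E a b) (hy : v ≠ 0) :
    fderiv ℝ (gradient (-E)) v = -fderiv ℝ (gradient E) v := by
  refine HasFDerivAt.fderiv ?_
  refine (h.hasFDerivAt_gradient hy).neg.congr_of_eventuallyEq ?_
  filter_upwards [isOpen_compl_singleton.mem_nhds hy] with z hz using h.gradient_neg hz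

/-- Münzner's structure of four principal curvatures for a minimal level set. -/
theorem four_principal_curvatures (h : RadialIsoparametric E a b) (hs : NormalStart E p η r)
    {ι : Type*} [Fintype ι] {e : ι → V} (he : Orthonormal ℝ e) {k : ι → ℝ}
    (hcard : Fintype.card ι + 2 = Module.finrank ℝ V)
    (hep : ∀ i, ⟪p, e i⟫_ℝ = 0) (heη : ∀ i, ⟪η, e i⟫_ℝ = 0)
    (hv : ∀ i, fderiv ℝ (gradient E) p (e i) = -(r * k i) • e i)
    {κ : Fin 4 → ℝ} (hκ : StrictAnti κ) (hk : range k = range κ) (hmin : ∑ i, k i = 0) :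
    κ 0 * κ 2 = -1 ∧ κ 1 * κ 3 = -1 ∧
      (1 + κ 0 * κ 1) / (κ 0 - κ 1) = -((1 + κ 0 * κ 3) / (κ 0 - κ 3)) ∧
      Finset.card {i | k i = κ 2} = Finset.card {i | k i = κ 0} ∧
      Finset.card {i | k i = κ 3} = Finset.card {i | k i = κ 1} := by
  have hp0 : p ≠ 0 := by rw [← norm_ne_zero_iff, hs.norm_point]; exact one_ne_zero
  obtain ⟨h1, h2, h3⟩ := h.reflection_symmetry hs he hcard hep heη hv hκ hk hmin
  have hs' : NormalStart (-E) p (-η) r :=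
    { norm_point := hs.norm_point
      norm_normal := by rw [norm_neg, hs.norm_normal]
      inner_eq := by rw [inner_neg_right, hs.inner_eq, neg_zero]
      gradient_eq := by rw [h.gradient_neg hp0, hs.gradient_eq, smul_neg]
      pos := hs.pos }
  -- Passing to `-E` reverses the normal, negating the curvatures and reversing their order; the
  -- focal point is now that of `κ 3`.
  obtain ⟨g1, -, g3⟩ := h.neg.reflection_symmetry hs' he (k := fun i => -k i)
    (κ := fun j => -κ (Fin.rev j)) hcard hep
    (fun i => by rw [inner_neg_left, heη i, neg_zero])
    (fun i => by rw [h.hessian_neg hp0, _root_.neg_apply, hv i]; module)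
    (fun i j hij => neg_lt_neg (hκ (Fin.rev_lt_rev.2 hij)))
    (by
      have e1 : range (fun i => -k i) = Neg.neg '' range k := (range_comp _ _)
      have e2 : range (fun j => -κ (Fin.rev j)) = Neg.neg '' range κ := by
        rw [← range_comp, ← (Fin.rev_surjective).range_comp (Neg.neg ∘ κ)]; rfl
      rw [e1, e2, hk])
    (by simp [hmin])
  have r0 : Fin.rev (0 : Fin 4) = 3 := rfl
  have r1 : Fin.rev (1 : Fin 4) = 2 := rfl
  have r2 : Fin.rev (2 : Fin 4) = 1 := rfl
  have r3 : Fin.rev (3 : Fin 4) = 0 := rfl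
  simp only [r0, r1, r2, r3, neg_inj] at g1 g3
  exact ⟨h1, by linarith, h2, g3, h3.symm⟩

end RadialIsoparametric
end

/-! ### The shape operator of a level set and its spectrum -/

namespace SphereHypersurface

open scoped Manifold ContDiff EuclideanSpace

variable {n : ℕ}

theorem radialExt_of_ne_zero (f : UnitSphere n → ℝ) {x : Ambient n} (hx : x ≠ 0)
    (h : ‖x‖⁻¹ • x ∈ Metric.sphere (0 : Ambient n) 1) :
    radialExt f x = f ⟨‖x‖⁻¹ • x, h⟩ := by
  simp [radialExt, hx]

theorem radialExt_coe (f : UnitSphere n → ℝ) (p : UnitSphere n) : radialExt f p = f p := by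
  have hp : ‖(p : Ambient n)‖ = 1 := norm_eq_of_mem_sphere p
  have hp0 : (p : Ambient n) ≠ 0 := by rw [← norm_ne_zero_iff, hp]; exact one_ne_zero
  rw [radialExt_of_ne_zero f hp0 (by simp [hp])]
  congr 1
  ext1
  simp [hp]

theorem radialExt_smul (f : UnitSphere n → ℝ) (y : Ambient n) {r : ℝ} (hr : 0 < r) :
    radialExt f (r • y) = radialExt f y := by
  by_cases hy : y = 0
  · simp [hy]
  · have e : ‖r • y‖⁻¹ • r • y = ‖y‖⁻¹ • y := by
      rw [norm_smul, Real.norm_eq_abs, abs_of_pos hr, smul_smul]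
      congr 1
      have := norm_ne_zero_iff.2 hy
      field_simp
    rw [radialExt_of_ne_zero f (smul_ne_zero hr.ne' hy)
      (by rw [e]; simp [norm_smul, hy]),
      radialExt_of_ne_zero f hy (by simp [norm_smul, hy])]
    congr 1
    ext1
    exact e

theorem contDiffOn_radialExt {f : UnitSphere n → ℝ} (hf : ContMDiff (𝓡 (n + 2)) 𝓘(ℝ, ℝ) ∞ f) :
    ContDiffOn ℝ ∞ (radialExt f) {0}ᶜ := by
  have : Fact (Module.finrank ℝ (Ambient n) = n + 2 + 1) := ⟨finrank_euclideanSpace_fin⟩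
  let U : TopologicalSpace.Opens (Ambient n) := ⟨{0}ᶜ, isOpen_compl_singleton⟩
  have hU : ∀ x : U, (x : Ambient n) ≠ 0 := fun x => x.2
  have hg : ContMDiff 𝓘(ℝ, Ambient n) 𝓘(ℝ, Ambient n) ∞
      (fun x : U => ‖(x : Ambient n)‖⁻¹ • (x : Ambient n)) := by
    intro x
    rw [contMDiffAt_subtype_iff (f := fun x : Ambient n => ‖x‖⁻¹ • x)]
    exact (((contDiffAt_norm ℝ (hU x)).inv (norm_ne_zero_iff.2 (hU x))).smul
      contDiffAt_id).contMDiffAt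
  have hmem : ∀ x : U, ‖(x : Ambient n)‖⁻¹ • (x : Ambient n) ∈ Metric.sphere (0 : Ambient n) 1 :=
    fun x => by simp [norm_smul, hU x]
  have h1 := ContMDiff.codRestrict_sphere (n := n + 2) hg hmem
  have h2 := hf.comp h1
  intro x hx
  have h3 := h2 ⟨x, hx⟩
  have e : (f ∘ Set.codRestrict _ _ hmem) = fun x : U => radialExt f x := by
    funext z
    exact (radialExt_of_ne_zero f (hU z) (hmem z)).symm
  rw [e, contMDiffAt_subtype_iff] at h3
  exact h3.contDiffAt.contDiffWithinAt

theorem IsIsoparametric.exists_radialIsoparametric {f : UnitSphere n → ℝ} (hf : IsIsoparametric f) :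
    ∃ a b, RadialIsoparametric (radialExt f) a b := by
  obtain ⟨b, hb, hb'⟩ := hf.gradient_eq
  obtain ⟨a, ha, ha'⟩ := hf.laplacian_eq
  refine ⟨a, b, contDiffOn_radialExt hf.smooth, fun y r hr => radialExt_smul f y hr,
    fun y hy => ?_, fun y hy => ?_, ha, hb⟩
  · have := hb' ⟨y, by simp [hy]⟩
    rw [← radialExt_coe f] at this
    exact this
  · have := ha' ⟨y, by simp [hy]⟩
    rw [← radialExt_coe f] at this
    exact this

theorem mem_tangentSpace {f : UnitSphere n → ℝ} {y v : Ambient n} :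
    v ∈ tangentSpace f y ↔ ⟪y, v⟫_ℝ = 0 ∧ ⟪grad f y, v⟫_ℝ = 0 := by
  simp only [tangentSpace, Submodule.mem_orthogonal]
  constructor
  · exact fun h => ⟨h _ (Submodule.subset_span (by simp)), h _ (Submodule.subset_span (by simp))⟩
  · rintro ⟨h1, h2⟩ u hu
    obtain ⟨c, d, rfl⟩ := Submodule.mem_span_pair.1 hu
    rw [inner_add_left, inner_smul_left, inner_smul_left, h1, h2]
    simp

theorem norm_coe_sphere (p : UnitSphere n) : ‖(p : Ambient n)‖ = 1 := norm_eq_of_mem_sphere p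

theorem coe_sphere_ne_zero (p : UnitSphere n) : (p : Ambient n) ≠ 0 := by
  rw [← norm_ne_zero_iff, norm_coe_sphere]; exact one_ne_zero

section
variable {f : UnitSphere n → ℝ} {a b : ℝ → ℝ} {p : UnitSphere n}

theorem normalStart
    (h : RadialIsoparametric (radialExt f) a b) (hp : grad f p ≠ 0) : RadialIsoparametric.NormalStart (radialExt f) (p : Ambient n)
    (unitNormal f p) ‖grad f p‖ where
  norm_point := norm_coe_sphere p
  norm_normal := by simp [unitNormal, norm_smul, hp]
  inner_eq := by
    rw [unitNormal, inner_smul_right, real_inner_comm, grad,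
      h.inner_gradient_self (coe_sphere_ne_zero p), mul_zero]
  gradient_eq := by
    rw [unitNormal, smul_smul, mul_inv_cancel₀ (norm_ne_zero_iff.2 hp), one_smul]; rfl
  pos := norm_pos_iff.2 hp

theorem contDiffAt_unitNormal
    (h : RadialIsoparametric (radialExt f) a b) (hp : grad f p ≠ 0) : ContDiffAt ℝ ∞ (unitNormal f) (p : Ambient n) := by
  have hg : ContDiffAt ℝ ∞ (grad f) (p : Ambient n) := h.contDiffAt_gradient (coe_sphere_ne_zero p)
  exact ((hg.norm ℝ hp).inv (norm_ne_zero_iff.2 hp)).smul hg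

/-- The derivative of the normalizing factor only contributes along the gradient, which is invisible
to `w`. -/
theorem inner_fderiv_unitNormal
    (h : RadialIsoparametric (radialExt f) a b) (hp : grad f p ≠ 0) (u w : Ambient n) (hw : ⟪grad f p, w⟫_ℝ = 0) :
    ⟪fderiv ℝ (unitNormal f) p u, w⟫_ℝ =
      ‖grad f p‖⁻¹ * ⟪fderiv ℝ (grad f) p u, w⟫_ℝ := by
  have hg : ContDiffAt ℝ ∞ (grad f) (p : Ambient n) := h.contDiffAt_gradient (coe_sphere_ne_zero p)
  have h1 : DifferentiableAt ℝ (fun y => ‖grad f y‖⁻¹) (p : Ambient n) :=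
    ((hg.norm ℝ hp).inv (norm_ne_zero_iff.2 hp)).differentiableAt (by simp)
  have h2 := h1.hasFDerivAt.smul (hg.differentiableAt (by simp)).hasFDerivAt
  have h3 : fderiv ℝ (unitNormal f) p = _ := HasFDerivAt.fderiv h2
  rw [h3]
  simp [inner_add_left, inner_smul_left, hw]

/-- The symmetric Hessian preserves the span of position and gradient, hence also its orthogonal
complement. -/
theorem hessian_mem_tangentSpace
    (h : RadialIsoparametric (radialExt f) a b) {u : Ambient n} (hu : u ∈ tangentSpace f p) :
    fderiv ℝ (grad f) p u ∈ tangentSpace f p := by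
  obtain ⟨hu1, hu2⟩ := mem_tangentSpace.1 hu
  have hp0 := coe_sphere_ne_zero p
  rw [mem_tangentSpace]
  unfold grad at hu2 ⊢
  constructor
  · rw [← h.hessian_symm hp0, h.hessian_self hp0, inner_neg_left, hu2, neg_zero]
  · have h1 := congrArg (fun z => ⟪z, u⟫_ℝ) (h.hessian_gradient hp0)
    simp only [norm_coe_sphere, inner_sub_left, inner_smul_left, hu1, hu2] at h1
    rw [← h.hessian_symm hp0]
    simpa using h1

theorem inner_shapeOperator (u w : tangentSpace f p) :
    ⟪(shapeOperator f p u : Ambient n), (w : Ambient n)⟫_ℝ =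
      -⟪fderiv ℝ (unitNormal f) p u, (w : Ambient n)⟫_ℝ := by
  have h1 : (shapeOperator f p u : Ambient n) =
    -(tangentSpace f p).starProjection (fderiv ℝ (unitNormal f) p u) := rfl
  rw [h1, inner_neg_left, Submodule.inner_starProjection_left_eq_right,
    Submodule.starProjection_eq_self_iff.2 w.2]

theorem shapeOperator_eq
    (h : RadialIsoparametric (radialExt f) a b) (hp : grad f p ≠ 0) (u : tangentSpace f p) :
    fderiv ℝ (grad f) p u = -(‖grad f p‖ • (shapeOperator f p u : Ambient n)) := by
  have hr := norm_ne_zero_iff.2 hp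
  have h1 : (⟨_, hessian_mem_tangentSpace h u.2⟩ : tangentSpace f p) =
      -(‖grad f p‖ • shapeOperator f p u) := by
    refine ext_inner_right ℝ fun w => ?_
    change ⟪fderiv ℝ (grad f) p u, (w : Ambient n)⟫_ℝ =
      ⟪-(‖grad f p‖ • (shapeOperator f p u : Ambient n)), (w : Ambient n)⟫_ℝ
    rw [inner_neg_left, inner_smul_left, inner_shapeOperator,
      inner_fderiv_unitNormal h hp _ _ (mem_tangentSpace.1 w.2).2]
    simp only [conj_trivial]
    field_simp
  exact congrArg Subtype.val h1

theorem isSymmetric_shapeOperator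
    (h : RadialIsoparametric (radialExt f) a b) (hp : grad f p ≠ 0) : (shapeOperator f p).IsSymmetric := by
  intro u w
  change ⟪(shapeOperator f p u : Ambient n), (w : Ambient n)⟫_ℝ =
    ⟪(u : Ambient n), (shapeOperator f p w : Ambient n)⟫_ℝ
  rw [real_inner_comm (shapeOperator f p w : Ambient n), inner_shapeOperator, inner_shapeOperator,
    inner_fderiv_unitNormal h hp _ _ (mem_tangentSpace.1 w.2).2,
    inner_fderiv_unitNormal h hp _ _ (mem_tangentSpace.1 u.2).2]
  have h1 := h.hessian_symm (coe_sphere_ne_zero p) (u : Ambient n) w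
  rw [real_inner_comm _ (u : Ambient n)] at h1
  unfold grad
  rw [h1]

theorem finrank_tangentSpace
    (h : RadialIsoparametric (radialExt f) a b) (hp : grad f p ≠ 0) : Module.finrank ℝ (tangentSpace f p) = n + 1 := by
  have hs := normalStart h hp
  have hli : LinearIndependent ℝ ![(p : Ambient n), grad f p] := by
    rw [LinearIndependent.pair_iff]
    intro s t hst
    have h0 : ⟪grad f p, (p : Ambient n)⟫_ℝ = 0 := h.inner_gradient_self (coe_sphere_ne_zero p)
    have h1 := congrArg (fun z => ⟪z, (p : Ambient n)⟫_ℝ) hst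
    have h2 := congrArg (fun z => ⟪z, grad f p⟫_ℝ) hst
    simp only [inner_add_left, inner_smul_left, h0, real_inner_comm (grad f p) (p : Ambient n)] at h1 h2
    rw [real_inner_comm] at h0
    simp [hp] at h1 h2
    exact ⟨h1, h2⟩
  have h1 := finrank_span_eq_card hli
  have h2 := (Submodule.span ℝ {(p : Ambient n), grad f p}).finrank_add_finrank_orthogonal
  have e : range ![(p : Ambient n), grad f p] = {(p : Ambient n), grad f p} := by
    simp [Matrix.range_cons, Set.pair_comm]
  rw [e] at h1
  rw [h1, finrank_euclideanSpace_fin] at h2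
  simp at h2
  show Module.finrank ℝ (Submodule.span ℝ {(p : Ambient n), grad f p})ᗮ = n + 1
  omega

end

/-- Münzner's structure theorem at a point of a minimal level set. -/
theorem principal_structure {f : UnitSphere n → ℝ} {c : ℝ} {m₁ m₂ : ℕ}
    (hf : IsIsoparametric f) (hc : IsAttainedRegularValue f c) (hmin : IsMinimalLevel f c)
    (hg : HasFourPrincipalCurvatures f c m₁ m₂) {p : UnitSphere n} (hp : f p = c) :
    ∃ κ : Fin 4 → ℝ, StrictAnti κ ∧ principalCurvatures f p = range κ ∧
      multiplicity f p (κ 0) = m₁ ∧ multiplicity f p (κ 1) = m₂ ∧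
      multiplicity f p (κ 2) = m₁ ∧ multiplicity f p (κ 3) = m₂ ∧
      κ 0 * κ 2 = -1 ∧ κ 1 * κ 3 = -1 ∧
      (1 + κ 0 * κ 1) / (κ 0 - κ 1) = -((1 + κ 0 * κ 3) / (κ 0 - κ 3)) ∧
      m₁ * (κ 0 + κ 2) + m₂ * (κ 1 + κ 3) = 0 ∧ n + 1 = 2 * (m₁ + m₂) ∧ 0 < m₁ ∧ 0 < m₂ := by
  obtain ⟨a, b, h⟩ := hf.exists_radialIsoparametric
  have hgp := hc.2 p hp
  obtain ⟨κ, hκ, hrange, hm₁, hm₂⟩ := hg p hp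
  have hs := normalStart h hgp
  have hsym := isSymmetric_shapeOperator h hgp
  have hfr := finrank_tangentSpace h hgp
  set B := hsym.eigenvectorBasis hfr with hB
  set k := hsym.eigenvalues hfr with hk
  have hkr : range k = range κ := by
    rw [← hrange]
    ext μ
    constructor
    · rintro ⟨i, rfl⟩
      exact hsym.hasEigenvalue_eigenvalues hfr i
    · exact fun hμ => hsym.exists_eigenvalues_eq hfr hμ
  have hcard : ∀ μ, Finset.card {i | k i = μ} = multiplicity f p μ := fun μ =>
    hsym.card_filter_eigenvalues_eq hfr μ
  have htr : ∑ i, k i = 0 := by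
    have := hsym.trace_eq_sum_eigenvalues hfr
    rw [hmin p hp] at this
    exact this.symm
  have hmem : ∀ i, k i ∈ range κ := fun i => hkr ▸ mem_range_self i
  have hortho : Orthonormal ℝ fun i => (B i : Ambient n) :=
    B.orthonormal.comp_linearIsometry (tangentSpace f p).subtypeₗᵢ
  obtain ⟨r1, r2, r3, r4, r5⟩ := h.four_principal_curvatures hs hortho (k := k)
    (by simp)
    (fun i => (mem_tangentSpace.1 (B i).2).1)
    (fun i => by
      rw [unitNormal, inner_smul_left, (mem_tangentSpace.1 (B i).2).2, mul_zero])
    (fun i => by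
      have h1 := shapeOperator_eq h hgp (B i)
      rw [hB, hsym.apply_eigenvectorBasis hfr i] at h1
      have e : grad f = gradient (radialExt f) := rfl
      rw [← e, h1]
      simp only [Submodule.coe_smul, neg_smul, mul_smul]
      rfl)
    hκ hkr htr
  rw [hcard, hcard, hm₁] at r4
  rw [hcard, hcard, hm₂] at r5
  -- Weighting the eigenvalues by the identity gives the trace relation, and by 1 the dimension
  -- count.
  have hsum := sum_comp_eq_sum_card_mul hκ.injective hmem fun x => x
  have hone := sum_comp_eq_sum_card_mul hκ.injective hmem fun _ => 1
  simp only [htr, Fin.sum_univ_four, hcard, hm₁, hm₂, r4, r5] at hsum hone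
  have hpos : ∀ j, 0 < multiplicity f p (κ j) := fun j => by
    rw [← hcard]
    obtain ⟨i, hi⟩ : κ j ∈ range k := hkr ▸ mem_range_self j
    exact Finset.card_pos.2 ⟨i, by simp [hi]⟩
  refine ⟨κ, hκ, hrange, hm₁, hm₂, r4, r5, r1, r2, r3, by linarith, ?_, hm₁ ▸ hpos 0, hm₂ ▸ hpos 1⟩
  have : ((n + 1 : ℕ) : ℝ) = ((2 * (m₁ + m₂) : ℕ) : ℝ) := by
    simp at hone
    push_cast
    linarith
  exact_mod_cast this

end SphereHypersurface

/-! ### Tangential projection, second fundamental form and Gauss equation -/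

namespace SphereHypersurface

open scoped Manifold ContDiff EuclideanSpace

variable {n : ℕ}

/-- The orthogonal projection to the tangent spaces of the level sets. -/
noncomputable def tangentProj (f : UnitSphere n → ℝ) (y : Ambient n) : Ambient n →L[ℝ] Ambient n :=
  (tangentSpace f y).starProjection

/-- The scalar second fundamental form of the level set in the sphere. -/
noncomputable def scalarFF (f : UnitSphere n → ℝ) (p : UnitSphere n) (u v : Ambient n) : ℝ :=
  -⟪fderiv ℝ (unitNormal f) p u, v⟫_ℝ

theorem tangentProj_symm (f : UnitSphere n → ℝ) (y u v : Ambient n) :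
    ⟪tangentProj f y u, v⟫_ℝ = ⟪u, tangentProj f y v⟫_ℝ :=
  Submodule.inner_starProjection_left_eq_right _ u v

theorem tangentProj_of_mem {f : UnitSphere n → ℝ} {y u : Ambient n} (hu : u ∈ tangentSpace f y) :
    tangentProj f y u = u := Submodule.starProjection_eq_self_iff.2 hu

theorem tangentProj_idem (f : UnitSphere n → ℝ) (y u : Ambient n) :
    tangentProj f y (tangentProj f y u) = tangentProj f y u :=
  tangentProj_of_mem (Submodule.starProjection_apply_mem _ u)

section
variable {f : UnitSphere n → ℝ} {a b : ℝ → ℝ} {p : UnitSphere n}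

/-- An explicit formula, valid because `y` and the gradient are orthogonal, from which smoothness of
the projection in `y` can be read off. -/
theorem tangentProj_eq
    (h : RadialIsoparametric (radialExt f) a b) {y : Ambient n} (hy : y ≠ 0) (hg : grad f y ≠ 0) :
    tangentProj f y = ContinuousLinearMap.id ℝ (Ambient n) -
      (‖y‖ ^ 2)⁻¹ • (innerSL ℝ y).smulRight y -
      (innerSL ℝ (unitNormal f y)).smulRight (unitNormal f y) := by
  have hy' := norm_ne_zero_iff.2 hy
  have hg' := norm_ne_zero_iff.2 hg
  have h0 : ⟪grad f y, y⟫_ℝ = 0 := h.inner_gradient_self hy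
  have h0' : ⟪y, grad f y⟫_ℝ = 0 := (real_inner_comm _ _).trans h0
  ext1 v
  refine (Submodule.eq_starProjection_of_mem_orthogonal' (z := (‖y‖ ^ 2)⁻¹ • ⟪y, v⟫_ℝ • y +
    ⟪unitNormal f y, v⟫_ℝ • unitNormal f y) ?_ ?_ ?_)
  · rw [mem_tangentSpace]
    simp only [_root_.sub_apply, _root_.smul_apply,
      ContinuousLinearMap.smulRight_apply, ContinuousLinearMap.id_apply, innerSL_apply_apply,
      inner_sub_right, inner_smul_right, unitNormal, inner_smul_left, h0, h0',
      real_inner_self_eq_norm_sq, conj_trivial]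
    constructor <;> field_simp <;> ring
  · refine Submodule.le_orthogonal_orthogonal _ (Submodule.add_mem _ ?_ ?_)
    · exact Submodule.smul_mem _ _ (Submodule.smul_mem _ _ (Submodule.subset_span (by simp)))
    · exact Submodule.smul_mem _ _ (Submodule.smul_mem _ _ (Submodule.subset_span (by simp)))
  · simp only [_root_.sub_apply, _root_.smul_apply,
      ContinuousLinearMap.smulRight_apply, ContinuousLinearMap.id_apply, innerSL_apply_apply]
    abel

theorem eventually_tangentProj_eq
    (h : RadialIsoparametric (radialExt f) a b) (hp : grad f p ≠ 0) : tangentProj f =ᶠ[𝓝 (p : Ambient n)] fun y =>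
    ContinuousLinearMap.id ℝ (Ambient n) - (‖y‖ ^ 2)⁻¹ • (innerSL ℝ y).smulRight y -
      (innerSL ℝ (unitNormal f y)).smulRight (unitNormal f y) := by
  have hg : ContinuousAt (grad f) (p : Ambient n) :=
    (h.contDiffAt_gradient (coe_sphere_ne_zero p)).continuousAt
  filter_upwards [isOpen_compl_singleton.mem_nhds (coe_sphere_ne_zero p), hg.eventually_ne hp]
    with y hy hgy using tangentProj_eq h hy hgy

theorem contDiffAt_tangentProj
    (h : RadialIsoparametric (radialExt f) a b) (hp : grad f p ≠ 0) : ContDiffAt ℝ ∞ (tangentProj f) (p : Ambient n) := by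
  refine ContDiffAt.congr_of_eventuallyEq ?_ (eventually_tangentProj_eq h hp)
  have hu := contDiffAt_unitNormal h hp
  have hn : ContDiffAt ℝ ∞ (fun y : Ambient n => (‖y‖ ^ 2)⁻¹) (p : Ambient n) :=
    (contDiffAt_id.norm_sq ℝ).inv (by simp)
  have hi : ContDiff ℝ ∞ (fun y : Ambient n => innerSL ℝ y) := (innerSL ℝ).contDiff
  exact (contDiffAt_const.sub (hn.smul (hi.contDiffAt.smulRight contDiffAt_id))).sub
    ((hi.contDiffAt.comp _ hu).smulRight hu)

theorem hasFDerivAt_tangentProj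
    (h : RadialIsoparametric (radialExt f) a b) (hp : grad f p ≠ 0) :
    HasFDerivAt (tangentProj f) (fderiv ℝ (tangentProj f) p) (p : Ambient n) :=
  ((contDiffAt_tangentProj h hp).differentiableAt (by simp)).hasFDerivAt

theorem fderiv_tangentProj_symm
    (h : RadialIsoparametric (radialExt f) a b) (hp : grad f p ≠ 0) (u v w : Ambient n) :
    ⟪fderiv ℝ (tangentProj f) p u v, w⟫_ℝ = ⟪v, fderiv ℝ (tangentProj f) p u w⟫_ℝ := by
  have hP := hasFDerivAt_tangentProj h hp
  have h1 := (hP.clm_apply (hasFDerivAt_const v _)).inner ℝ (hasFDerivAt_const w _)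
  have h2 := (hasFDerivAt_const v _).inner ℝ (hP.clm_apply (hasFDerivAt_const w _))
  have e : (fun y => ⟪tangentProj f y v, w⟫_ℝ) = fun y => ⟪v, tangentProj f y w⟫_ℝ :=
    funext fun y => tangentProj_symm f y v w
  rw [e] at h1
  have := congrArg (fun L => L u) (h1.unique h2)
  simpa [fderivInnerCLM_apply] using this

/-- The Weingarten formula. -/
theorem fderiv_tangentProj_apply
    (h : RadialIsoparametric (radialExt f) a b) (hp : grad f p ≠ 0) {u v : Ambient n} (hv : v ∈ tangentSpace f p) :
    fderiv ℝ (tangentProj f) p u v = -⟪u, v⟫_ℝ • (p : Ambient n) +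
      scalarFF f p u v • unitNormal f p := by
  obtain ⟨hv1, hv2⟩ := mem_tangentSpace.1 hv
  have hP := (hasFDerivAt_tangentProj h hp).clm_apply (hasFDerivAt_const v _)
  have hU := ((contDiffAt_unitNormal h hp).differentiableAt (by simp)).hasFDerivAt
  have hI : HasFDerivAt (fun y : Ambient n => ⟪y, v⟫_ℝ) _ (p : Ambient n) :=
    (hasFDerivAt_id (p : Ambient n)).inner ℝ (hasFDerivAt_const v _)
  have hN : HasFDerivAt (fun y : Ambient n => (‖y‖ ^ 2)⁻¹) _ (p : Ambient n) :=
    (((contDiffAt_id (n := 1)).norm_sq ℝ).inv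
      (by simp) |>.differentiableAt (by simp)).hasFDerivAt
  have h1 := ((hasFDerivAt_const v (p : Ambient n)).sub
    (hN.smul (hI.smul (hasFDerivAt_id (p : Ambient n))))).sub
    ((hU.inner ℝ (hasFDerivAt_const v _)).smul hU)
  have h2 := hP.unique (h1.congr_of_eventuallyEq (by
    filter_upwards [eventually_tangentProj_eq h hp] with y hy
    rw [hy]
    simp))
  have h3 := congrArg (fun L => L u) h2
  have hv3 : ⟪unitNormal f p, v⟫_ℝ = 0 := by rw [unitNormal, inner_smul_left, hv2, mul_zero]
  simp [fderivInnerCLM_apply, hv1, hv3] at h3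
  rw [h3, scalarFF]
  module

theorem fderiv_tangentField
    (h : RadialIsoparametric (radialExt f) a b) (hp : grad f p ≠ 0) (u v : Ambient n) :
    fderiv ℝ (tangentField f v) p u = fderiv ℝ (tangentProj f) p u v := by
  have h1 : HasFDerivAt (tangentField f v) _ (p : Ambient n) :=
    (hasFDerivAt_tangentProj h hp).clm_apply (hasFDerivAt_const v _)
  rw [h1.fderiv]
  simp

theorem secondFF_eq
    (h : RadialIsoparametric (radialExt f) a b) (hp : grad f p ≠ 0) {u v : Ambient n} (hv : v ∈ tangentSpace f p) :
    secondFF f p u v = -⟪u, v⟫_ℝ • (p : Ambient n) + scalarFF f p u v • unitNormal f p := by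
  rw [secondFF, fderiv_tangentField h hp, fderiv_tangentProj_apply h hp hv]
  refine Submodule.starProjection_eq_self_iff.2 (Submodule.le_orthogonal_orthogonal _
    (Submodule.add_mem _ ?_ ?_))
  · exact Submodule.smul_mem _ _ (Submodule.subset_span (by simp))
  · exact Submodule.smul_mem _ _ (Submodule.smul_mem _ _ (Submodule.subset_span (by simp)))

theorem inner_normal_combination
    (h : RadialIsoparametric (radialExt f) a b) (hp : grad f p ≠ 0) (s t s' t' : ℝ) :
    ⟪s • (p : Ambient n) + t • unitNormal f p, s' • (p : Ambient n) + t' • unitNormal f p⟫_ℝ =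
      s * s' + t * t' := by
  have hs := normalStart h hp
  simp only [inner_add_left, inner_add_right, inner_smul_left, inner_smul_right,
    real_inner_self_eq_norm_sq, hs.norm_point, hs.norm_normal, hs.inner_eq,
    real_inner_comm (p : Ambient n) (unitNormal f p), conj_trivial]
  ring

theorem norm_secondFF_sq
    (h : RadialIsoparametric (radialExt f) a b) (hp : grad f p ≠ 0) {u v : Ambient n} (hv : v ∈ tangentSpace f p) :
    ‖secondFF f p u v‖ ^ 2 = ⟪u, v⟫_ℝ ^ 2 + scalarFF f p u v ^ 2 := by
  rw [← real_inner_self_eq_norm_sq, secondFF_eq h hp hv, inner_normal_combination h hp]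
  ring

theorem covDeriv_tangentField_eventuallyEq
    (h : RadialIsoparametric (radialExt f) a b) (hp : grad f p ≠ 0) (v z : Ambient n) :
    covDeriv f (tangentField f v) (tangentField f z) =ᶠ[𝓝 (p : Ambient n)] fun y =>
      tangentProj f y (fderiv ℝ (tangentProj f) y (tangentProj f y v) z) := by
  have h1 : ∀ᶠ y in 𝓝 (p : Ambient n), ContDiffAt ℝ 1 (tangentProj f) y :=
    ((contDiffAt_tangentProj h hp).of_le (m := 1) (by simp)).eventually (by simp)
  filter_upwards [h1] with y hy
  have h2 : HasFDerivAt (tangentField f z) _ y :=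
    ((hy.differentiableAt (by simp)).hasFDerivAt).clm_apply (hasFDerivAt_const z _)
  rw [covDeriv, h2.fderiv]
  simp only [tangentProj, tangentField]
  simp

/-- The product rule for `P (DP (P v) z)`; terms are kept in the form in which the
antisymmetrization will cancel them. -/
theorem covDeriv_covDeriv
    (h : RadialIsoparametric (radialExt f) a b) (hp : grad f p ≠ 0) {u : Ambient n} (v z : Ambient n) (hu : u ∈ tangentSpace f p)
    (hv : v ∈ tangentSpace f p) :
    covDeriv f (tangentField f u) (covDeriv f (tangentField f v) (tangentField f z)) p =
      tangentProj f p (fderiv ℝ (tangentProj f) p u (fderiv ℝ (tangentProj f) p v z) +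
        (fderiv ℝ (fderiv ℝ (tangentProj f)) p u v z +
          fderiv ℝ (tangentProj f) p (fderiv ℝ (tangentProj f) p u v) z)) := by
  have hP := hasFDerivAt_tangentProj h hp
  have hD : HasFDerivAt (fderiv ℝ (tangentProj f)) (fderiv ℝ (fderiv ℝ (tangentProj f)) p)
      (p : Ambient n) :=
    (((contDiffAt_tangentProj h hp).fderiv_right (m := ∞) (by simp)).differentiableAt
      (by simp)).hasFDerivAt
  have h1 := hP.clm_apply ((hD.clm_apply (hP.clm_apply (hasFDerivAt_const v _))).clm_apply
    (hasFDerivAt_const z _))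
  have h2 := h1.congr_of_eventuallyEq (covDeriv_tangentField_eventuallyEq h hp v z)
  rw [covDeriv, h2.fderiv]
  have hu' : tangentField f u p = u := tangentProj_of_mem hu
  rw [hu']
  change tangentProj f p _ = _
  simp only [tangentProj_of_mem hv]
  simp only [_root_.add_apply, ContinuousLinearMap.comp_apply,
    ContinuousLinearMap.flip_apply, map_add, tangentProj_idem]
  simp
  abel

/-- Second derivatives of the projection cancel by symmetry, and the terms from differentiating the
extended fields match the Lie bracket. Only the commutator of first derivatives remains. -/
theorem curvatureOp_eq
    (h : RadialIsoparametric (radialExt f) a b) (hp : grad f p ≠ 0) {u v : Ambient n} (z : Ambient n) (hu : u ∈ tangentSpace f p)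
    (hv : v ∈ tangentSpace f p) :
    curvatureOp f (tangentField f u) (tangentField f v) (tangentField f z) p =
      tangentProj f p (fderiv ℝ (tangentProj f) p u (fderiv ℝ (tangentProj f) p v z) -
        fderiv ℝ (tangentProj f) p v (fderiv ℝ (tangentProj f) p u z)) := by
  have hs : IsSymmSndFDerivAt ℝ (tangentProj f) (p : Ambient n) :=
    (contDiffAt_tangentProj h hp).isSymmSndFDerivAt
      (by rw [minSmoothness_of_isRCLikeNormedField]; exact WithTop.coe_le_coe.2 (le_top : (2 : ℕ∞) ≤ ⊤))
  have hbr : VectorField.lieBracket ℝ (tangentField f u) (tangentField f v) p =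
      fderiv ℝ (tangentProj f) p u v - fderiv ℝ (tangentProj f) p v u := by
    rw [VectorField.lieBracket, fderiv_tangentField h hp, fderiv_tangentField h hp]
    have hu' : tangentField f u p = u := tangentProj_of_mem hu
    have hv' : tangentField f v p = v := tangentProj_of_mem hv
    rw [hu', hv']
  have h3 : covDeriv f (VectorField.lieBracket ℝ (tangentField f u) (tangentField f v))
      (tangentField f z) p = tangentProj f p (fderiv ℝ (tangentProj f) p
        (fderiv ℝ (tangentProj f) p u v - fderiv ℝ (tangentProj f) p v u) z) := by
    rw [covDeriv, hbr, fderiv_tangentField h hp]; rfl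
  rw [curvatureOp, covDeriv_covDeriv h hp v z hu hv, covDeriv_covDeriv h hp u z hv hu, h3, hs u v,
    ← map_sub, ← map_sub]
  congr 1
  rw [map_sub, _root_.sub_apply]
  abel

/-- The Gauss equation. -/
theorem riemann_eq
    (h : RadialIsoparametric (radialExt f) a b) (hp : grad f p ≠ 0) {u v w z : Ambient n} (hu : u ∈ tangentSpace f p)
    (hv : v ∈ tangentSpace f p) (hw : w ∈ tangentSpace f p) (hz : z ∈ tangentSpace f p) :
    riemann f p u v w z =
      (⟪v, z⟫_ℝ * ⟪u, w⟫_ℝ + scalarFF f p v z * scalarFF f p u w) -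
      (⟪u, z⟫_ℝ * ⟪v, w⟫_ℝ + scalarFF f p u z * scalarFF f p v w) := by
  -- The derivative of the projection is symmetric, so one factor moves onto `w`; both sides are
  -- then normal vectors given by the Weingarten formula.
  rw [riemann, curvatureOp_eq h hp z hu hv, tangentProj_symm, tangentProj_of_mem hw,
    inner_sub_left, fderiv_tangentProj_symm h hp u _ w, fderiv_tangentProj_symm h hp v _ w,
    fderiv_tangentProj_apply h hp hz, fderiv_tangentProj_apply h hp hw,
    fderiv_tangentProj_apply h hp hz, fderiv_tangentProj_apply h hp hw,
    inner_normal_combination h hp, inner_normal_combination h hp]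
  ring

end

end SphereHypersurface

/-! ### The quantity Δ through the shape operator -/

/-- A unit vector of a subspace together with an orthonormal basis of its complement there is an
orthonormal basis of the subspace. -/
theorem exists_orthonormalBasis_option {V ι : Type*} [NormedAddCommGroup V] [InnerProductSpace ℝ V]
    [FiniteDimensional ℝ V] [Fintype ι] {T : Submodule ℝ V} {ν : V} (hν : ν ∈ T) (hν1 : ‖ν‖ = 1)
    (e : OrthonormalBasis ι ℝ (T ⊓ (Submodule.span ℝ {ν})ᗮ : Submodule ℝ V)) :
    ∃ w : OrthonormalBasis (Option ι) ℝ T, (w none : V) = ν ∧ ∀ k, (w (some k) : V) = e k := by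
  have hmem : ∀ k, (e k : V) ∈ T := fun k => (e k).2.1
  have horth : ∀ k, ⟪ν, (e k : V)⟫_ℝ = 0 := fun k =>
    (e k).2.2 ν (Submodule.mem_span_singleton_self ν)
  set w : Option ι → T := fun o => o.elim ⟨ν, hν⟩ fun k => ⟨e k, hmem k⟩ with hw
  have how : Orthonormal ℝ w := by
    constructor
    · rintro (_ | k)
      · exact hν1
      · exact e.orthonormal.1 k
    · rintro (_ | k) (_ | l) hkl
      · exact absurd rfl hkl
      · exact horth l
      · exact (real_inner_comm _ _).trans (horth k)
      · exact e.orthonormal.2 fun hh => hkl (by rw [hh])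
  have hbot : (Submodule.span ℝ (range w))ᗮ = ⊥ := by
    rw [Submodule.eq_bot_iff]
    intro x hx
    have hx' : ∀ o, ⟪w o, x⟫_ℝ = 0 := fun o =>
      hx _ (Submodule.subset_span (mem_range_self o))
    have hxK : (x : V) ∈ T ⊓ (Submodule.span ℝ {ν})ᗮ :=
      ⟨x.2, Submodule.mem_orthogonal_singleton_iff_inner_right.2 (hx' none)⟩
    have h0 : (⟨x, hxK⟩ : (T ⊓ (Submodule.span ℝ {ν})ᗮ : Submodule ℝ V)) = 0 := by
      rw [← e.sum_repr' ⟨x, hxK⟩]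
      refine Finset.sum_eq_zero fun k _ => ?_
      have hk : ⟪e k, (⟨x, hxK⟩ : (T ⊓ (Submodule.span ℝ {ν})ᗮ : Submodule ℝ V))⟫_ℝ = 0 :=
        hx' (some k)
      rw [hk, zero_smul]
    exact Subtype.ext (congrArg (fun z : (T ⊓ (Submodule.span ℝ {ν})ᗮ : Submodule ℝ V) => (z : V)) h0)
  refine ⟨OrthonormalBasis.mkOfOrthogonalEqBot how hbot, ?_, fun k => ?_⟩ <;>
    simp [hw]

namespace SphereHypersurface

variable {n : ℕ} {f : UnitSphere n → ℝ} {a b : ℝ → ℝ}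

theorem scalarFF_eq {p : UnitSphere n} (u v : tangentSpace f p) :
    scalarFF f p u v = ⟪shapeOperator f p u, v⟫_ℝ :=
  (inner_shapeOperator u v).symm

variable {p : UnitSphere n}

theorem sum_inner_shapeOperator_sq
    (h : RadialIsoparametric (radialExt f) a b) (hp : grad f p ≠ 0) {ι : Type*} [Fintype ι]
    (w : OrthonormalBasis ι ℝ (tangentSpace f p)) (x : tangentSpace f p) :
    ∑ i, ⟪shapeOperator f p (w i), x⟫_ℝ ^ 2 = ‖shapeOperator f p x‖ ^ 2 := by
  rw [← w.sum_sq_norm_inner_right (shapeOperator f p x)]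
  refine Finset.sum_congr rfl fun i _ => ?_
  rw [isSymmetric_shapeOperator h hp, Real.norm_eq_abs, sq_abs]

theorem riemann_self_eq
    (h : RadialIsoparametric (radialExt f) a b) (hp : grad f p ≠ 0) (u x : tangentSpace f p) :
    riemann f p u x u x = ‖u‖ ^ 2 * ‖x‖ ^ 2 - ⟪u, x⟫_ℝ ^ 2 +
      ⟪shapeOperator f p u, u⟫_ℝ * ⟪shapeOperator f p x, x⟫_ℝ -
      ⟪shapeOperator f p u, x⟫_ℝ ^ 2 := by
  rw [riemann_eq h hp u.2 x.2 u.2 x.2]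
  simp only [scalarFF_eq]
  rw [isSymmetric_shapeOperator h hp x u, real_inner_comm (shapeOperator f p u) x,
    real_inner_self_eq_norm_sq, real_inner_self_eq_norm_sq, real_inner_comm (u : Ambient n) x]
  simp only [Submodule.coe_norm, Submodule.coe_inner]
  ring

/-- The trace of the Gauss equation, where minimality removes the mean curvature term; the factor
`n` is the dimension `n + 1` less the direction of `x`. -/
theorem sum_riemann_self_eq
    (h : RadialIsoparametric (radialExt f) a b) (hp : grad f p ≠ 0) (htr : LinearMap.trace ℝ _ (shapeOperator f p) = 0)
    {ι : Type*} [Fintype ι] (w : OrthonormalBasis ι ℝ (tangentSpace f p)) (x : tangentSpace f p) :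
    ∑ i, riemann f p (w i) x (w i) x = n * ‖x‖ ^ 2 - ‖shapeOperator f p x‖ ^ 2 := by
  have hcard : (Fintype.card ι : ℝ) = n + 1 := by
    have := Module.finrank_eq_card_basis w.toBasis
    rw [finrank_tangentSpace h hp] at this
    rw [← this]; push_cast; ring
  have h1 : ∑ i, ⟪w i, x⟫_ℝ ^ 2 = ‖x‖ ^ 2 := by
    rw [← w.sum_sq_norm_inner_right x]; simp
  have h2 : ∑ i, ⟪shapeOperator f p (w i), w i⟫_ℝ = 0 := by
    rw [← htr, LinearMap.trace_eq_sum_inner _ w]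
    exact Finset.sum_congr rfl fun i _ => real_inner_comm _ _
  simp only [riemann_self_eq h hp, Finset.sum_add_distrib, Finset.sum_sub_distrib, ← Finset.sum_mul,
    sum_inner_shapeOperator_sq h hp, h1, h2, w.orthonormal.1]
  simp [hcard]
  ring

/-- The Ambrozio–Carlotto–Sharp quantity of a minimal level set through its shape operator. -/
theorem acsDelta_eq
    (h : RadialIsoparametric (radialExt f) a b) (hp : grad f p ≠ 0) (htr : LinearMap.trace ℝ _ (shapeOperator f p) = 0)
    (X ν : tangentSpace f p) (hX : ‖X‖ = 1) (hν : ‖ν‖ = 1) (hXν : ⟪X, ν⟫_ℝ = 0) :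
    acsDelta f p X ν = 2 * n - 2 - 2 * ‖shapeOperator f p X‖ ^ 2 - 2 * ‖shapeOperator f p ν‖ ^ 2 -
      ⟪shapeOperator f p X, X⟫_ℝ * ⟪shapeOperator f p ν, ν⟫_ℝ +
      2 * ⟪shapeOperator f p X, ν⟫_ℝ ^ 2 + ⟪shapeOperator f p ν, ν⟫_ℝ ^ 2 := by
  -- Adding `ν` to the basis of its complement turns each sum into a full trace minus the term of
  -- `ν`.
  obtain ⟨w, hw0, hw⟩ := exists_orthonormalBasis_option ν.2 hν
    (stdOrthonormalBasis ℝ (normalComplement f p ν))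
  have hw0' : w none = ν := Subtype.ext hw0
  have hw' : ∀ k, (w (some k) : Ambient n) =
      (stdOrthonormalBasis ℝ (normalComplement f p ν) k : Ambient n) := hw
  have hX' : ‖(X : Ambient n)‖ = 1 := hX
  have hνX : ⟪ν, X⟫_ℝ = 0 := (real_inner_comm _ _).trans hXν
  have hsym : ⟪shapeOperator f p ν, X⟫_ℝ = ⟪shapeOperator f p X, ν⟫_ℝ := by
    rw [isSymmetric_shapeOperator h hp ν X, real_inner_comm]
  have hsec : ∀ u x : tangentSpace f p, ‖secondFF f p u x‖ ^ 2 =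
      ⟪u, x⟫_ℝ ^ 2 + ⟪shapeOperator f p u, x⟫_ℝ ^ 2 := fun u x => by
    rw [norm_secondFF_sq h hp x.2, scalarFF_eq]; rfl
  have hsum : ∀ x : tangentSpace f p, ∑ i, ‖secondFF f p (w i) x‖ ^ 2 =
      ‖x‖ ^ 2 + ‖shapeOperator f p x‖ ^ 2 := fun x => by
    simp only [hsec, Finset.sum_add_distrib, sum_inner_shapeOperator_sq h hp]
    rw [← w.sum_sq_norm_inner_right x]; simp
  have s1 := sum_riemann_self_eq h hp htr w X
  have s2 := hsum X
  have s3 := hsum ν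
  have s4 : ricci f p ν ν = _ :=
    sum_riemann_self_eq h hp htr (stdOrthonormalBasis ℝ (tangentSpace f p)) ν
  rw [Fintype.sum_option] at s1 s2 s3
  simp only [hw'] at s1 s2 s3
  rw [hw0', riemann_self_eq h hp, hX, hν, hνX, hsym] at s1
  rw [hw0', hsec, hX, hνX, hsym] at s2
  rw [hw0', hsec, hν, real_inner_self_eq_norm_sq, hν] at s3
  rw [hν] at s4
  simp only [acsDelta]
  rw [hX', ← Finset.sum_mul, s4]
  linear_combination s1 - s2 - s3

theorem acsDelta_eq_of_mem_curvatureSpace (h : RadialIsoparametric (radialExt f) a b)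
    (hp : grad f p ≠ 0) (htr : LinearMap.trace ℝ _ (shapeOperator f p) = 0) {μ : ℝ}
    {X ν : tangentSpace f p} (hXm : X ∈ curvatureSpace f p μ) (hνm : ν ∈ curvatureSpace f p μ)
    (hX : ‖X‖ = 1) (hν : ‖ν‖ = 1) (hXν : ⟪X, ν⟫_ℝ = 0) :
    acsDelta f p X ν = 2 * n - 2 - 4 * μ ^ 2 := by
  rw [acsDelta_eq h hp htr X ν hX hν hXν, Module.End.mem_eigenspace_iff.1 hXm,
    Module.End.mem_eigenspace_iff.1 hνm]
  simp only [norm_smul, hX, hν, Real.norm_eq_abs, mul_one, sq_abs]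
  change 2 * (n:ℝ) - 2 - 2 * μ ^ 2 - 2 * μ ^ 2 - ⟪μ • (X : Ambient n), (X : Ambient n)⟫_ℝ *
    ⟪μ • (ν : Ambient n), (ν : Ambient n)⟫_ℝ + 2 * ⟪μ • (X : Ambient n), (ν : Ambient n)⟫_ℝ ^ 2 +
    ⟪μ • (ν : Ambient n), (ν : Ambient n)⟫_ℝ ^ 2 = _
  have e1 : ⟪(X : Ambient n), (ν : Ambient n)⟫_ℝ = 0 := hXν
  have e2 : ⟪(X : Ambient n), (X : Ambient n)⟫_ℝ = 1 := by
    rw [real_inner_self_eq_norm_sq]; change ‖X‖ ^ 2 = 1; rw [hX, one_pow]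
  have e3 : ⟪(ν : Ambient n), (ν : Ambient n)⟫_ℝ = 1 := by
    rw [real_inner_self_eq_norm_sq]; change ‖ν‖ ^ 2 = 1; rw [hν, one_pow]
  simp only [inner_smul_left, e1, e2, e3, conj_trivial]
  ring

end SphereHypersurface

/-! ### Algebra of the extremal principal curvatures -/

section

/-- Here `ℓ` is minus the smallest curvature. Clearing denominators gives `(μ + ℓ) ^ 2 = (μ * ℓ - 1)
^ 2`, and signs select the root `μ + ℓ = μ * ℓ - 1`. In angles: if `μ = cot A` and `ℓ = cot B`, then
`A + B = π / 4`. -/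
theorem extremal_relations {μ ℓ μ' ℓ' m M : ℝ} (hμ : μ * μ' = -1) (hℓ : ℓ' * -ℓ = -1)
    (h1 : ℓ' < μ) (h2 : μ' < ℓ') (h3 : -ℓ < μ')
    (hrel : (1 + μ * ℓ') / (μ - ℓ') = -((1 + μ * -ℓ) / (μ - -ℓ)))
    (htr : m * (μ + μ') + M * (ℓ' + -ℓ) = 0) :
    1 < μ ∧ 1 < ℓ ∧ μ * ℓ = μ + ℓ + 1 ∧ m * (μ ^ 2 - 1) * ℓ = M * (ℓ ^ 2 - 1) * μ := by
  have hμ0 : 0 < μ := by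
    by_contra! hneg
    nlinarith
  have hℓ0 : 0 < ℓ' := by
    by_contra! hneg
    nlinarith
  have hℓ1 : 0 < ℓ := by nlinarith
  have e1 : μ' = -1 / μ := by rw [eq_div_iff hμ0.ne']; linarith
  have e2 : ℓ' = 1 / ℓ := by rw [eq_div_iff hℓ1.ne']; linarith
  have hμℓ : 1 < μ * ℓ := by
    rw [e2, div_lt_iff₀ hℓ1] at h1; exact h1
  have hsq : (μ + ℓ) ^ 2 = (μ * ℓ - 1) ^ 2 := by
    have hp1 : μ - ℓ' ≠ 0 := (sub_pos.2 h1).ne'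
    have hp2 : μ - -ℓ ≠ 0 := by linarith
    rw [← neg_div, div_eq_div_iff hp1 hp2] at hrel
    have : ℓ' * ℓ = 1 := by linarith
    have h' : (ℓ + μ * (ℓ' * ℓ)) * (μ + ℓ) = (μ * ℓ - 1) * (μ * ℓ - ℓ' * ℓ) := by
      linear_combination ℓ * hrel
    rw [this] at h'
    linear_combination h'
  have hsum : μ + ℓ = μ * ℓ - 1 := by
    rcases sq_eq_sq_iff_eq_or_eq_neg.1 hsq with h | h <;> linarith
  refine ⟨?_, ?_, by linarith, ?_⟩
  · by_contra! hle; nlinarith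
  · by_contra! hle; nlinarith
  · rw [e1, e2] at htr
    field_simp at htr
    linarith

theorem extremal_quadratic {μ ℓ m M : ℝ} (hμ : 1 < μ) (hrel : μ * ℓ = μ + ℓ + 1)
    (htr : m * (μ ^ 2 - 1) * ℓ = M * (ℓ ^ 2 - 1) * μ) :
    m * (μ ^ 2 - 1) ^ 2 = 4 * M * μ ^ 2 := by
  have hℓ : ℓ = (μ + 1) / (μ - 1) := by
    rw [eq_div_iff (by linarith)]; linarith
  have h1 : μ - 1 ≠ 0 := by linarith
  subst hℓ
  field_simp at htr
  linear_combination htr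

theorem le_of_extremal {μ ℓ m M : ℝ} (hμ : 1 < μ) (hℓ : 1 < ℓ) (hℓμ : ℓ ≤ μ) (hm : 0 < m)
    (htr : m * (μ ^ 2 - 1) * ℓ = M * (ℓ ^ 2 - 1) * μ) : m ≤ M := by
  have h1 : 0 < (ℓ ^ 2 - 1) * μ := mul_pos (by nlinarith) (by linarith)
  have h2 : (ℓ ^ 2 - 1) * μ ≤ (μ ^ 2 - 1) * ℓ := by
    nlinarith [mul_nonneg (sub_nonneg.2 hℓμ) (show 0 ≤ μ * ℓ + 1 by positivity)]
  have h3 : m * ((ℓ ^ 2 - 1) * μ) ≤ M * ((ℓ ^ 2 - 1) * μ) := by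
    calc m * ((ℓ ^ 2 - 1) * μ) ≤ m * ((μ ^ 2 - 1) * ℓ) := by gcongr
      _ = _ := by linarith
  exact le_of_mul_le_mul_right h3 h1

theorem sq_eq_of_quadratic {μ m M : ℝ} (hμ : 1 < μ) (hm : 0 < m) (hM : 0 < M)
    (hq : m * (μ ^ 2 - 1) ^ 2 = 4 * M * μ ^ 2) :
    μ ^ 2 = (1 + √(1 - m / (m + M))) / (1 - √(1 - m / (m + M))) := by
  have hr : √(1 - m / (m + M)) = (μ ^ 2 - 1) / (μ ^ 2 + 1) := by
    have h0 : 0 ≤ (μ ^ 2 - 1) / (μ ^ 2 + 1) := div_nonneg (by nlinarith) (by positivity)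
    have h1 : 1 - m / (m + M) = ((μ ^ 2 - 1) / (μ ^ 2 + 1)) ^ 2 := by
      have : m + M ≠ 0 := by positivity
      field_simp
      linear_combination -hq
    rw [h1, Real.sqrt_sq h0]
  rw [hr]
  field_simp
  ring

/-- After inserting `q`, the difference has numerator `s ^ 2 * t - (s - 1) * (t + 1) ^ 2`, which
factors as `(s - (t + 1)) * (s * t - (t + 1))`; the second factor is always positive. -/
theorem four_sub_lt_iff {t q s : ℝ} (ht : 1 < t) (hs : 2 ≤ s)
    (hq : q * (t + 1) ^ 2 = 4 * s * t) : 0 < 4 * s - 4 - 4 * t ↔ 4 - 4 / s < q := by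
  have hs0 : 0 < s := by linarith
  have h1 : 4 - 4 / s < q ↔ 0 < t * (s - (t + 1)) * (s * t - (t + 1)) := by
    have e1 : q = 4 * s * t / (t + 1) ^ 2 := by rw [eq_div_iff (by positivity)]; exact hq
    have e2 : 4 - 4 / s = 4 * (s - 1) / s := by field_simp
    rw [e1, e2, div_lt_div_iff₀ hs0 (by positivity)]
    constructor <;> intro h <;> nlinarith
  rw [h1]
  have h2 : 0 < s * t - (t + 1) := by nlinarith
  constructor
  · intro h; exact mul_pos (mul_pos (by linarith) (by linarith)) h2
  · intro h
    have := (mul_pos_iff_of_pos_right h2).1 h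
    have := (mul_pos_iff_of_pos_left (show 0 < t by linarith)).1 this
    linarith

/-- This is the worst case of Δ, with `x` and `y` the signed values of the quadratic form at `X` and
`ν`, and the squared norms replaced by their spectral bounds. -/
theorem extremal_bound {μ ℓ x y : ℝ} (hℓ1 : 1 < ℓ) (hℓμ : ℓ ≤ μ) (hrel : μ * ℓ = μ + ℓ + 1)
    (hx : -ℓ ≤ x) (hx' : x ≤ μ) (hy' : y ≤ μ) :
    2 * ((μ - ℓ) * x + μ * ℓ) + 2 * ((μ - ℓ) * y + μ * ℓ) + x * y - y ^ 2 < 4 * μ ^ 2 + 4 := by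
  -- From `(μ - 1) * (ℓ - 1) = 2` and `ℓ ≤ μ` one gets `ℓ ≤ 1 + √2`; the rounder bound leaves enough
  -- room below.
  have hℓ : ℓ < 5 / 2 := by
    by_contra! hge
    nlinarith
  have h1 : (μ - ℓ) * x + μ * ℓ ≤ μ ^ 2 := by nlinarith [mul_nonneg (sub_nonneg.2 hℓμ) (sub_nonneg.2 hx')]
  rcases le_or_gt 0 y with hy | hy
  · have h2 : x * y ≤ μ * y := by gcongr
    -- The two factors add up to `2 * ℓ - μ ≤ ℓ`, so when both are nonnegative their product is at
    -- most `ℓ ^ 2 / 4`.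
    have h3 : (μ - y) * (y - 2 * μ + 2 * ℓ) < 4 := by
      rcases le_or_gt (y - 2 * μ + 2 * ℓ) 0 with h | h
      · have := mul_nonpos_of_nonneg_of_nonpos (sub_nonneg.2 hy') h
        linarith
      · nlinarith [sq_nonneg ((μ - y) - (y - 2 * μ + 2 * ℓ)), sub_nonneg.2 hy']
    nlinarith
  · have h2 : x * y ≤ -ℓ * y := by nlinarith
    have h3 : (μ - ℓ) * y ≤ 0 := mul_nonpos_of_nonneg_of_nonpos (sub_nonneg.2 hℓμ) hy.le
    nlinarith [sq_nonneg (2 * y + ℓ)]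

end

/-- Spectral bounds for a symmetric operator with spectrum in an interval. -/
theorem LinearMap.IsSymmetric.spectral_bounds {T : Type*} [NormedAddCommGroup T]
    [InnerProductSpace ℝ T] [FiniteDimensional ℝ T] {A : T →ₗ[ℝ] T} (hA : A.IsSymmetric)
    {l u : ℝ} (hspec : ∀ κ, Module.End.HasEigenvalue A κ → l ≤ κ ∧ κ ≤ u) {x : T} (hx : ‖x‖ = 1) :
    l ≤ ⟪A x, x⟫_ℝ ∧ ⟪A x, x⟫_ℝ ≤ u ∧ ‖A x‖ ^ 2 ≤ (l + u) * ⟪A x, x⟫_ℝ - l * u := by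
  set B := hA.eigenvectorBasis rfl
  set k := hA.eigenvalues rfl
  have hk : ∀ i, l ≤ k i ∧ k i ≤ u := fun i => hspec _ (hA.hasEigenvalue_eigenvalues rfl i)
  have hAB : ∀ i, ⟪B i, A x⟫_ℝ = k i * ⟪B i, x⟫_ℝ := fun i => by
    rw [← hA, hA.apply_eigenvectorBasis rfl i, inner_smul_left]; rfl
  have s0 : ∑ i, ⟪B i, x⟫_ℝ ^ 2 = 1 := by
    rw [← one_pow 2, ← hx, ← B.sum_sq_norm_inner_right x]; simp
  have s1 : ∑ i, k i * ⟪B i, x⟫_ℝ ^ 2 = ⟪A x, x⟫_ℝ := by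
    rw [← B.sum_inner_mul_inner (A x) x]
    refine Finset.sum_congr rfl fun i _ => ?_
    rw [real_inner_comm (B i) (A x), hAB]; ring
  have s2 : ∑ i, k i ^ 2 * ⟪B i, x⟫_ℝ ^ 2 = ‖A x‖ ^ 2 := by
    rw [← B.sum_sq_norm_inner_right (A x)]
    refine Finset.sum_congr rfl fun i _ => ?_
    rw [Real.norm_eq_abs, sq_abs, hAB]; ring
  refine ⟨?_, ?_, ?_⟩
  · calc l = ∑ i, l * ⟪B i, x⟫_ℝ ^ 2 := by rw [← Finset.mul_sum, s0, mul_one]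
      _ ≤ _ := by rw [← s1]; gcongr with i; exact (hk i).1
  · calc _ ≤ ∑ i, u * ⟪B i, x⟫_ℝ ^ 2 := by rw [← s1]; gcongr with i; exact (hk i).2
      _ = u := by rw [← Finset.mul_sum, s0, mul_one]
  · calc ‖A x‖ ^ 2 ≤ ∑ i, ((l + u) * (k i * ⟪B i, x⟫_ℝ ^ 2) - l * u * ⟪B i, x⟫_ℝ ^ 2) := by
          rw [← s2]
          refine Finset.sum_le_sum fun i _ => ?_
          -- The chord bound `(k i - l) * (u - k i) ≥ 0` makes the squared eigenvalue linear in the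
          -- eigenvalue.
          have := mul_nonneg (sub_nonneg.2 (hk i).1) (sub_nonneg.2 (hk i).2)
          nlinarith [mul_nonneg this (sq_nonneg ⟪B i, x⟫_ℝ)]
      _ = _ := by rw [Finset.sum_sub_distrib, ← Finset.mul_sum, ← Finset.mul_sum, s0, s1, mul_one]

/-! ### The spectrum seen from a curvature of largest absolute value -/

namespace SphereHypersurface

variable {n : ℕ} {f : UnitSphere n → ℝ} {c : ℝ} {m₁ m₂ : ℕ}

/-- The principal curvatures of a minimal level set seen from a principal curvature `ε * k` of
largest absolute value: the extreme ones are `ε * k` and `-ε * l`. -/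
theorem extremal_structure (hf : IsIsoparametric f) (hc : IsAttainedRegularValue f c)
    (hmin : IsMinimalLevel f c) (hg : HasFourPrincipalCurvatures f c m₁ m₂) {p : UnitSphere n}
    (hp : f p = c) {μ : ℝ} (hμ : μ ∈ principalCurvatures f p)
    (hmax : ∀ κ ∈ principalCurvatures f p, |κ| ≤ |μ|) :
    ∃ ε k l : ℝ, ε ^ 2 = 1 ∧ μ = ε * k ∧ 1 < l ∧ l ≤ k ∧ k * l = k + l + 1 ∧
      ((min m₁ m₂ : ℕ) : ℝ) * (k ^ 2 - 1) ^ 2 = 4 * (m₁ + m₂ - (min m₁ m₂ : ℕ)) * k ^ 2 ∧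
      multiplicity f p μ = min m₁ m₂ ∧ -ε / k ∈ principalCurvatures f p ∧
      ∀ κ ∈ principalCurvatures f p, -l ≤ ε * κ ∧ ε * κ ≤ k := by
  obtain ⟨κ, hκ, hr, d0, d1, d2, d3, r02, r13, rel, tr, -, hm₁, hm₂⟩ :=
    principal_structure hf hc hmin hg hp
  have h10 := hκ (show (0 : Fin 4) < 1 by decide)
  have h21 := hκ (show (1 : Fin 4) < 2 by decide)
  have h32 := hκ (show (2 : Fin 4) < 3 by decide)
  have hm₁' : (0 : ℝ) < m₁ := by exact_mod_cast hm₁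
  have hm₂' : (0 : ℝ) < m₂ := by exact_mod_cast hm₂
  obtain ⟨e0, e3, e, et⟩ := extremal_relations (μ := κ 0) (ℓ := -κ 3) (m := m₁) (M := m₂) r02
    (by rw [neg_neg]; exact r13) h10 h21 (by rw [neg_neg]; exact h32)
    (by rw [neg_neg]; exact rel) (by rw [neg_neg]; exact tr)
  have hb : ∀ x ∈ principalCurvatures f p, κ 3 ≤ x ∧ x ≤ κ 0 := by
    intro x hx
    rw [hr] at hx
    obtain ⟨j, rfl⟩ := hx
    exact ⟨hκ.antitone (Fin.le_last j), hκ.antitone (Fin.zero_le j)⟩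
  have hmem : ∀ j, κ j ∈ principalCurvatures f p := fun j => hr ▸ mem_range_self j
  have hκ1 : 0 < κ 1 := by nlinarith
  have hκ2 : κ 2 < 0 := by nlinarith
  have a0 : |κ 0| = κ 0 := abs_of_pos (by linarith)
  have a3 : |κ 3| = -κ 3 := abs_of_neg (by linarith)
  have hμ' := hμ
  rw [hr] at hμ'
  obtain ⟨j, rfl⟩ := hμ'
  -- The middle curvatures are excluded, since `0 < κ 1 < κ 0` and `κ 3 < κ 2 < 0`.
  have hj : j = 0 ∨ j = 3 := by
    have t0 := hmax _ (hmem 0)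
    have t3 := hmax _ (hmem 3)
    rw [a0] at t0
    rw [a3] at t3
    fin_cases j
    · exact Or.inl rfl
    · change κ 0 ≤ |κ 1| at t0
      rw [abs_of_pos hκ1] at t0; linarith
    · change -κ 3 ≤ |κ 2| at t3
      rw [abs_of_neg hκ2] at t3; linarith
    · exact Or.inr rfl
  rcases hj with rfl | rfl
  · have hle : -κ 3 ≤ κ 0 := by simpa [a0, a3] using hmax _ (hmem 3)
    have hm : m₁ ≤ m₂ := by exact_mod_cast le_of_extremal e0 e3 hle hm₁' et
    refine ⟨1, κ 0, -κ 3, by norm_num, by ring, e3, hle, e, ?_, ?_, ?_, ?_⟩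
    · rw [min_eq_left hm, add_sub_cancel_left]
      exact extremal_quadratic e0 e et
    · rw [d0, min_eq_left hm]
    · have : -1 / κ 0 = κ 2 := by rw [div_eq_iff (by linarith)]; linarith
      rw [this]; exact hmem 2
    · intro x hx
      have := hb x hx
      constructor <;> linarith
  -- The mirror case: the sign `ε = -1` exchanges the two ends and the two multiplicities.
  · have hle : κ 0 ≤ -κ 3 := by simpa [a0, a3] using hmax _ (hmem 0)
    have hm : m₂ ≤ m₁ := by exact_mod_cast le_of_extremal e3 e0 hle hm₂' et.symm
    refine ⟨-1, -κ 3, κ 0, by norm_num, by ring, e0, hle, by linarith, ?_, ?_, ?_, ?_⟩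
    · rw [min_eq_right hm, add_sub_cancel_right]
      exact extremal_quadratic e3 (by linarith) et.symm
    · rw [d3, min_eq_right hm]
    · have : - -1 / -κ 3 = κ 1 := by rw [div_eq_iff (by linarith)]; linarith
      rw [this]; exact hmem 1
    · intro x hx
      have := hb x hx
      constructor <;> linarith

theorem exists_maximal_principalCurvature (hg : HasFourPrincipalCurvatures f c m₁ m₂)
    {p : UnitSphere n} (hp : f p = c) :
    ∃ μ ∈ principalCurvatures f p, ∀ κ ∈ principalCurvatures f p, |κ| ≤ |μ| := by
  obtain ⟨κ, -, hr, -⟩ := hg p hp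
  obtain ⟨j, -, hj⟩ := Finset.exists_max_image Finset.univ (fun j => |κ j|) ⟨0, Finset.mem_univ _⟩
  refine ⟨κ j, hr ▸ mem_range_self j, fun x hx => ?_⟩
  rw [hr] at hx
  obtain ⟨i, rfl⟩ := hx
  exact hj i (Finset.mem_univ i)

theorem exists_unit_mem_curvatureSpace {p : UnitSphere n} {μ : ℝ}
    (hμ : μ ∈ principalCurvatures f p) : ∃ X ∈ curvatureSpace f p μ, ‖X‖ = 1 := by
  obtain ⟨v, hv⟩ := Module.End.HasEigenvalue.exists_hasEigenvector hμ
  refine ⟨‖v‖⁻¹ • v, Submodule.smul_mem _ _ hv.1, ?_⟩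
  rw [norm_smul, norm_inv, norm_norm, inv_mul_cancel₀ (norm_ne_zero_iff.2 hv.2)]

theorem exists_orthonormal_pair_curvatureSpace {p : UnitSphere n} {μ : ℝ}
    (h : 2 ≤ multiplicity f p μ) : ∃ X ∈ curvatureSpace f p μ, ∃ ν ∈ curvatureSpace f p μ,
      ‖X‖ = 1 ∧ ‖ν‖ = 1 ∧ inner ℝ X ν = 0 := by
  set B := stdOrthonormalBasis ℝ (curvatureSpace f p μ)
  refine ⟨B ⟨0, by unfold multiplicity at h; omega⟩, Subtype.mem _,
    B ⟨1, by unfold multiplicity at h; omega⟩, Subtype.mem _, B.orthonormal.1 _, B.orthonormal.1 _,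
    B.orthonormal.2 (by simp)⟩

end SphereHypersurface

/-! ### Positivity of Δ and conclusion -/

open SphereHypersurface in
theorem acsDelta_pos {n : ℕ} {f : UnitSphere n → ℝ} {a b : ℝ → ℝ}
    (h : RadialIsoparametric (radialExt f) a b) {p : UnitSphere n} (hp : grad f p ≠ 0)
    (htr : LinearMap.trace ℝ _ (shapeOperator f p) = 0) {ε k l : ℝ} (hε : ε ^ 2 = 1) (hl : 1 < l)
    (hlk : l ≤ k) (hrel : k * l = k + l + 1)
    (hspec : ∀ κ ∈ principalCurvatures f p, -l ≤ ε * κ ∧ ε * κ ≤ k)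
    (hn : 4 * k ^ 2 + 4 ≤ 2 * (n : ℝ) - 2) (X ν : tangentSpace f p) (hX : ‖X‖ = 1) (hν : ‖ν‖ = 1)
    (hXν : inner ℝ X ν = 0) : 0 < acsDelta f p X ν := by
  rw [acsDelta_eq h hp htr X ν hX hν hXν]
  have hsym := isSymmetric_shapeOperator h hp
  have hbd : ∀ x : tangentSpace f p, ‖x‖ = 1 → -l ≤ ε * ⟪shapeOperator f p x, x⟫_ℝ ∧
      ε * ⟪shapeOperator f p x, x⟫_ℝ ≤ k ∧ ‖shapeOperator f p x‖ ^ 2 ≤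
        (k - l) * (ε * ⟪shapeOperator f p x, x⟫_ℝ) + k * l := by
    intro x hx
    -- For `ε = -1` the spectrum lies in `[-k, l]` instead of `[-l, k]`; multiplying by `ε` makes
    -- the bounds agree.
    rcases sq_eq_sq_iff_eq_or_eq_neg.1 (hε.trans (one_pow 2).symm) with rfl | rfl
    · obtain ⟨b1, b2, b3⟩ := hsym.spectral_bounds (l := -l) (u := k)
        (fun κ hκ => by simpa using hspec κ hκ) hx
      refine ⟨by linarith, by linarith, by linarith⟩
    · obtain ⟨b1, b2, b3⟩ := hsym.spectral_bounds (l := -k) (u := l)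
        (fun κ hκ => by have := hspec κ hκ; constructor <;> linarith) hx
      refine ⟨by linarith, by linarith, by linarith⟩
  obtain ⟨x1, x2, x3⟩ := hbd X hX
  obtain ⟨y1, y2, y3⟩ := hbd ν hν
  have hb := extremal_bound hl hlk hrel x1 x2 y2
  have hz := sq_nonneg ⟪shapeOperator f p X, ν⟫_ℝ
  have e1 : ε * ⟪shapeOperator f p X, X⟫_ℝ * (ε * ⟪shapeOperator f p ν, ν⟫_ℝ) =
      ⟪shapeOperator f p X, X⟫_ℝ * ⟪shapeOperator f p ν, ν⟫_ℝ := by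
    linear_combination (⟪shapeOperator f p X, X⟫_ℝ * ⟪shapeOperator f p ν, ν⟫_ℝ) * hε
  have e2 : (ε * ⟪shapeOperator f p ν, ν⟫_ℝ) ^ 2 = ⟪shapeOperator f p ν, ν⟫_ℝ ^ 2 := by
    rw [mul_pow, hε, one_mul]
  rw [e1, e2] at hb
  linarith

end

theorem mainTheorem3 {n : ℕ} (f : SphereHypersurface.UnitSphere n → ℝ) (c : ℝ) (m₁ m₂ : ℕ)
    (hf : SphereHypersurface.IsIsoparametric f)
    (hc : SphereHypersurface.IsAttainedRegularValue f c)
    (hmin : SphereHypersurface.IsMinimalLevel f c)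
    (hg : SphereHypersurface.HasFourPrincipalCurvatures f c m₁ m₂) :
    (∀ p : SphereHypersurface.UnitSphere n, f p = c →
      ∀ μ ∈ SphereHypersurface.principalCurvatures f p,
        (∀ κ ∈ SphereHypersurface.principalCurvatures f p, |κ| ≤ |μ|) →
        SphereHypersurface.multiplicity f p μ = min m₁ m₂ ∧
        μ ^ 2 = (1 + √(1 - (min m₁ m₂ : ℕ) / ((m₁ : ℝ) + m₂))) /
          (1 - √(1 - (min m₁ m₂ : ℕ) / ((m₁ : ℝ) + m₂))) ∧
        (∀ X ∈ SphereHypersurface.curvatureSpace f p μ,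
          ∀ ν ∈ SphereHypersurface.curvatureSpace f p μ,
            ‖X‖ = 1 → ‖ν‖ = 1 → inner ℝ X ν = 0 →
            SphereHypersurface.acsDelta f p X ν = (2 * (n : ℝ) - 2) - 4 * μ ^ 2) ∧
        (0 < (2 * (n : ℝ) - 2) - 4 * μ ^ 2 ↔
          4 - 4 / ((m₁ : ℝ) + m₂) < ((min m₁ m₂ : ℕ) : ℝ))) ∧
    ((∀ p : SphereHypersurface.UnitSphere n, f p = c →
        ∀ X ∈ SphereHypersurface.tangentSpace f p, ∀ ν ∈ SphereHypersurface.tangentSpace f p,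
          ‖X‖ = 1 → ‖ν‖ = 1 → inner ℝ X ν = 0 → 0 < SphereHypersurface.acsDelta f p X ν) ↔
      4 ≤ min m₁ m₂) := by
  obtain ⟨a, b, h⟩ := hf.exists_radialIsoparametric
  obtain ⟨p₀, hp₀⟩ := hc.1
  obtain ⟨-, -, -, -, -, -, -, -, -, -, -, hn, hm₁, hm₂⟩ :=
    SphereHypersurface.principal_structure hf hc hmin hg hp₀
  have hn' : (n : ℝ) + 1 = 2 * (m₁ + m₂) := by exact_mod_cast hn
  have hm : 0 < min m₁ m₂ := lt_min hm₁ hm₂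
  have hm' : (0 : ℝ) < (min m₁ m₂ : ℕ) := by exact_mod_cast hm
  have hs2 : (2 : ℝ) ≤ m₁ + m₂ := by exact_mod_cast (by omega : 2 ≤ m₁ + m₂)
  have hM' : (0 : ℝ) < m₁ + m₂ - (min m₁ m₂ : ℕ) := by
    have : min m₁ m₂ + 1 ≤ m₁ + m₂ := by omega
    have : ((min m₁ m₂ : ℕ) : ℝ) + 1 ≤ m₁ + m₂ := by exact_mod_cast this
    linarith
  have part1 : ∀ p : SphereHypersurface.UnitSphere n, f p = c →
      ∀ μ ∈ SphereHypersurface.principalCurvatures f p,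
        (∀ κ ∈ SphereHypersurface.principalCurvatures f p, |κ| ≤ |μ|) →
        SphereHypersurface.multiplicity f p μ = min m₁ m₂ ∧
        μ ^ 2 = (1 + √(1 - (min m₁ m₂ : ℕ) / ((m₁ : ℝ) + m₂))) /
          (1 - √(1 - (min m₁ m₂ : ℕ) / ((m₁ : ℝ) + m₂))) ∧
        (∀ X ∈ SphereHypersurface.curvatureSpace f p μ,
          ∀ ν ∈ SphereHypersurface.curvatureSpace f p μ,
            ‖X‖ = 1 → ‖ν‖ = 1 → inner ℝ X ν = 0 →
            SphereHypersurface.acsDelta f p X ν = (2 * (n : ℝ) - 2) - 4 * μ ^ 2) ∧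
        (0 < (2 * (n : ℝ) - 2) - 4 * μ ^ 2 ↔
          4 - 4 / ((m₁ : ℝ) + m₂) < ((min m₁ m₂ : ℕ) : ℝ)) := by
    intro p hp μ hμ hmax
    obtain ⟨ε, k, l, hε, hμk, hl, hlk, -, hq, hmult, -⟩ :=
      SphereHypersurface.extremal_structure hf hc hmin hg hp hμ hmax
    have hk : 1 < k := hl.trans_le hlk
    have hμ2 : μ ^ 2 = k ^ 2 := by rw [hμk, mul_pow, hε, one_mul]
    refine ⟨hmult, ?_, ?_, ?_⟩
    · have := sq_eq_of_quadratic hk hm' hM' hq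
      rw [add_sub_cancel] at this
      rw [hμ2]
      exact this
    · intro X hX ν hν h1 h2 h3
      exact SphereHypersurface.acsDelta_eq_of_mem_curvatureSpace h (hc.2 p hp) (hmin p hp) hX hν h1 h2 h3
    · have key := four_sub_lt_iff (t := k ^ 2) (q := (min m₁ m₂ : ℕ)) (s := (m₁ : ℝ) + m₂)
        (by nlinarith) hs2 (by linear_combination hq)
      rw [← key, hμ2]
      have : 2 * (n : ℝ) - 2 - 4 * k ^ 2 = 4 * (m₁ + m₂) - 4 - 4 * k ^ 2 := by linarith
      rw [this]
  refine ⟨part1, fun hpos => ?_, fun hq4 p hp X hX ν hν h1 h2 h3 => ?_⟩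
  · obtain ⟨μ, hμ, hmax⟩ := SphereHypersurface.exists_maximal_principalCurvature hg hp₀
    obtain ⟨hmult, -, hΔ, hiff⟩ := part1 p₀ hp₀ μ hμ hmax
    by_contra! hlt
    -- A simple extremal curvature admits no orthonormal pair in its eigenspace; then `ν` is taken
    -- with curvature `-ε / k = -1 / μ`.
    rcases Nat.lt_or_ge (min m₁ m₂) 2 with hlt2 | hge2
    · obtain ⟨ε, k, l, hε, hμk, hl, hlk, -, hq, -, hmem, -⟩ :=
        SphereHypersurface.extremal_structure hf hc hmin hg hp₀ hμ hmax
      have hk : 1 < k := hl.trans_le hlk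
      have hk0 : k ≠ 0 := by linarith
      obtain ⟨X, hX, hX1⟩ := SphereHypersurface.exists_unit_mem_curvatureSpace hμ
      obtain ⟨ν, hν, hν1⟩ := SphereHypersurface.exists_unit_mem_curvatureSpace hmem
      have hsym := SphereHypersurface.isSymmetric_shapeOperator h (hc.2 p₀ hp₀)
      have hne : μ ≠ -ε / k := by
        intro he
        rw [hμk, eq_div_iff hk0] at he
        have : ε ^ 2 * (k ^ 2 + 1) = 0 := by linear_combination ε * he
        rw [hε] at this
        nlinarith
      have hXν : inner ℝ X ν = 0 := hsym.orthogonalFamily_eigenspaces hne ⟨X, hX⟩ ⟨ν, hν⟩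
      have hp := hpos p₀ hp₀ X X.2 ν ν.2 hX1 hν1 hXν
      rw [SphereHypersurface.acsDelta_eq h (hc.2 p₀ hp₀) (hmin p₀ hp₀) X ν hX1 hν1 hXν,
        Module.End.mem_eigenspace_iff.1 hX, Module.End.mem_eigenspace_iff.1 hν] at hp
      have e2 : inner ℝ X X = (1 : ℝ) := by rw [real_inner_self_eq_norm_sq, hX1, one_pow]
      have e3 : inner ℝ ν ν = (1 : ℝ) := by rw [real_inner_self_eq_norm_sq, hν1, one_pow]
      have i1 : ∀ (t : ℝ) (x y : SphereHypersurface.tangentSpace f p₀),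
          inner ℝ (t • x) y = t * inner ℝ x y := fun t x y =>
        real_inner_smul_left (x : SphereHypersurface.Ambient n) y t
      have i2 : ∀ (t : ℝ) (x : SphereHypersurface.tangentSpace f p₀), ‖t • x‖ = |t| * ‖x‖ :=
        fun t x => norm_smul t x
      rw [i2, i2, i1, i1, i1, hX1, hν1, hXν, e2, e3] at hp
      simp only [mul_one, sq_abs, mul_zero] at hp
      have h1 : ((min m₁ m₂ : ℕ) : ℝ) = 1 := by exact_mod_cast (by omega : min m₁ m₂ = 1)
      rw [h1] at hq
      have hμ2 : μ ^ 2 = k ^ 2 := by rw [hμk, mul_pow, hε, one_mul]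
      have hx2 : (-ε / k) ^ 2 = 1 / k ^ 2 := by rw [div_pow, neg_sq, hε]
      have hxμ : μ * (-ε / k) = -1 := by
        rw [hμk]; field_simp; linarith
      rw [hμ2, hx2, hxμ] at hp
      have h4 : 4 * ((m₁ : ℝ) + m₂) = k ^ 2 + 2 + 1 / k ^ 2 := by
        field_simp
        linear_combination -hq
      -- Substituting this, Δ for the mixed pair equals `-k ^ 2 - 1`.
      have h5 : 2 * (n : ℝ) = k ^ 2 + 1 / k ^ 2 := by linarith
      nlinarith
    · obtain ⟨X, hX, ν, hν, hX1, hν1, hXν⟩ :=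
        SphereHypersurface.exists_orthonormal_pair_curvatureSpace (hmult ▸ hge2)
      have hp := hpos p₀ hp₀ X X.2 ν ν.2 hX1 hν1 hXν
      rw [hΔ X hX ν hν hX1 hν1 hXν, hiff] at hp
      have h3 : ((min m₁ m₂ : ℕ) : ℝ) ≤ 3 := by exact_mod_cast (by omega : min m₁ m₂ ≤ 3)
      -- Both multiplicities are at least 2, so `4 - 4 / s ≥ 3 ≥ q`, against the criterion of part
      -- (1).
      have h4 : (4 : ℝ) ≤ m₁ + m₂ := by exact_mod_cast (by omega : 4 ≤ m₁ + m₂)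
      have h5 : 4 / ((m₁ : ℝ) + m₂) ≤ 1 := by rw [div_le_one (by linarith)]; exact h4
      linarith
  · obtain ⟨μ, hμ, hmax⟩ := SphereHypersurface.exists_maximal_principalCurvature hg hp
    obtain ⟨ε, k, l, hε, hμk, hl, hlk, hrel, hq, -, -, hspec⟩ :=
      SphereHypersurface.extremal_structure hf hc hmin hg hp hμ hmax
    have hk : 1 < k := hl.trans_le hlk
    refine acsDelta_pos h (hc.2 p hp) (hmin p hp) hε hl hlk hrel hspec ?_ ⟨X, hX⟩ ⟨ν, hν⟩ h1 h2 h3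
    have hq4' : (4 : ℝ) ≤ (min m₁ m₂ : ℕ) := by exact_mod_cast hq4
    have e1 : ((min m₁ m₂ : ℕ) : ℝ) * (k ^ 2 + 1) ^ 2 = 4 * (m₁ + m₂) * k ^ 2 := by
      linear_combination hq
    -- With `q ≥ 4` this gives `k ^ 2 + 2 ≤ s`, which is the needed `4 * k ^ 2 + 4 ≤ 2 * n - 2`
    -- because `n + 1 = 2 * s`.
    have e2 : (k ^ 2 + 1) ^ 2 ≤ ((m₁ : ℝ) + m₂) * k ^ 2 := by
      nlinarith [sq_nonneg (k ^ 2 + 1)]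
    have e3 : k ^ 2 * (k ^ 2 + 2) ≤ k ^ 2 * ((m₁ : ℝ) + m₂) := by nlinarith
    have e4 : k ^ 2 + 2 ≤ (m₁ : ℝ) + m₂ := le_of_mul_le_mul_left e3 (by positivity)
    linarith
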